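/- Let $n\ge 1$, let $\Lambda=\bigoplus_{k=0}^n\Lambda^k$ be the complex exterior algebra over $\mathbb R^n$ with its standard Hermitian inner product, and for $1<p<\infty$ let $d$ and $d^*$ be the exterior derivative and its formal adjoint, acting in $L^p(\mathbb R^n;\Lambda)$ in the sense of distributions on their maximal domains. For an unbounded operator $A$ in $L^p$ let $\mathcal D_p(A)$, $\mathcal R_p(A)$ and $\mathcal N_p(A)$ be its domain, range and null space. Let $B_1,B_2\in L^\infty(\mathbb R^n;\mathcal L(\Lambda))$ preserve the degree of forms, that is, $B_j=B_j^0\oplus\dots\oplus B_j^n$ with $B_j^k\in L^\infty(\mathbb R^n;\mathcal L(\Lambda^k))$. Suppose that $\Pi_B=d+B_1d^*B_2$ is a perturbed Hodge-Dirac operator, that is: - $\mathcal R_2(B_2B_1d^*)\subset\mathcal N_2(d^*)$ and $\mathcal R_2(B_1B_2d)\subset\mathcal N_2(d)$; - for some $\kappa_1,\kappa_2>0$, $\operatorname{Re}(B_1u,u)\ge\kappa_1\|u\|_2^2$ for all $u\in\mathcal R_2(d^*)$ and $\operatorname{Re}(B_2u,u)\ge\kappa_2\|u\|_2^2$ for all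 $u\in\mathcal R_2(d)$. In $L^p$ the operators $B_1d^*B_2$ and $\Pi_B$ have domains $\{u\in L^p: B_2u\in\mathcal D_p(d^*)\}$ and $\mathcal D_p(d)\cap\mathcal D_p(B_1d^*B_2)$. For $1<p<\infty$ and $\frac1p+\frac1{p'}=1$ let $(\Pi_B(p))$ be the condition that there is a constant $C$ with $\|u\|_p\le C\|B_1u\|_p$ for all $u\in\overline{\mathcal R_p(d^*)}$ and $\|v\|_{p'}\le C\|B_2^*v\|_{p'}$ for all $v\in\overline{\mathcal R_{p'}(d)}$. One says that $\Pi_B$ Hodge decomposes $L^p(\mathbb R^n;\Lambda)$ if $(\Pi_B(p))$ holds and there is a splitting into complemented subspaces $$L^p(\mathbb R^n;\Lambda)=\mathcal N_p(\Pi_B)\oplus\overline{\mathcal R_p(\Pi_B)}=\mathcal N_p(\Pi_B)\oplus\overline{\mathcal R_p(d)}\oplus\overline{\mathcal R_p(B_1d^*B_2)}.$$ Let $(p_H,p^H)$ denote the set of all $p\in(1,\infty)$ for which $\Pi_B$ Hodge decomposes $L^p(\mathbb R^n;\Lambda)$. For $0\le\theta<\frac\pi2$ let $S_\theta=\{0\}\cup\{z\neq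 0:|\arg z|\le\theta\text{ or }|\arg(-z)|\le\theta\}$, and for $0<\mu<\frac\pi2$ let $S^o_\mu=\{z\ne0:|\arg z|<\mu\text{ or }|\arg(-z)|<\mu\}$. A closed operator $D$ is $\omega$-bisectorial if its spectrum lies in $S_\omega$ and, for every $\theta\in(\omega,\frac\pi2)$, $\lambda(\lambda I-D)^{-1}$ is uniformly bounded for $\lambda\in\mathbb C\setminus S_\theta$. It has a bounded $H^\infty$ functional calculus with angle $\mu\in(\omega,\frac\pi2)$ if there is $C>0$ with $\|\psi(D)\|\le C\sup_{S^o_\mu}|\psi|$ for all holomorphic $\psi$ on $S_\mu^o$ such that $|\psi(z)|\le c|z|^\alpha(1+|z|^{\alpha+\beta})^{-1}$ on $S^o_\mu$ for some $\alpha,\beta,c>0$; here $\psi(D)=\frac1{2\pi i}\int_{\partial S_\theta}\psi(z)(zI-D)^{-1}\,dz$ with $\theta\in(\omega,\mu)$ and $\partial S_\theta$ oriented counter-clockwise. Let $p\in(1,\infty)$. Suppose that $(\Pi_B(p))$ holds and that $\Pi_B$ is $\omega$-bisectorial in $L^p(\mathbb R^n;\Lambda)$, for some $\omega\in[0,\frac\pi2)$,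 with a bounded $H^\infty$ functional calculus in $L^p(\mathbb R^n;\Lambda)$ with some angle $\mu\in(\omega,\frac\pi2)$. Then $p\in(p_H,p^H)$; that is, $\Pi_B$ Hodge decomposes $L^p(\mathbb R^n;\Lambda)$. -/

import Mathlib

open MeasureTheory Set
open scoped ENNReal

noncomputable section

namespace HodgeDirac

/-! ### Unbounded operators: null space, range, bisectoriality, functional calculus -/

section Operators

variable {X : Type*} [NormedAddCommGroup X] [NormedSpace ℂ X]

/-- The null space of an unbounded operator, as a subspace of the ambient space. -/
def nullSpace (D : X →ₗ.[ℂ] X) : Submodule ℂ X :=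
  (LinearMap.ker D.toFun).map D.domain.subtype

/-- The range of an unbounded operator. -/
def rangeSpace (D : X →ₗ.[ℂ] X) : Submodule ℂ X :=
  LinearMap.range D.toFun

/-- The composition `D ∘ T` of an unbounded operator with a bounded one, with its natural domain
`{u | T u ∈ dom D}`. -/
def precomp (D : X →ₗ.[ℂ] X) (T : X →L[ℂ] X) : X →ₗ.[ℂ] X where
  domain := D.domain.comap T.toLinearMap
  toFun := D.toFun.comp (T.toLinearMap.restrict (fun _ hx => hx))

/-- `R` is the bounded two-sided inverse of `lam - D`. -/
def IsResolventAt (D : X →ₗ.[ℂ] X) (lam : ℂ) (R : X →L[ℂ] X) : Prop :=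
  (∀ x : X, ∃ h : R x ∈ D.domain, lam • R x - D ⟨R x, h⟩ = x) ∧
    ∀ x : D.domain, R (lam • (x : X) - D x) = x

/-- The resolvent set: the complement of the spectrum `σ(D)`. -/
def resolventSet (D : X →ₗ.[ℂ] X) : Set ℂ :=
  {lam | ∃ R : X →L[ℂ] X, IsResolventAt D lam R}

open Classical in
/-- The resolvent `(lam - D)⁻¹` (zero when `lam` is in the spectrum). -/
def resolvent (D : X →ₗ.[ℂ] X) (lam : ℂ) : X →L[ℂ] X :=
  if h : ∃ R : X →L[ℂ] X, IsResolventAt D lam R then h.choose else 0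

/-- The closed double sector of half-angle `ω` around the real axis (it contains `0`). -/
def closedBisector (ω : ℝ) : Set ℂ :=
  {z | z = 0 ∨ |Complex.arg z| ≤ ω ∨ |Complex.arg (-z)| ≤ ω}

/-- The open double sector of half-angle `μ` around the real axis (without `0`). -/
def openBisector (μ : ℝ) : Set ℂ :=
  {z | z ≠ 0 ∧ (|Complex.arg z| < μ ∨ |Complex.arg (-z)| < μ)}

/-- `D` is `ω`-bisectorial: closed, with spectrum in the closed double sector of angle `ω`, and with
`lam (lam - D)⁻¹` uniformly bounded off every larger double sector. -/
structure IsBisectorial (D : X →ₗ.[ℂ] X) (ω : ℝ) : Prop where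
  closed : D.IsClosed
  spectrum : (resolventSet D)ᶜ ⊆ closedBisector ω
  bound : ∀ θ, ω < θ → θ < Real.pi / 2 → ∃ C : ℝ, 0 < C ∧
    ∀ lam ∉ closedBisector θ, ‖lam • resolvent D lam‖ ≤ C

/-- The class `Ψ` on the open double sector: holomorphic functions with
`|ψ(z)| ≤ C |z|^α (1 + |z|^(α+β))⁻¹` for some `α, β, C > 0`. -/
def PsiClass (μ : ℝ) : Set (ℂ → ℂ) :=
  {ψ | DifferentiableOn ℂ ψ (openBisector μ) ∧ ∃ α β C : ℝ, 0 < α ∧ 0 < β ∧ 0 < C ∧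
    ∀ z ∈ openBisector μ, ‖ψ z‖ ≤ C * ‖z‖ ^ α * (1 + ‖z‖ ^ (α + β))⁻¹}

/-- The Cauchy integral `ψ(D) = (2πi)⁻¹ ∫_γ ψ(z) (z - D)⁻¹ dz`, where `γ` is the boundary of the
closed double sector of angle `θ`, oriented counter-clockwise. The four terms are the four rays of
`γ`: the right sector has its ray `r e^{-iθ}` outgoing and its ray `r e^{iθ}` incoming, and the left
sector is the image of the right one under `z ↦ -z`. -/
def psiCalc (D : X →ₗ.[ℂ] X) (θ : ℝ) (ψ : ℂ → ℂ) : X →L[ℂ] X :=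
  let a : ℂ := Complex.exp (Complex.I * θ)
  let b : ℂ := Complex.exp (-(Complex.I * θ))
  let F : ℂ → (X →L[ℂ] X) := fun z => ψ z • resolvent D z
  (2 * Real.pi * Complex.I)⁻¹ • ∫ r : ℝ in Ioi 0,
    (b • F (r * b) - a • F (r * a) - b • F (-(r * b)) + a • F (-(r * a)))

/-- The `ω`-bisectorial operator `D` has a bounded `H^∞` functional calculus with angle `μ`:
`‖ψ(D)‖ ≤ C ‖ψ‖_∞` for all `ψ` in the class `Ψ` on the open double sector of angle `μ`. The number
`M` ranges over the upper bounds of `|ψ|` there. (By Cauchy's theorem `ψ(D)` does not depend on the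
contour angle `θ ∈ (ω, μ)`.) -/
def HasBoundedHInftyCalculus (D : X →ₗ.[ℂ] X) (ω μ : ℝ) : Prop :=
  ∃ θ, ω < θ ∧ θ < μ ∧ ∃ C : ℝ, 0 < C ∧ ∀ ψ ∈ PsiClass μ, ∀ M : ℝ,
    (∀ z ∈ openBisector μ, ‖ψ z‖ ≤ M) → ‖psiCalc D θ ψ‖ ≤ C * M

end Operators

/-! ### First order operators with constant coefficients on `L^p` -/

section FirstOrder

variable {n : ℕ} {E : Type*} [NormedAddCommGroup E] [NormedSpace ℂ E]

/-- `∑ⱼ Aⱼ ∂ⱼ u = f` in the sense of distributions on `ℝⁿ`. -/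
def IsWeakSol (A : Fin n → E →L[ℂ] E) (u f : EuclideanSpace ℝ (Fin n) → E) : Prop :=
  ∀ φ : EuclideanSpace ℝ (Fin n) → ℝ, ContDiff ℝ ((⊤ : ℕ∞) : WithTop ℕ∞) φ → HasCompactSupport φ →
    ∫ x, φ x • f x = -∫ x, ∑ j, fderiv ℝ φ x (EuclideanSpace.single j 1) • A j (u x)

theorem integrable_smul_test {p : ℝ≥0∞} [Fact (1 ≤ p)] {φ : EuclideanSpace ℝ (Fin n) → ℝ}
    (hφ : Continuous φ) (hc : HasCompactSupport φ)
    (f : Lp E p (volume : Measure (EuclideanSpace ℝ (Fin n)))) :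
    Integrable (fun x => φ x • f x) :=
  ((Lp.memLp f).locallyIntegrable Fact.out).integrable_smul_left_of_hasCompactSupport hφ hc

theorem integrable_sum_test {p : ℝ≥0∞} [Fact (1 ≤ p)] (A : Fin n → E →L[ℂ] E)
    {φ : EuclideanSpace ℝ (Fin n) → ℝ} (hφ : ContDiff ℝ ((⊤ : ℕ∞) : WithTop ℕ∞) φ) (hc : HasCompactSupport φ)
    (u : Lp E p (volume : Measure (EuclideanSpace ℝ (Fin n)))) :
    Integrable (fun x => ∑ j, fderiv ℝ φ x (EuclideanSpace.single j 1) • A j (u x)) := by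
  refine integrable_finsetSum _ fun j _ => ?_
  have h1 : Continuous fun x => fderiv ℝ φ x (EuclideanSpace.single j 1) :=
    (hφ.continuous_fderiv (by simp)).clm_apply continuous_const
  have h2 : HasCompactSupport fun x => fderiv ℝ φ x (EuclideanSpace.single j 1) :=
    hc.fderiv_apply ℝ _
  have h3 := (A j).integrable_comp (integrable_smul_test h1 h2 u)
  refine h3.congr (Filter.Eventually.of_forall fun x => ?_)
  exact ((A j).restrictScalars ℝ).map_smul _ _

/-- The graph in `L^p × L^p` of the operator `∑ⱼ Aⱼ ∂ⱼ`, taken in the sense of distributions. -/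
def firstOrderGraph (A : Fin n → E →L[ℂ] E) (p : ℝ≥0∞) [Fact (1 ≤ p)] :
    Submodule ℂ (Lp E p (volume : Measure (EuclideanSpace ℝ (Fin n))) ×
      Lp E p (volume : Measure (EuclideanSpace ℝ (Fin n)))) where
  carrier := {w | IsWeakSol A w.1 w.2}
  zero_mem' := by
    intro φ hφ hc
    have h0 := Lp.coeFn_zero E p (volume : Measure (EuclideanSpace ℝ (Fin n)))
    rw [integral_eq_zero_of_ae, integral_eq_zero_of_ae, neg_zero]
    · filter_upwards [h0] with x hx
      simp only [Prod.fst_zero, hx, Pi.zero_apply, map_zero, smul_zero, Finset.sum_const_zero]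
    · filter_upwards [h0] with x hx
      simp only [Prod.snd_zero, hx, Pi.zero_apply, smul_zero]
  add_mem' := by
    rintro ⟨u, f⟩ ⟨v, g⟩ h1 h2 φ hφ hc
    have e1 : ∫ x, φ x • (f + g) x = ∫ x, (φ x • f x + φ x • g x) := by
      refine integral_congr_ae ?_
      filter_upwards [Lp.coeFn_add f g] with x hx
      rw [hx, Pi.add_apply, smul_add]
    have e2 : ∫ x, ∑ j, fderiv ℝ φ x (EuclideanSpace.single j 1) • A j ((u + v) x) =
        ∫ x, (∑ j, fderiv ℝ φ x (EuclideanSpace.single j 1) • A j (u x) +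
          ∑ j, fderiv ℝ φ x (EuclideanSpace.single j 1) • A j (v x)) := by
      refine integral_congr_ae ?_
      filter_upwards [Lp.coeFn_add u v] with x hx
      simp only [hx, Pi.add_apply, map_add, smul_add, Finset.sum_add_distrib]
    have k1 := h1 φ hφ hc
    have k2 := h2 φ hφ hc
    change ∫ x, φ x • (f + g) x =
      -∫ x, ∑ j, fderiv ℝ φ x (EuclideanSpace.single j 1) • A j ((u + v) x)
    rw [e1, e2, integral_add (integrable_smul_test hφ.continuous hc f)
      (integrable_smul_test hφ.continuous hc g), integral_add (integrable_sum_test A hφ hc u)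
      (integrable_sum_test A hφ hc v), neg_add]
    exact congrArg₂ (· + ·) k1 k2
  smul_mem' := by
    rintro c ⟨u, f⟩ h φ hφ hc
    have e1 : ∫ x, φ x • (c • f) x = ∫ x, c • (φ x • f x) := by
      refine integral_congr_ae ?_
      filter_upwards [Lp.coeFn_smul c f] with x hx
      simp [hx, smul_comm c]
    have e2 : ∫ x, ∑ j, fderiv ℝ φ x (EuclideanSpace.single j 1) • A j ((c • u) x) =
        ∫ x, c • ∑ j, fderiv ℝ φ x (EuclideanSpace.single j 1) • A j (u x) := by
      refine integral_congr_ae ?_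
      filter_upwards [Lp.coeFn_smul c u] with x hx
      simp [hx, Finset.smul_sum, smul_comm c]
    have k := h φ hφ hc
    change ∫ x, φ x • (c • f) x =
      -∫ x, ∑ j, fderiv ℝ φ x (EuclideanSpace.single j 1) • A j ((c • u) x)
    rw [e1, e2, integral_smul, integral_smul, ← smul_neg]
    exact congrArg (c • ·) k

theorem firstOrderGraph_single_valued [CompleteSpace E] (A : Fin n → E →L[ℂ] E) (p : ℝ≥0∞)
    [Fact (1 ≤ p)] : ∀ w ∈ firstOrderGraph A p, w.1 = 0 → w.2 = 0 := by
  rintro ⟨u, f⟩ h (rfl : u = 0)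
  have h0 := Lp.coeFn_zero E p (volume : Measure (EuclideanSpace ℝ (Fin n)))
  rw [Lp.eq_zero_iff_ae_eq_zero]
  refine ae_eq_zero_of_integral_contDiff_smul_eq_zero
    ((Lp.memLp f).locallyIntegrable Fact.out) fun φ hφ hc => ?_
  refine (h φ hφ hc).trans ?_
  rw [integral_eq_zero_of_ae, neg_zero]
  filter_upwards [h0] with x hx
  simp only [hx, Pi.zero_apply, map_zero, smul_zero, Finset.sum_const_zero]

/-- The unbounded operator `∑ⱼ Aⱼ ∂ⱼ` on `L^p`: its domain consists of the `u ∈ L^p` for which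
`∑ⱼ Aⱼ ∂ⱼ u`, computed in the sense of distributions, lies in `L^p`. -/
def firstOrderOp (A : Fin n → E →L[ℂ] E) (p : ℝ≥0∞) [Fact (1 ≤ p)] :
    Lp E p (volume : Measure (EuclideanSpace ℝ (Fin n))) →ₗ.[ℂ]
      Lp E p (volume : Measure (EuclideanSpace ℝ (Fin n))) :=
  (firstOrderGraph A p).toLinearPMap

theorem mem_graph_firstOrderOp [CompleteSpace E] (A : Fin n → E →L[ℂ] E) (p : ℝ≥0∞)
    [Fact (1 ≤ p)] (u f : Lp E p (volume : Measure (EuclideanSpace ℝ (Fin n)))) :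
    (u, f) ∈ (firstOrderOp A p).graph ↔ IsWeakSol A u f := by
  rw [firstOrderOp, Submodule.toLinearPMap_graph_eq _ (firstOrderGraph_single_valued A p)]
  rfl

/-- The bounded operator on `L^p` of multiplication by `B ∈ L^∞(ℝⁿ; 𝓛(E))`. -/
def mulOp (B : Lp (E →L[ℂ] E) ∞ (volume : Measure (EuclideanSpace ℝ (Fin n))))
    (p : ℝ≥0∞) [Fact (1 ≤ p)] :
    Lp E p (volume : Measure (EuclideanSpace ℝ (Fin n))) →L[ℂ]
      Lp E p (volume : Measure (EuclideanSpace ℝ (Fin n))) :=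
  (ContinuousLinearMap.id ℂ (E →L[ℂ] E)).holderL volume ∞ p p B

end FirstOrder

/-! ### Differential forms and perturbed Hodge-Dirac operators -/

/-- The complex exterior algebra `Λ` of `ℝⁿ` with its Hermitian inner product, written in the
orthonormal basis `e_S = e_{s₁} ∧ ⋯ ∧ e_{sₖ}`, `S = {s₁ < ⋯ < sₖ} ⊆ {1, …, n}`. -/
abbrev Forms (n : ℕ) : Type := EuclideanSpace ℂ (Finset (Fin n))

/-- The forms `Λ^k` of degree `k`, spanned by the `e_S` with `|S| = k`. -/
def degreeForms (n k : ℕ) : Submodule ℂ (Forms n) where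
  carrier := {w | ∀ S : Finset (Fin n), S.card ≠ k → w S = 0}
  zero_mem' := fun _ _ => rfl
  add_mem' := fun {a b} ha hb S hS => by simp [ha S hS, hb S hS]
  smul_mem' := fun c a ha S hS => by simp [ha S hS]

/-- Left exterior multiplication `w ↦ e_j ∧ w` on `Λ`: the matrix, in the basis `(e_S)`, of left
multiplication by `e_j` in the exterior algebra of `ℂⁿ`. -/
def wedge (n : ℕ) (j : Fin n) : Forms n →L[ℂ] Forms n :=
  Matrix.toEuclideanCLM (𝕜 := ℂ) (n := Finset (Fin n))
    (LinearMap.toMatrix (Pi.basisFun ℂ (Fin n)).ExteriorAlgebra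
      (Pi.basisFun ℂ (Fin n)).ExteriorAlgebra
      (LinearMap.mulLeft ℂ (ExteriorAlgebra.ι ℂ (Pi.single j 1 : Fin n → ℂ))))

/-- The space `L^p(ℝⁿ; Λ)`. -/
abbrev LpForms (n : ℕ) (p : ℝ≥0∞) : Type :=
  Lp (Forms n) p (volume : Measure (EuclideanSpace ℝ (Fin n)))

/-- The coefficient space `L^∞(ℝⁿ; 𝓛(Λ))`. -/
abbrev Coeff (n : ℕ) : Type :=
  Lp (Forms n →L[ℂ] Forms n) ∞ (volume : Measure (EuclideanSpace ℝ (Fin n)))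

/-- The exterior derivative `Γ = d = ∑ⱼ e_j ∧ ∂ⱼ` on `L^p(ℝⁿ; Λ)`. -/
def extD (n : ℕ) (p : ℝ≥0∞) [Fact (1 ≤ p)] : LpForms n p →ₗ.[ℂ] LpForms n p :=
  firstOrderOp (wedge n) p

/-- The adjoint exterior derivative `Γ* = d* = -∑ⱼ (e_j ∧)* ∂ⱼ` on `L^p(ℝⁿ; Λ)`. -/
def extDStar (n : ℕ) (p : ℝ≥0∞) [Fact (1 ≤ p)] : LpForms n p →ₗ.[ℂ] LpForms n p :=
  firstOrderOp (fun j => -ContinuousLinearMap.adjoint (wedge n j)) p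

variable {n : ℕ}

/-- `Γ*_B = B₁ d* B₂` on `L^p(ℝⁿ; Λ)`, with domain `{u | B₂ u ∈ dom d*}`. -/
def gammaStarB (B₁ B₂ : Coeff n) (p : ℝ≥0∞) [Fact (1 ≤ p)] : LpForms n p →ₗ.[ℂ] LpForms n p :=
  (mulOp B₁ p).toLinearMap.compPMap (precomp (extDStar n p) (mulOp B₂ p))

/-- `Π_B = d + B₁ d* B₂` on `L^p(ℝⁿ; Λ)`, with domain `dom d ∩ dom (B₁ d* B₂)`. -/
def piB (B₁ B₂ : Coeff n) (p : ℝ≥0∞) [Fact (1 ≤ p)] : LpForms n p →ₗ.[ℂ] LpForms n p :=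
  extD n p + gammaStarB B₁ B₂ p

/-- The conditions on `B₁, B₂` under which `Π_B = d + B₁ d* B₂` is a perturbed Hodge-Dirac operator.
The bounds `κ₁, κ₂ > 0` and the boundedness of `B₁, B₂` make the angles of accretivity smaller
than `π / 2`. -/
structure IsPerturbedHodgeDirac (B₁ B₂ : Coeff n) : Prop where
  nilpotent_dStar : ∀ u ∈ rangeSpace (extDStar n 2),
    mulOp B₂ 2 (mulOp B₁ 2 u) ∈ nullSpace (extDStar n 2)
  nilpotent_d : ∀ u ∈ rangeSpace (extD n 2), mulOp B₁ 2 (mulOp B₂ 2 u) ∈ nullSpace (extD n 2)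
  accretive₁ : ∃ κ₁ : ℝ, 0 < κ₁ ∧ ∀ u ∈ rangeSpace (extDStar n 2),
    κ₁ * ‖u‖ ^ 2 ≤ (inner ℂ u (mulOp B₁ 2 u)).re
  accretive₂ : ∃ κ₂ : ℝ, 0 < κ₂ ∧ ∀ u ∈ rangeSpace (extD n 2),
    κ₂ * ‖u‖ ^ 2 ≤ (inner ℂ u (mulOp B₂ 2 u)).re

/-- `B` splits as `B⁰ ⊕ ⋯ ⊕ Bⁿ` with `B^k(x) ∈ 𝓛(Λ^k)`. -/
def PreservesDegree (B : Coeff n) : Prop :=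
  ∀ᵐ x, ∀ k : ℕ, ∀ w ∈ degreeForms n k, B x w ∈ degreeForms n k

instance fact_one_le_conjExponent (p : ℝ≥0∞) : Fact (1 ≤ p.conjExponent) :=
  ⟨le_self_add⟩

/-- The condition `(Π_B(p))`: `‖u‖_p ≲ ‖B₁ u‖_p` on the closure of `R_p(d*)`, and
`‖v‖_{p'} ≲ ‖B₂* v‖_{p'}` on the closure of `R_{p'}(d)`, where `1/p + 1/p' = 1`. -/
def InvertibilityCondition (B₁ B₂ : Coeff n) (p : ℝ≥0∞) [Fact (1 ≤ p)] : Prop :=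
  (∃ C : ℝ, ∀ u ∈ (rangeSpace (extDStar n p)).topologicalClosure, ‖u‖ ≤ C * ‖mulOp B₁ p u‖) ∧
  ∃ C : ℝ, ∀ v ∈ (rangeSpace (extD n p.conjExponent)).topologicalClosure,
    ‖v‖ ≤ C * ‖mulOp (star B₂) p.conjExponent v‖

/-- `Π_B` Hodge decomposes `L^p`: `(Π_B(p))` holds and there are splittings into complemented
subspaces `L^p = N(Π_B) ⊕ cl R(Π_B) = N(Π_B) ⊕ cl R(d) ⊕ cl R(B₁ d* B₂)`. -/
structure HodgeDecomposes (B₁ B₂ : Coeff n) (p : ℝ≥0∞) [Fact (1 ≤ p)] : Prop where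
  invertible : InvertibilityCondition B₁ B₂ p
  null_compl : (nullSpace (piB B₁ B₂ p)).ClosedComplemented
  range_compl : (rangeSpace (piB B₁ B₂ p)).topologicalClosure.ClosedComplemented
  range_d_compl : (rangeSpace (extD n p)).topologicalClosure.ClosedComplemented
  range_dStar_compl : (rangeSpace (gammaStarB B₁ B₂ p)).topologicalClosure.ClosedComplemented
  isCompl : IsCompl (nullSpace (piB B₁ B₂ p)) (rangeSpace (piB B₁ B₂ p)).topologicalClosure
  isInternal : DirectSum.IsInternal ![nullSpace (piB B₁ B₂ p),
    (rangeSpace (extD n p)).topologicalClosure,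
    (rangeSpace (gammaStarB B₁ B₂ p)).topologicalClosure]

/-- The set `(p_H, p^H)` of all exponents `1 < p < ∞` for which `Π_B` Hodge decomposes `L^p`. -/
def hodgeExponents (B₁ B₂ : Coeff n) : Set ℝ≥0∞ :=
  {p | p < ∞ ∧ ∃ h : 1 < p, haveI : Fact (1 ≤ p) := ⟨h.le⟩; HodgeDecomposes B₁ B₂ p}

end HodgeDirac

end

/-!
Write `S = d`, `T = B₁ d* B₂`, `D = S + T = Π_B`, all acting in `L^p`. The point is the estimate
`‖S u‖ + ‖T u‖ ≲ ‖D u‖` on the domain of `D`; the splitting follows from it.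

*The estimate.* Let `J` multiply the forms of degree `k` by `iᵏ`. As `d` raises the degree by one,
`d*` lowers it and `B₁, B₂` preserve it, `S J = -i J S` and `T J = i J T`. Hence
`D J u = -i J (S u - T u)`, and `J` is an isometry, so that it suffices to prove
`‖D J u‖ ≲ ‖D u‖`. Now `S² = T² = 0`, so `D² = S T + T S` commutes with `J`, and therefore
`ψ(D) D J u = J ψ(D) D u` for odd `ψ`. Take `ψ_t(z) = t z / (1 + t² z²)`. The bounded functional
calculus bounds `∑ₖ εₖ ψ_{2ᵏ t}(D)` uniformly in the signs `εₖ = ± 1`. The identity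
`ψ_t ψ_{2t} = (2/3) ((1 + t² z²)⁻¹ - (1 + 4 t² z²)⁻¹)` makes the sum
`∑ₖ ψ_{2ᵏ t}(D) ψ_{2ᵏ⁺¹ t}(D)` telescope, in the limit, to a multiple of the identity on the range of
`D`, and averaging a product of two sign sums over the signs leaves this diagonal sum. With
`v = D J u` the second factor of the product is
`(∑ₖ εₖ ψ_{2ᵏ⁺¹ t}(D)) v = J (∑ₖ εₖ ψ_{2ᵏ⁺¹ t}(D)) D u`, whence `‖v‖ ≲ ‖D u‖`
(`IsNilpotentPair.exists_norm_sub_le`).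

*The splitting.* By the estimate, `i t S (1 + i t D)⁻¹` is bounded uniformly in `t`; as `t → ∞` it
converges strongly to a projection onto the closed range of `S` that vanishes on the null space of
`D` and on the range of `T` (`IsNilpotentPair.exists_projection`). Exchanging `S` and `T` gives the
second projection, and together they give the three summands (`IsNilpotentPair.hodge_splitting`).

*What is needed on the way.* That the null space and the closed range of `D` span `L^p`, and that
`D` is densely defined, are consequences of weak compactness; the form of it used here is
`hasConvexLimits_Lp`, deduced from uniform convexity. The Cauchy integral defining `ψ_t(D)` is
computed by turning its rays into each other across the poles at `± i / t` (`psiCalc_oddSymbol`).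
Finally, `T² = 0` is assumed in `L²` only and has to be transferred to `L^p`: it says that certain
bounded, compactly supported matrix functions annihilate the range of
`d*`, and their mollifications are admissible test functions
(`integral_eq_zero_of_annihilates`, `nilpotent_transfer`).
-/

noncomputable section

namespace HodgeDirac

open Filter Topology

/-! ### Strong limits of bounded operators -/

section Limits

variable {X : Type*} [NormedAddCommGroup X] [NormedSpace ℂ X]

theorem tendsto_of_mem_closure {ι : Type*} {l : Filter ι} {T : ι → X →L[ℂ] X} {M : ℝ}
    (hM : ∀ᶠ i in l, ‖T i‖ ≤ M) (A : X →L[ℂ] X) {s : Set X}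
    (hs : ∀ x ∈ s, Tendsto (fun i => T i x) l (𝓝 (A x))) {x : X} (hx : x ∈ closure s) :
    Tendsto (fun i => T i x) l (𝓝 (A x)) := by
  rw [Metric.tendsto_nhds]
  intro ε hε
  set K : ℝ := |M| + ‖A‖ + 1 with hK
  have hK0 : 0 < K := by positivity
  obtain ⟨y, hy, hxy⟩ := Metric.mem_closure_iff.1 hx (ε / (2 * K)) (by positivity)
  filter_upwards [hM, Metric.tendsto_nhds.1 (hs y hy) (ε / 2) (by positivity)] with i hi hi'
  rw [dist_eq_norm] at *
  have h1 : T i x - A x = (T i - A) (x - y) + (T i y - A y) := by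
    simp only [sub_apply, map_sub]; abel
  have h2 : ‖T i - A‖ ≤ K :=
    (norm_sub_le _ _).trans (by linarith [le_abs_self M])
  have h3 : ‖(T i - A) (x - y)‖ ≤ K * (ε / (2 * K)) :=
    ((T i - A).le_of_opNorm_le h2 _).trans (by gcongr)
  have h4 : K * (ε / (2 * K)) = ε / 2 := by field_simp
  rw [h1]
  calc _ ≤ _ := norm_add_le _ _
    _ < ε := by linarith

theorem exists_tendsto_of_dense [CompleteSpace X] {T : ℕ → X →L[ℂ] X} {M : ℝ}
    (hM : ∀ n, ‖T n‖ ≤ M) {s : Set X}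
    (hs : ∀ x ∈ s, ∃ y, Tendsto (fun n => T n x) atTop (𝓝 y)) (hd : Dense s) :
    ∃ Q : X →L[ℂ] X, ∀ x, Tendsto (fun n => T n x) atTop (𝓝 (Q x)) := by
  have hM0 : 0 ≤ M := (norm_nonneg _).trans (hM 0)
  have hc : ∀ x, ∃ y, Tendsto (fun n => T n x) atTop (𝓝 y) := by
    intro x
    apply cauchySeq_tendsto_of_complete
    rw [Metric.cauchySeq_iff']
    intro ε hε
    obtain ⟨y, hy, hxy⟩ := Metric.mem_closure_iff.1 (hd x) (ε / (4 * (M + 1))) (by positivity)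
    obtain ⟨z, hz⟩ := hs y hy
    obtain ⟨N, hN⟩ := Metric.cauchySeq_iff'.1 hz.cauchySeq (ε / 2) (by positivity)
    refine ⟨N, fun n hn => ?_⟩
    have h0 := hN n hn
    rw [dist_eq_norm] at *
    have h1 : T n x - T N x = T n (x - y) + (T n y - T N y) - T N (x - y) := by
      simp only [map_sub]; abel
    have h2 : ∀ m, ‖T m (x - y)‖ ≤ M * (ε / (4 * (M + 1))) := fun m =>
      ((T m).le_of_opNorm_le (hM m) _).trans (by gcongr)
    have h3 : M * (ε / (4 * (M + 1))) < ε / 4 := by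
      rw [mul_div_assoc', div_lt_div_iff₀ (by positivity) (by positivity)]
      nlinarith
    rw [h1]
    calc _ ≤ ‖T n (x - y)‖ + ‖T n y - T N y‖ + ‖T N (x - y)‖ :=
          (norm_sub_le _ _).trans (by gcongr; exact norm_add_le _ _)
      _ < ε := by linarith [h2 n, h2 N]
  choose f hf using hc
  exact ⟨continuousLinearMapOfTendsto (fun n => T n) (tendsto_pi_nhds.2 hf), hf⟩

/-- A substitute for reflexivity: every bounded sequence has a point lying in all closed midpoint
convex sets which contain a tail of the sequence. -/
def HasConvexLimits (X : Type*) [NormedAddCommGroup X] [NormedSpace ℂ X] : Prop :=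
  ∀ (x : ℕ → X) (C : ℝ), (∀ k, ‖x k‖ ≤ C) → ∃ x₀, ∀ s : Set X, IsClosed s →
    (∀ a ∈ s, ∀ b ∈ s, (2⁻¹ : ℂ) • (a + b) ∈ s) → (∀ᶠ k in atTop, x k ∈ s) → x₀ ∈ s

theorem HasConvexLimits.exists_limit (h : HasConvexLimits X) {x : ℕ → X} {C : ℝ}
    (hx : ∀ k, ‖x k‖ ≤ C) : ∃ x₀, (∀ (V : Submodule ℂ X) (u : X),
      (∀ᶠ k in atTop, u - x k ∈ V) → u - x₀ ∈ V.topologicalClosure) ∧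
      ∀ (T : X →L[ℂ] X) (y : X), Tendsto (fun k => T (x k)) atTop (𝓝 y) → T x₀ = y := by
  obtain ⟨x₀, h₀⟩ := h x C hx
  refine ⟨x₀, fun V u hV => ?_, fun T y hT => ?_⟩
  · refine h₀ {a | u - a ∈ V.topologicalClosure} ?_ ?_ ?_
    · exact V.isClosed_topologicalClosure.preimage (by fun_prop)
    · intro a ha b hb
      have : u - (2⁻¹ : ℂ) • (a + b) = (2⁻¹ : ℂ) • ((u - a) + (u - b)) := by module
      simp only [mem_ofPred_eq, this]
      exact Submodule.smul_mem _ _ (Submodule.add_mem _ ha hb)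
    · filter_upwards [hV] with k hk using V.le_topologicalClosure hk
  · rw [← sub_eq_zero, ← norm_le_zero_iff]
    refine le_of_forall_pos_le_add fun ε hε => ?_
    rw [zero_add]
    refine h₀ {a | ‖T a - y‖ ≤ ε} ?_ ?_ ?_
    · exact isClosed_le (by fun_prop) continuous_const
    · intro a ha b hb
      have : T ((2⁻¹ : ℂ) • (a + b)) - y = (2⁻¹ : ℂ) • ((T a - y) + (T b - y)) := by
        simp only [map_smul, map_add]; module
      simp only [mem_ofPred_eq] at ha hb ⊢
      rw [this, norm_smul]
      have := norm_add_le (T a - y) (T b - y)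
      norm_num
      linarith
    · filter_upwards [Metric.tendsto_nhds.1 hT ε hε] with k hk
      rw [dist_eq_norm] at hk
      exact hk.le

end Limits

/-! ### Averaging over signs -/

/-- The average over all signs `ε` of `(∑ εₖ aₖ) (∑ εₖ bₖ)` is the diagonal sum `∑ aₖ bₖ`. -/
theorem norm_apply_add_sum_le {X : Type*} [NormedAddCommGroup X] [NormedSpace ℂ X]
    (a : ℕ → X →L[ℂ] X) (b : ℕ → X) {K : ℝ} (n : ℕ) :
    ∀ (A : X →L[ℂ] X) (y : X), (∀ ε : ℕ → ℂ, (∀ k, ε k = 1 ∨ ε k = -1) →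
      ‖(A + ∑ k ∈ Finset.range n, ε k • a k) (y + ∑ k ∈ Finset.range n, ε k • b k)‖ ≤ K) →
      ‖A y + ∑ k ∈ Finset.range n, a k (b k)‖ ≤ K := by
  induction n with
  | zero =>
    intro A y h
    simpa using h (fun _ => 1) (fun _ => Or.inl rfl)
  | succ n ih =>
    intro A y h
    have key : ∀ σ : ℂ, (σ = 1 ∨ σ = -1) →
        ‖(A + σ • a n) (y + σ • b n) + ∑ k ∈ Finset.range n, a k (b k)‖ ≤ K := by
      intro σ hσ
      refine ih _ _ fun ε hε => ?_
      have h1 := h (Function.update ε n σ) (fun k => by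
        by_cases hk : k = n
        · subst hk; simpa using hσ
        · simpa [hk] using hε k)
      have h2 : ∀ {Y : Type _} [AddCommGroup Y] [Module ℂ Y] (c : ℕ → Y),
          ∑ k ∈ Finset.range n, Function.update ε n σ k • c k =
            ∑ k ∈ Finset.range n, ε k • c k := fun c =>
        Finset.sum_congr rfl fun k hk => by
          rw [Function.update_of_ne (Finset.mem_range.1 hk).ne]
      rw [Finset.sum_range_succ, Finset.sum_range_succ, h2, h2, Function.update_self] at h1
      convert h1 using 3 <;> abel
    have h1 := key 1 (Or.inl rfl)
    have h2 := key (-1) (Or.inr rfl)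
    rw [Finset.sum_range_succ]
    set S := ∑ k ∈ Finset.range n, a k (b k)
    have h3 : A y + (S + a n (b n)) = (2⁻¹ : ℂ) •
        (((A + (1 : ℂ) • a n) (y + (1 : ℂ) • b n) + S) +
          ((A + (-1 : ℂ) • a n) (y + (-1 : ℂ) • b n) + S)) := by
      simp only [one_smul, neg_smul, add_apply, neg_apply, map_add, map_neg]
      module
    rw [h3, norm_smul]
    have h4 := (norm_add_le _ _).trans (add_le_add h1 h2)
    norm_num at h4 ⊢
    linarith

/-! ### The resolvent family on the imaginary axis -/

section Family

variable {X : Type*} [NormedAddCommGroup X] [NormedSpace ℂ X]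

/-- `E t = (1 + i t D)⁻¹` for all real `t ≠ 0`, with uniform bound `M`. -/
structure IsResolventFamily (D : X →ₗ.[ℂ] X) (E : ℝ → X →L[ℂ] X) (M : ℝ) : Prop where
  mem_graph : ∀ t : ℝ, t ≠ 0 → ∀ u, (E t u, (Complex.I * t)⁻¹ • (u - E t u)) ∈ D.graph
  apply_add : ∀ t : ℝ, t ≠ 0 → ∀ x y, (x, y) ∈ D.graph → E t (x + (Complex.I * t) • y) = x
  norm_le : ∀ t : ℝ, t ≠ 0 → ‖E t‖ ≤ M

/-- `(1 + t² D²)⁻¹`, the product of the resolvents at `± i / t`. -/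
def evenPart (E : ℝ → X →L[ℂ] X) (t : ℝ) : X →L[ℂ] X := E t * E (-t)

/-- `t D (1 + t² D²)⁻¹`, expressed through the resolvents at `± i / t`. -/
def oddPart (E : ℝ → X →L[ℂ] X) (t : ℝ) : X →L[ℂ] X :=
  (2 * Complex.I)⁻¹ • (E (-t) - E t)

end Family

theorem eventually_ne_zero_cobounded : ∀ᶠ t : ℝ in Bornology.cobounded ℝ, t ≠ 0 :=
  (Bornology.isBounded_singleton (x := (0 : ℝ))).compl

section Operators

variable {X : Type*} [NormedAddCommGroup X] [NormedSpace ℂ X]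

theorem mem_nullSpace_iff {D : X →ₗ.[ℂ] X} {x : X} : x ∈ nullSpace D ↔ (x, (0 : X)) ∈ D.graph := by
  rw [nullSpace, Submodule.mem_map]
  constructor
  · rintro ⟨y, hy, rfl⟩
    have h := D.mem_graph y
    rwa [show D y = 0 from hy] at h
  · intro h
    obtain ⟨y, hy, hy'⟩ := (LinearPMap.mem_graph_iff D).1 h
    exact ⟨y, hy', hy⟩

theorem mem_rangeSpace_iff {D : X →ₗ.[ℂ] X} {y : X} :
    y ∈ rangeSpace D ↔ ∃ x, (x, y) ∈ D.graph :=
  LinearPMap.mem_range_iff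

namespace IsResolventFamily

variable {D : X →ₗ.[ℂ] X} {E : ℝ → X →L[ℂ] X} {M : ℝ}

theorem nonneg (hE : IsResolventFamily D E M) : 0 ≤ M :=
  (norm_nonneg _).trans (hE.norm_le 1 one_ne_zero)

theorem sub_apply_eq (hE : IsResolventFamily D E M) {t : ℝ} (ht : t ≠ 0) {x y : X}
    (h : (x, y) ∈ D.graph) : x - E t x = (Complex.I * t) • E t y := by
  have := hE.apply_add t ht x y h
  rw [map_add, map_smul] at this
  rw [sub_eq_iff_eq_add, add_comm]
  exact this.symm

theorem graph_apply (hE : IsResolventFamily D E M) {t : ℝ} (ht : t ≠ 0) {x y : X}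
    (h : (x, y) ∈ D.graph) : (E t x, E t y) ∈ D.graph := by
  have := hE.mem_graph t ht x
  rwa [hE.sub_apply_eq ht h, smul_smul, inv_mul_cancel₀, one_smul] at this
  simpa using ht

/-- The resolvent identity. -/
theorem resolvent_identity (hE : IsResolventFamily D E M) {s t : ℝ} (hs : s ≠ 0) (ht : t ≠ 0) :
    ((s : ℂ) - t) • (E s * E t) = (s : ℂ) • E s - (t : ℂ) • E t := by
  ext u
  have h := hE.apply_add s hs _ _ (hE.mem_graph t ht u)
  have ht' : (t : ℂ) ≠ 0 := by simpa using ht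
  have h1 : (Complex.I * s) • (Complex.I * t)⁻¹ • (u - E t u) = ((s : ℂ) / t) • (u - E t u) := by
    rw [smul_smul]; congr 1; field_simp [Complex.I_ne_zero]
  rw [h1, map_add, map_smul, map_sub] at h
  change ((s : ℂ) - t) • E s (E t u) = (s : ℂ) • E s u - (t : ℂ) • E t u
  nth_rw 2 [← h]
  rw [smul_add, smul_smul, mul_div_cancel₀ _ ht']
  module

theorem commute (hE : IsResolventFamily D E M) {s t : ℝ} (hs : s ≠ 0) (ht : t ≠ 0) :
    E s * E t = E t * E s := by
  by_cases h : s = t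
  · rw [h]
  have h1 := hE.resolvent_identity hs ht
  have h2 := hE.resolvent_identity ht hs
  have h3 : ((s : ℂ) - t) • (E s * E t) = ((s : ℂ) - t) • (E t * E s) := by
    have : ((s : ℂ) - t) • (E t * E s) = - (((t : ℂ) - s) • (E t * E s)) := by module
    rw [h1, this, h2]; module
  have h4 : (s : ℂ) - t ≠ 0 := by
    rw [sub_ne_zero]; exact_mod_cast h
  simpa [smul_smul, inv_mul_cancel₀ h4] using congrArg (fun T => ((s : ℂ) - t)⁻¹ • T) h3

theorem mul_eq (hE : IsResolventFamily D E M) {s t : ℝ} (hs : s ≠ 0) (ht : t ≠ 0) (h : s ≠ t) :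
    E s * E t = ((s : ℂ) / (s - t)) • E s - ((t : ℂ) / (s - t)) • E t := by
  have h4 : (s : ℂ) - t ≠ 0 := by
    rw [sub_ne_zero]; exact_mod_cast h
  have h1 := congrArg (fun T => ((s : ℂ) - t)⁻¹ • T) (hE.resolvent_identity hs ht)
  simp only [smul_smul, inv_mul_cancel₀ h4, one_smul, smul_sub] at h1
  rw [h1]
  congr 2 <;> ring

theorem evenPart_eq (hE : IsResolventFamily D E M) {t : ℝ} (ht : t ≠ 0) :
    evenPart E t = (2⁻¹ : ℂ) • (E t + E (-t)) := by
  have ht' : (t : ℂ) ≠ 0 := by simpa using ht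
  rw [evenPart, hE.mul_eq ht (neg_ne_zero.2 ht) (by intro h; apply ht; linarith)]
  have h1 : (t : ℂ) / (t - (-t : ℝ)) = 2⁻¹ := by
    push_cast; field_simp; ring
  have h2 : ((-t : ℝ) : ℂ) / (t - (-t : ℝ)) = -2⁻¹ := by
    push_cast; field_simp; ring
  rw [h1, h2]; module

/-- The identity behind telescoping: with `f_t(z) = t z / (1 + t² z²)`,
`f_t f_{2t} = (2/3) ((1 + t² z²)⁻¹ - (1 + 4 t² z²)⁻¹)`. -/
theorem oddPart_mul_oddPart (hE : IsResolventFamily D E M) {t : ℝ} (ht : t ≠ 0) :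
    oddPart E t * oddPart E (2 * t) =
      (2 / 3 : ℂ) • (evenPart E t - evenPart E (2 * t)) := by
  have ht' : (t : ℂ) ≠ 0 := by simpa using ht
  have h2t : 2 * t ≠ 0 := mul_ne_zero two_ne_zero ht
  have hn : ∀ {x : ℝ}, x ≠ 0 → -x ≠ 0 := fun h => neg_ne_zero.2 h
  have e1 : E (-t) * E (-(2 * t)) = (2 : ℂ) • E (-(2 * t)) - E (-t) := by
    rw [hE.mul_eq (hn ht) (hn h2t) (by intro h; apply ht; linarith)]
    have h1 : ((-t : ℝ) : ℂ) / ((-t : ℝ) - (-(2 * t) : ℝ)) = -1 := by push_cast; field_simp; ring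
    have h2 : ((-(2 * t) : ℝ) : ℂ) / ((-t : ℝ) - (-(2 * t) : ℝ)) = -2 := by
      push_cast; field_simp; ring
    rw [h1, h2]; module
  have e2 : E t * E (2 * t) = (2 : ℂ) • E (2 * t) - E t := by
    rw [hE.mul_eq ht h2t (by intro h; apply ht; linarith)]
    have h1 : (t : ℂ) / (t - (2 * t : ℝ)) = -1 := by push_cast; field_simp; ring
    have h2 : ((2 * t : ℝ) : ℂ) / (t - (2 * t : ℝ)) = -2 := by
      push_cast; field_simp; ring
    rw [h1, h2]; module
  have e3 : E (-t) * E (2 * t) = (1 / 3 : ℂ) • E (-t) + (2 / 3 : ℂ) • E (2 * t) := by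
    rw [hE.mul_eq (hn ht) h2t (by intro h; apply ht; linarith)]
    have h1 : ((-t : ℝ) : ℂ) / ((-t : ℝ) - (2 * t : ℝ)) = 1 / 3 := by push_cast; field_simp; ring
    have h2 : ((2 * t : ℝ) : ℂ) / ((-t : ℝ) - (2 * t : ℝ)) = -2 / 3 := by
      push_cast; field_simp; ring
    rw [h1, h2]; module
  have e4 : E t * E (-(2 * t)) = (1 / 3 : ℂ) • E t + (2 / 3 : ℂ) • E (-(2 * t)) := by
    rw [hE.mul_eq ht (hn h2t) (by intro h; apply ht; linarith)]
    have h1 : (t : ℂ) / (t - (-(2 * t) : ℝ)) = 1 / 3 := by push_cast; field_simp; ring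
    have h2 : ((-(2 * t) : ℝ) : ℂ) / (t - (-(2 * t) : ℝ)) = -2 / 3 := by
      push_cast; field_simp; ring
    rw [h1, h2]; module
  rw [hE.evenPart_eq ht, hE.evenPart_eq h2t, oddPart, oddPart, smul_mul_smul_comm, sub_mul, mul_sub,
    mul_sub, e1, e2, e3, e4]
  have h5 : (2 * Complex.I)⁻¹ * (2 * Complex.I)⁻¹ = (-1 / 4 : ℂ) := by
    rw [← mul_inv, mul_mul_mul_comm, Complex.I_mul_I]; norm_num
  rw [h5]; module

theorem sum_oddPart_mul (hE : IsResolventFamily D E M) {t : ℝ} (ht : t ≠ 0) (n : ℕ) :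
    ∑ k ∈ Finset.range n, oddPart E (t * 2 ^ k) * oddPart E (2 * t * 2 ^ k) =
      (2 / 3 : ℂ) • (evenPart E t - evenPart E (t * 2 ^ n)) := by
  induction n with
  | zero => simp
  | succ n ih =>
    have h : 2 * t * 2 ^ n = 2 * (t * 2 ^ n) := by ring
    rw [Finset.sum_range_succ, ih, h, hE.oddPart_mul_oddPart (by positivity),
      show t * 2 ^ (n + 1) = 2 * (t * 2 ^ n) by ring]
    module

/-- `x = (1 + t² D²)⁻¹ u` solves `x + t² D² x = u`. -/
theorem evenPart_spec (hE : IsResolventFamily D E M) {t : ℝ} (ht : t ≠ 0) (u : X) :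
    ∃ z w, (evenPart E t u, z) ∈ D.graph ∧ (z, w) ∈ D.graph ∧
      evenPart E t u + ((t : ℂ) ^ 2) • w = u := by
  have ht' : (t : ℂ) ≠ 0 := by simpa using ht
  have h1 := hE.mem_graph (-t) (neg_ne_zero.2 ht) u
  have h2 := hE.mem_graph t ht (E (-t) u)
  change (evenPart E t u, (Complex.I * t)⁻¹ • (E (-t) u - evenPart E t u)) ∈ _ at h2
  refine ⟨_, _, h2, D.graph.smul_mem (Complex.I * t)⁻¹ (D.graph.sub_mem h1 h2), ?_⟩
  have h3 : ((t : ℂ) ^ 2) * (Complex.I * t)⁻¹ = -(Complex.I * t) := by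
    rw [mul_inv_eq_iff_eq_mul₀ (by simpa using ht)]
    linear_combination ((t : ℂ) ^ 2) * Complex.I_mul_I
  change evenPart E t u + ((t : ℂ) ^ 2) • (Complex.I * t)⁻¹ •
    ((Complex.I * (-t : ℝ))⁻¹ • (u - E (-t) u) -
      (Complex.I * t)⁻¹ • (E (-t) u - evenPart E t u)) = u
  have h4 : (Complex.I * (t : ℂ)) ≠ 0 := by simpa using ht
  have h5 : -(Complex.I * (t : ℂ)) * (Complex.I * (-t : ℝ))⁻¹ = 1 := by
    push_cast
    rw [mul_neg, inv_neg, neg_mul_neg, mul_inv_cancel₀ h4]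
  rw [smul_smul, h3, smul_sub, smul_smul, smul_smul, h5, neg_mul, mul_inv_cancel₀ h4]
  module

theorem evenPart_unique (hE : IsResolventFamily D E M) {t : ℝ} (ht : t ≠ 0) {x z w u : X}
    (h1 : (x, z) ∈ D.graph) (h2 : (z, w) ∈ D.graph) (h : x + ((t : ℂ) ^ 2) • w = u) :
    evenPart E t u = x := by
  have h3 : E (-t) u = x + (Complex.I * t) • z := by
    have h4 := hE.apply_add (-t) (neg_ne_zero.2 ht) _ _
      (D.graph.add_mem h1 (D.graph.smul_mem (Complex.I * t) h2))
    simp only [Prod.smul_mk] at h4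
    rw [← h4, ← h]
    congr 1
    have h5 : (Complex.I * ((-t : ℝ) : ℂ)) * (Complex.I * t) = (t : ℂ) ^ 2 := by
      push_cast; linear_combination (-(t : ℂ) ^ 2) * Complex.I_mul_I
    rw [smul_add, smul_smul, h5]
    push_cast; module
  change E t (E (-t) u) = x
  rw [h3]
  exact hE.apply_add t ht _ _ h1

theorem oddPart_apply (hE : IsResolventFamily D E M) {t : ℝ} (ht : t ≠ 0) {x y : X}
    (h : (x, y) ∈ D.graph) : oddPart E t y = ((t : ℂ)⁻¹) • (x - evenPart E t x) := by
  have ht' : (t : ℂ) ≠ 0 := by simpa using ht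
  have h4 : (Complex.I * (t : ℂ)) ≠ 0 := by simpa using ht
  have h1 : E t y = (Complex.I * t)⁻¹ • (x - E t x) := by
    rw [hE.sub_apply_eq ht h, smul_smul, inv_mul_cancel₀ h4, one_smul]
  have h2 : E (-t) y = -(Complex.I * t)⁻¹ • (x - E (-t) x) := by
    rw [hE.sub_apply_eq (neg_ne_zero.2 ht) h, smul_smul]
    push_cast
    rw [mul_neg, neg_mul_neg, inv_mul_cancel₀ h4, one_smul]
  rw [hE.evenPart_eq ht, oddPart]
  simp only [smul_apply, sub_apply, add_apply, h1, h2]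
  have h6 : (2 * Complex.I)⁻¹ * (Complex.I * t)⁻¹ = -((2 * (t : ℂ))⁻¹) := by
    rw [← mul_inv, ← inv_neg]; congr 1
    linear_combination (2 * (t : ℂ)) * Complex.I_mul_I
  have h7 : ((2 * (t : ℂ))⁻¹) = (t : ℂ)⁻¹ * 2⁻¹ := by rw [mul_inv, mul_comm]
  rw [smul_sub, smul_smul, smul_smul, mul_neg, h6, h7]
  module

/-- `(1 + i t D)⁻¹ v → 0` as `|t| → ∞` for `v` in the range of `D`. -/
theorem tendsto_cobounded (hE : IsResolventFamily D E M) {v : X} (hv : v ∈ rangeSpace D) :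
    Tendsto (fun t => E t v) (Bornology.cobounded ℝ) (𝓝 0) := by
  obtain ⟨x, hx⟩ := mem_rangeSpace_iff.1 hv
  have h0 : Tendsto (fun t : ℝ => ‖t‖⁻¹ * ((1 + M) * ‖x‖)) (Bornology.cobounded ℝ) (𝓝 0) := by
    simpa using (tendsto_inv_atTop_zero.comp (tendsto_norm_cobounded_atTop (E := ℝ))).mul_const
      ((1 + M) * ‖x‖)
  refine squeeze_zero_norm' ?_ h0
  filter_upwards [eventually_ne_zero_cobounded] with t ht
  have h1 : E t v = (Complex.I * t)⁻¹ • (x - E t x) := by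
    rw [hE.sub_apply_eq ht hx, smul_smul, inv_mul_cancel₀ (by simpa using ht), one_smul]
  rw [h1, norm_smul]
  have h2 : ‖(Complex.I * (t : ℂ))⁻¹‖ = ‖t‖⁻¹ := by simp
  rw [h2]
  gcongr
  calc ‖x - E t x‖ ≤ ‖x‖ + ‖E t x‖ := norm_sub_le _ _
    _ ≤ ‖x‖ + M * ‖x‖ := by gcongr; exact (E t).le_of_opNorm_le (hE.norm_le t ht) x
    _ = _ := by ring

/-- The mean ergodic decomposition: null space plus closed range is everything. -/
theorem exists_null_add_range (hE : IsResolventFamily D E M) (hX : HasConvexLimits X) (u : X) :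
    ∃ x₀ ∈ nullSpace D, u - x₀ ∈ (rangeSpace D).topologicalClosure := by
  have hk : ∀ k : ℕ, ((k : ℝ) + 1) ≠ 0 := fun k => by positivity
  obtain ⟨x₀, h1, h2⟩ := hX.exists_limit (x := fun k : ℕ => E (k + 1) u) (C := M * ‖u‖)
    fun k => (E _).le_of_opNorm_le (hE.norm_le _ (hk k)) u
  refine ⟨x₀, ?_, h1 _ u (Eventually.of_forall fun k => ?_)⟩
  · have h3 : (1 - E 1) x₀ = 0 := by
      refine h2 (1 - E 1) 0 ?_
      have hv : (1 - E 1) u ∈ rangeSpace D := by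
        refine mem_rangeSpace_iff.2 ⟨_, D.graph.smul_mem (Complex.I * (1 : ℝ))
          (hE.mem_graph 1 one_ne_zero u)⟩ |> fun h => ?_
        simpa [smul_smul] using h
      have h4 := (hE.tendsto_cobounded hv).comp (tendsto_natCast_atTop_cobounded (α := ℝ) |>.comp
        (tendsto_add_atTop_nat 1))
      refine h4.congr fun k => ?_
      have h5 := congrArg (fun T : X →L[ℂ] X => T u) (hE.commute (hk k) one_ne_zero)
      have h6 : ((k + 1 : ℕ) : ℝ) = k + 1 := by push_cast; rfl
      change E ((k + 1 : ℕ) : ℝ) (u - E 1 u) = E (k + 1) u - E 1 (E (k + 1) u)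
      rw [h6, map_sub]
      exact congrArg _ h5
    change x₀ - E 1 x₀ = 0 at h3
    have h4 := hE.mem_graph 1 one_ne_zero x₀
    rw [h3, ← sub_eq_zero.1 h3, smul_zero] at h4
    exact mem_nullSpace_iff.2 h4
  · refine mem_rangeSpace_iff.2 ⟨(Complex.I * ((k : ℝ) + 1 : ℝ)) • E (k + 1) u, ?_⟩
    have h6 := D.graph.smul_mem (Complex.I * ((k : ℝ) + 1 : ℝ)) (hE.mem_graph _ (hk k) u)
    rwa [Prod.smul_mk, smul_smul, mul_inv_cancel₀, one_smul] at h6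
    simpa using Complex.ofReal_ne_zero.2 (hk k)

theorem tendsto_zero_of_mem_domain (hE : IsResolventFamily D E M) {x y : X}
    (h : (x, y) ∈ D.graph) : Tendsto (fun t => E t x) (𝓝[≠] 0) (𝓝 x) := by
  rw [tendsto_iff_norm_sub_tendsto_zero]
  have h0 : Tendsto (fun t : ℝ => ‖t‖ * (M * ‖y‖)) (𝓝[≠] 0) (𝓝 0) := by
    have : Tendsto (fun t : ℝ => ‖t‖ * (M * ‖y‖)) (𝓝 0) (𝓝 (‖(0 : ℝ)‖ * (M * ‖y‖))) :=
      Continuous.tendsto (by fun_prop) _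
    rw [norm_zero, zero_mul] at this
    exact this.mono_left nhdsWithin_le_nhds
  refine squeeze_zero' (Eventually.of_forall fun _ => norm_nonneg _) ?_ h0
  filter_upwards [self_mem_nhdsWithin] with t ht
  rw [norm_sub_rev, hE.sub_apply_eq ht h, norm_smul]
  have h2 : ‖(Complex.I * (t : ℂ))‖ = ‖t‖ := by simp
  rw [h2]
  gcongr
  exact (E t).le_of_opNorm_le (hE.norm_le t ht) y

theorem mem_closure_domain (hE : IsResolventFamily D E M) (hX : HasConvexLimits X) (u : X) :
    u ∈ D.domain.topologicalClosure := by
  have hk : ∀ k : ℕ, (1 / ((k : ℝ) + 1)) ≠ 0 := fun k => by positivity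
  obtain ⟨x₀, h1, h2⟩ := hX.exists_limit (x := fun k : ℕ => E (1 / ((k : ℝ) + 1)) u)
    (C := M * ‖u‖) fun k => (E _).le_of_opNorm_le (hE.norm_le _ (hk k)) u
  have h3 : E 1 x₀ = E 1 u := by
    refine h2 (E 1) _ ?_
    have h4 := (hE.tendsto_zero_of_mem_domain (hE.mem_graph 1 one_ne_zero u)).comp
      (tendsto_nhdsWithin_iff.2 ⟨tendsto_one_div_add_atTop_nhds_zero_nat (𝕜 := ℝ),
        Eventually.of_forall hk⟩)
    refine h4.congr fun k => ?_
    exact congrArg (fun T : X →L[ℂ] X => T u) (hE.commute (hk k) one_ne_zero)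
  have h4 : x₀ = u := by
    have e1 := hE.mem_graph 1 one_ne_zero x₀
    have e2 := hE.mem_graph 1 one_ne_zero u
    rw [h3] at e1
    have h5 := LinearPMap.mem_graph_snd_inj D e1 e2 rfl
    have h6 := smul_right_injective X (r := (Complex.I * (1 : ℝ))⁻¹) (by simp) h5
    simpa using h6
  have h5 := h1 D.domain 0 (Eventually.of_forall fun k => by
    rw [zero_sub]
    exact D.domain.neg_mem (LinearPMap.mem_domain_of_mem_graph (hE.mem_graph _ (hk k) u)))
  rw [zero_sub, h4] at h5
  simpa using Submodule.neg_mem _ h5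

/-- `(1 + i t D)⁻¹ → 1` strongly as `t → 0`. -/
theorem tendsto_zero (hE : IsResolventFamily D E M) (hX : HasConvexLimits X) (u : X) :
    Tendsto (fun t => E t u) (𝓝[≠] 0) (𝓝 u) := by
  refine tendsto_of_mem_closure (M := M) (s := D.domain) ?_ (ContinuousLinearMap.id ℂ X) ?_
    (hE.mem_closure_domain hX u)
  · filter_upwards [self_mem_nhdsWithin] with t ht using hE.norm_le t ht
  · intro x hx
    exact hE.tendsto_zero_of_mem_domain (D.mem_graph ⟨x, hx⟩)

theorem tendsto_evenPart_zero (hE : IsResolventFamily D E M) (hX : HasConvexLimits X) (u : X) :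
    Tendsto (fun t => evenPart E t u) (𝓝[≠] 0) (𝓝 u) := by
  have h1 := hE.tendsto_zero hX u
  have h2 : Tendsto (fun t : ℝ => -t) (𝓝[≠] 0) (𝓝[≠] 0) := by
    refine tendsto_nhdsWithin_iff.2 ⟨?_, ?_⟩
    · have : Tendsto (fun t : ℝ => -t) (𝓝 0) (𝓝 (-0)) := continuous_neg.tendsto 0
      rw [neg_zero] at this
      exact this.mono_left nhdsWithin_le_nhds
    · filter_upwards [self_mem_nhdsWithin] with t ht using neg_ne_zero.2 ht
  have h3 := (h1.add (h1.comp h2)).const_smul (2⁻¹ : ℂ)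
  rw [show (2⁻¹ : ℂ) • (u + u) = u by module] at h3
  refine h3.congr' ?_
  filter_upwards [self_mem_nhdsWithin] with t ht
  rw [hE.evenPart_eq ht]; rfl

theorem tendsto_evenPart_cobounded (hE : IsResolventFamily D E M) {v : X}
    (hv : v ∈ rangeSpace D) :
    Tendsto (fun t => evenPart E t v) (Bornology.cobounded ℝ) (𝓝 0) := by
  have h1 := hE.tendsto_cobounded hv
  have h3 := (h1.add (h1.comp tendsto_neg_cobounded)).const_smul (2⁻¹ : ℂ)
  rw [add_zero, smul_zero] at h3
  refine h3.congr' ?_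
  filter_upwards [eventually_ne_zero_cobounded] with t ht
  rw [hE.evenPart_eq ht]; rfl

end IsResolventFamily

end Operators

/-! ### Hodge splitting for a pair of nilpotent operators -/

section Pair

variable {X : Type*} [NormedAddCommGroup X] [NormedSpace ℂ X]

/-- `D = S + T` on `dom S ∩ dom T`, with `S² = 0` and `T² = 0`; the relations between the unbounded
operators are expressed through their graphs. -/
structure IsNilpotentPair (S T D : X →ₗ.[ℂ] X) : Prop where
  graph_add : ∀ x a b, (x, a) ∈ S.graph → (x, b) ∈ T.graph → (x, a + b) ∈ D.graph
  exists_add : ∀ x z, (x, z) ∈ D.graph → ∃ a b, (x, a) ∈ S.graph ∧ (x, b) ∈ T.graph ∧ a + b = z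
  nilpotent_left : ∀ x a, (x, a) ∈ S.graph → (a, (0 : X)) ∈ S.graph
  nilpotent_right : ∀ x a, (x, a) ∈ T.graph → (a, (0 : X)) ∈ T.graph

/-- The sums `∑ₖ ± f(t 2ᵏ D)`, where `f(z) = z / (1 + z²)`, are bounded uniformly in the signs. -/
def HasSignBound (E : ℝ → X →L[ℂ] X) (C : ℝ) : Prop :=
  ∀ t : ℝ, 0 < t → ∀ (n : ℕ) (ε : ℕ → ℂ), (∀ k, ε k = 1 ∨ ε k = -1) →
    ‖∑ k ∈ Finset.range n, ε k • oddPart E (t * 2 ^ k)‖ ≤ C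

namespace IsNilpotentPair

variable {S T D : X →ₗ.[ℂ] X} {E : ℝ → X →L[ℂ] X} {M : ℝ}

theorem symm (h : IsNilpotentPair S T D) : IsNilpotentPair T S D where
  graph_add x a b ha hb := by
    rw [add_comm]; exact h.graph_add x b a hb ha
  exists_add x z hz := by
    obtain ⟨a, b, ha, hb, hab⟩ := h.exists_add x z hz
    exact ⟨b, a, hb, ha, by rw [add_comm]; exact hab⟩
  nilpotent_left := h.nilpotent_right
  nilpotent_right := h.nilpotent_left

/-- On `dom D²` one has `D² = S T + T S`: if `D x = a + b` with `a = S x` and `b = T x`, then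
`a, b ∈ dom D`, with `D b = S b` and `D a = T a`. -/
theorem exists_square (h : IsNilpotentPair S T D) {x z w : X} (h1 : (x, z) ∈ D.graph)
    (h2 : (z, w) ∈ D.graph) : ∃ a b a' b', (x, a) ∈ S.graph ∧ (x, b) ∈ T.graph ∧ a + b = z ∧
      (b, a') ∈ S.graph ∧ (a, b') ∈ T.graph ∧ a' + b' = w := by
  obtain ⟨a, b, ha, hb, rfl⟩ := h.exists_add x z h1
  obtain ⟨a', b', ha', hb', rfl⟩ := h.exists_add _ w h2
  refine ⟨a, b, a', b', ha, hb, rfl, ?_, ?_, rfl⟩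
  · simpa using S.graph.sub_mem ha' (h.nilpotent_left _ _ ha)
  · simpa using T.graph.sub_mem hb' (h.nilpotent_right _ _ hb)

theorem graph_left (h : IsNilpotentPair S T D) {x a b : X} (hb : (x, b) ∈ T.graph)
    (ha : (b, a) ∈ S.graph) : (b, a) ∈ D.graph := by
  simpa using h.graph_add _ _ _ ha (h.nilpotent_right _ _ hb)

/-- `(1 + t² D²)⁻¹` commutes with `S`. -/
theorem evenPart_graph (h : IsNilpotentPair S T D) (hE : IsResolventFamily D E M) {t : ℝ}
    (ht : t ≠ 0) {u f : X} (hu : (u, f) ∈ S.graph) :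
    (evenPart E t u, evenPart E t f) ∈ S.graph := by
  have ht' : (t : ℂ) ^ 2 ≠ 0 := pow_ne_zero _ (by simpa using ht)
  obtain ⟨z, w, h1, h2, h3⟩ := hE.evenPart_spec ht u
  obtain ⟨a, b, a', b', ha, hb, rfl, ha', hb', rfl⟩ := h.exists_square h1 h2
  have h4 : (b', ((t : ℂ) ^ 2)⁻¹ • (f - a)) ∈ S.graph := by
    have h5 := S.graph.sub_mem (S.graph.smul_mem ((t : ℂ) ^ 2)⁻¹ (S.graph.sub_mem hu ha))
      (h.nilpotent_left _ _ ha')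
    have h6 : ((t : ℂ) ^ 2)⁻¹ • (u - evenPart E t u) - a' = b' := by
      nth_rw 1 [← h3]
      rw [add_sub_cancel_left, smul_smul, inv_mul_cancel₀ ht']
      module
    simpa [h6] using h5
  have h7 : evenPart E t f = a := by
    refine hE.evenPart_unique ht (h.symm.graph_left ha hb') (h.graph_left hb' h4) ?_
    rw [smul_smul, mul_inv_cancel₀ ht']
    module
  rwa [h7]

/-- If `J` conjugates `D = S + T` into `i (T - S)`, it commutes with `D²` and so with
`(1 + t² D²)⁻¹`. -/
theorem evenPart_comm (h : IsNilpotentPair S T D) (hE : IsResolventFamily D E M) {J : X →L[ℂ] X}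
    (hS : ∀ x a, (x, a) ∈ S.graph → (J x, -Complex.I • J a) ∈ S.graph)
    (hT : ∀ x b, (x, b) ∈ T.graph → (J x, Complex.I • J b) ∈ T.graph) {t : ℝ} (ht : t ≠ 0)
    (u : X) : evenPart E t (J u) = J (evenPart E t u) := by
  obtain ⟨z, w, h1, h2, h3⟩ := hE.evenPart_spec ht u
  obtain ⟨a, b, a', b', ha, hb, rfl, ha', hb', rfl⟩ := h.exists_square h1 h2
  have e1 := h.graph_add _ _ _ (hS _ _ ha) (hT _ _ hb)
  have e2 := h.symm.graph_left (hS _ _ ha) (T.graph.smul_mem (-Complex.I) (hT _ _ hb'))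
  have e3 := h.graph_left (hT _ _ hb) (S.graph.smul_mem Complex.I (hS _ _ ha'))
  have e4 := D.graph.add_mem e2 e3
  refine hE.evenPart_unique ht e1 e4 ?_
  simp only [smul_smul, neg_mul, mul_neg, Complex.I_mul_I, neg_neg, one_smul]
  rw [← map_add, ← map_smul, ← map_add, add_comm b', h3]

/-- The main estimate. Since `J` commutes with `D²`, the odd functions of `D` in the sign sums
satisfy `ψ(D) D J = J ψ(D) D`; averaging over the signs bounds `D J x = -i J (S x - T x)` by `D x`. -/
theorem exists_norm_sub_le (h : IsNilpotentPair S T D) (hE : IsResolventFamily D E M)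
    (hX : HasConvexLimits X) {C : ℝ} (hC : HasSignBound E C) {J : X →L[ℂ] X}
    (hS : ∀ x a, (x, a) ∈ S.graph → (J x, -Complex.I • J a) ∈ S.graph)
    (hT : ∀ x b, (x, b) ∈ T.graph → (J x, Complex.I • J b) ∈ T.graph)
    (hJ : ∀ x, ‖J x‖ = ‖x‖) :
    ∃ K, ∀ x a b, (x, a) ∈ S.graph → (x, b) ∈ T.graph → ‖a - b‖ ≤ K * ‖a + b‖ := by
  have hC0 : 0 ≤ C := by simpa using hC 1 one_pos 0 (fun _ => 1) (fun _ => Or.inl rfl)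
  refine ⟨3 / 2 * (C * C), fun x a b ha hb => ?_⟩
  have hD := h.graph_add _ _ _ ha hb
  set v := -Complex.I • J a + Complex.I • J b with hv
  have hDJ : (J x, v) ∈ D.graph := h.graph_add _ _ _ (hS _ _ ha) (hT _ _ hb)
  have hnorm : ‖v‖ = ‖a - b‖ := by
    have : v = Complex.I • J (b - a) := by rw [hv, map_sub]; module
    rw [this, norm_smul, hJ, Complex.norm_I, one_mul, norm_sub_rev]
  have hodd : ∀ t : ℝ, t ≠ 0 → oddPart E t v = J (oddPart E t (a + b)) := by
    intro t ht
    rw [hE.oddPart_apply ht hDJ, hE.oddPart_apply ht hD, h.evenPart_comm hE hS hT ht, map_smul,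
      map_sub]
  have hstep : ∀ t : ℝ, 0 < t → ∀ n : ℕ,
      ‖evenPart E t v - evenPart E (t * 2 ^ n) v‖ ≤ 3 / 2 * (C * C) * ‖a + b‖ := by
    intro t ht n
    have key : ∀ ε : ℕ → ℂ, (∀ k, ε k = 1 ∨ ε k = -1) →
        ‖(∑ k ∈ Finset.range n, ε k • oddPart E (t * 2 ^ k))
          ((∑ k ∈ Finset.range n, ε k • oddPart E (2 * t * 2 ^ k)) v)‖ ≤ C * C * ‖a + b‖ := by
      intro ε hε
      have h1 : (∑ k ∈ Finset.range n, ε k • oddPart E (2 * t * 2 ^ k)) v =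
          J ((∑ k ∈ Finset.range n, ε k • oddPart E (2 * t * 2 ^ k)) (a + b)) := by
        rw [sum_apply, sum_apply, map_sum]
        refine Finset.sum_congr rfl fun k _ => ?_
        change ε k • oddPart E (2 * t * 2 ^ k) v = J (ε k • oddPart E (2 * t * 2 ^ k) (a + b))
        rw [hodd _ (by positivity), map_smul]
      rw [h1]
      refine (ContinuousLinearMap.le_of_opNorm_le _ (hC t ht n ε hε) _).trans ?_
      rw [hJ, mul_assoc]
      gcongr
      exact ContinuousLinearMap.le_of_opNorm_le _ (hC (2 * t) (by positivity) n ε hε) _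
    have havg := norm_apply_add_sum_le (fun k => oddPart E (t * 2 ^ k))
      (fun k => oddPart E (2 * t * 2 ^ k) v) n 0 0 (K := C * C * ‖a + b‖) fun ε hε => by
        simpa only [zero_add, sum_apply, smul_apply] using key ε hε
    rw [zero_apply, zero_add] at havg
    have hsum := congrArg (fun R : X →L[ℂ] X => R v) (hE.sum_oddPart_mul ht.ne' n)
    simp only [sum_apply] at hsum
    rw [show ∑ k ∈ Finset.range n, oddPart E (t * 2 ^ k) (oddPart E (2 * t * 2 ^ k) v) =
      (2 / 3 : ℂ) • (evenPart E t v - evenPart E (t * 2 ^ n) v) from hsum, norm_smul] at havg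
    norm_num at havg
    linarith
  have hstep' : ∀ t : ℝ, 0 < t → ‖evenPart E t v‖ ≤ 3 / 2 * (C * C) * ‖a + b‖ := by
    intro t ht
    have h1 : Tendsto (fun n : ℕ => t * (2 : ℝ) ^ n) atTop (Bornology.cobounded ℝ) :=
      ((tendsto_pow_atTop_atTop_of_one_lt one_lt_two).const_mul_atTop ht).mono_right
        (by rw [IsOrderBornology.cobounded_eq]; exact le_sup_right)
    have h2 := ((hE.tendsto_evenPart_cobounded (mem_rangeSpace_iff.2 ⟨_, hDJ⟩)).comp h1).const_sub
      (evenPart E t v)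
    rw [sub_zero] at h2
    exact le_of_tendsto h2.norm (Eventually.of_forall (hstep t ht))
  rw [← hnorm]
  refine le_of_tendsto ((hE.tendsto_evenPart_zero hX v).mono_left
    (nhdsWithin_mono 0 fun t (ht : t ∈ Ioi (0 : ℝ)) => ne_of_gt ht)).norm ?_
  filter_upwards [self_mem_nhdsWithin] with t ht using hstep' t ht

/-- For `w = S u` one has `(1 + t² D²)⁻¹ w = S (1 + t² D²)⁻¹ u`, and
`D (1 + t² D²)⁻¹ = O(1 / t)`. -/
theorem tendsto_evenPart_range (h : IsNilpotentPair S T D) (hE : IsResolventFamily D E M) {K : ℝ}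
    (hK : 0 ≤ K) (hS : ∀ x a b, (x, a) ∈ S.graph → (x, b) ∈ T.graph → ‖a‖ ≤ K * ‖a + b‖) {w : X}
    (hw : w ∈ rangeSpace S) :
    Tendsto (fun t => evenPart E t w) (Bornology.cobounded ℝ) (𝓝 0) := by
  obtain ⟨u, hu⟩ := mem_rangeSpace_iff.1 hw
  have h0 : Tendsto (fun t : ℝ => ‖t‖⁻¹ * (K * (M * ((1 + M) * ‖u‖))))
      (Bornology.cobounded ℝ) (𝓝 0) := by
    simpa using (tendsto_inv_atTop_zero.comp (tendsto_norm_cobounded_atTop (E := ℝ))).mul_const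
      (K * (M * ((1 + M) * ‖u‖)))
  refine squeeze_zero_norm' ?_ h0
  filter_upwards [eventually_ne_zero_cobounded] with t ht
  have h1 := h.evenPart_graph hE ht hu
  have h2 := hE.mem_graph t ht (E (-t) u)
  obtain ⟨a, b, ha, hb, hab⟩ := h.exists_add _ _ h2
  have h3 : evenPart E t w = a := LinearPMap.mem_graph_snd_inj S h1 ha rfl
  have hn := hS _ _ _ ha hb
  rw [hab, norm_smul] at hn
  have h4 : ‖(Complex.I * (t : ℂ))⁻¹‖ = ‖t‖⁻¹ := by simp
  have h5 : ‖E (-t) u‖ ≤ M * ‖u‖ := (E _).le_of_opNorm_le (hE.norm_le _ (neg_ne_zero.2 ht)) u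
  have h6 : ‖E (-t) u - E t (E (-t) u)‖ ≤ M * ((1 + M) * ‖u‖) := by
    calc _ ≤ ‖E (-t) u‖ + ‖E t (E (-t) u)‖ := norm_sub_le _ _
      _ ≤ ‖E (-t) u‖ + M * ‖E (-t) u‖ := by
          gcongr; exact (E t).le_of_opNorm_le (hE.norm_le t ht) _
      _ = (1 + M) * ‖E (-t) u‖ := by ring
      _ ≤ (1 + M) * (M * ‖u‖) := by have := hE.nonneg; gcongr
      _ = _ := by ring
  rw [h3]
  refine hn.trans ?_
  rw [h4]
  calc K * (‖t‖⁻¹ * _) = ‖t‖⁻¹ * (K * ‖E (-t) u - E t (E (-t) u)‖) := by ring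
    _ ≤ _ := by gcongr

/-- The projection onto the closed range of `S` along the null space of `D` and the closed range
of `T`: the bounded extension of `D x ↦ S x`. -/
theorem exists_projection [CompleteSpace X] (h : IsNilpotentPair S T D)
    (hE : IsResolventFamily D E M) (hX : HasConvexLimits X) {K : ℝ} (hK : 0 ≤ K)
    (hS : ∀ x a b, (x, a) ∈ S.graph → (x, b) ∈ T.graph → ‖a‖ ≤ K * ‖a + b‖)
    (hT : ∀ x a b, (x, a) ∈ S.graph → (x, b) ∈ T.graph → ‖b‖ ≤ K * ‖a + b‖) :
    ∃ Q : X →L[ℂ] X, (∀ x, Q x ∈ (rangeSpace S).topologicalClosure) ∧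
      (∀ x ∈ (rangeSpace S).topologicalClosure, Q x = x) ∧
      (∀ x ∈ (rangeSpace T).topologicalClosure, Q x = 0) ∧ (∀ x ∈ nullSpace D, Q x = 0) ∧
      ∀ x a b, (x, a) ∈ S.graph → (x, b) ∈ T.graph → Q (a + b) = a := by
  have hM := hE.nonneg
  have hdom : ∀ x z, (x, z) ∈ D.graph → x ∈ S.domain := fun x z hz => by
    obtain ⟨a, b, ha, -⟩ := h.exists_add x z hz
    exact LinearPMap.mem_domain_of_mem_graph ha
  have hne : ∀ k : ℕ, ((k : ℝ) + 1) ≠ 0 := fun k => by positivity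
  -- The operators `i t S (1 + i t D)⁻¹`, with `t = k + 1`.
  have hq : ∀ k : ℕ, ∃ q : X →L[ℂ] X, ‖q‖ ≤ K * (1 + M) ∧
      ∀ u, ((Complex.I * (k + 1 : ℝ)) • E (k + 1) u, q u) ∈ S.graph := by
    intro k
    have hmem : ∀ u, E (k + 1) u ∈ S.domain := fun u => hdom _ _ (hE.mem_graph _ (hne k) u)
    have hgr : ∀ u, ((Complex.I * (k + 1 : ℝ)) • E (k + 1) u,
        (Complex.I * (k + 1 : ℝ)) • S ⟨E (k + 1) u, hmem u⟩) ∈ S.graph := fun u =>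
      S.graph.smul_mem _ (S.mem_graph ⟨E (k + 1) u, hmem u⟩)
    let q₀ : X →ₗ[ℂ] X := (Complex.I * (k + 1 : ℝ)) •
      S.toFun.comp ((E (k + 1)).toLinearMap.codRestrict S.domain hmem)
    have hb : ∀ u, ‖q₀ u‖ ≤ K * (1 + M) * ‖u‖ := by
      intro u
      have h1 := D.graph.smul_mem (Complex.I * ((k : ℝ) + 1 : ℝ)) (hE.mem_graph _ (hne k) u)
      rw [Prod.smul_mk, smul_smul, mul_inv_cancel₀
        (by simpa using Complex.ofReal_ne_zero.2 (hne k)), one_smul] at h1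
      obtain ⟨a, b, ha, hb, hab⟩ := h.exists_add _ _ h1
      have h2 : q₀ u = a := LinearPMap.mem_graph_snd_inj S (hgr u) ha rfl
      rw [h2, mul_assoc]
      refine (hS _ _ _ ha hb).trans ?_
      gcongr
      rw [hab]
      calc _ ≤ ‖u‖ + ‖E (k + 1) u‖ := norm_sub_le _ _
        _ ≤ ‖u‖ + M * ‖u‖ := by gcongr; exact (E _).le_of_opNorm_le (hE.norm_le _ (hne k)) _
        _ = _ := by ring
    exact ⟨q₀.mkContinuous _ hb, LinearMap.mkContinuous_norm_le _ (by positivity) hb, hgr⟩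
  choose q hqn hqg using hq
  have hnull : ∀ x ∈ nullSpace D, ∀ k, q k x = 0 := by
    intro x hx k
    rw [mem_nullSpace_iff] at hx
    have h1 : E (k + 1) x = x := by
      have := hE.sub_apply_eq (hne k) hx
      rw [map_zero, smul_zero] at this
      exact (sub_eq_zero.1 this).symm
    obtain ⟨a, b, ha, hb, hab⟩ := h.exists_add _ _ hx
    have h2 := hqg k x
    rw [h1] at h2
    have h3 := LinearPMap.mem_graph_snd_inj S h2 (S.graph.smul_mem _ ha) rfl
    have h4 : a = 0 := by
      have := hS _ _ _ ha hb
      rw [hab, norm_zero, mul_zero] at this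
      exact norm_le_zero_iff.1 this
    rw [h3, h4]
    exact smul_zero _
  have hnat : Tendsto (fun k : ℕ => (k : ℝ) + 1) atTop (Bornology.cobounded ℝ) :=
    (tendsto_atTop_add_const_right _ 1 tendsto_natCast_atTop_atTop).mono_right
      (by rw [IsOrderBornology.cobounded_eq]; exact le_sup_right)
  have hrange : ∀ x a b, (x, a) ∈ S.graph → (x, b) ∈ T.graph →
      Tendsto (fun k => q k (a + b)) atTop (𝓝 a) := by
    intro x a b ha hb
    have hD := h.graph_add _ _ _ ha hb
    rw [tendsto_iff_norm_sub_tendsto_zero]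
    have h0 := ((hE.tendsto_cobounded (mem_rangeSpace_iff.2 ⟨x, hD⟩)).comp hnat).norm.const_mul K
    rw [norm_zero, mul_zero] at h0
    refine squeeze_zero (fun _ => norm_nonneg _) (fun k => ?_) h0
    obtain ⟨a', b', ha', hb', hab'⟩ := h.exists_add _ _ (hE.graph_apply (hne k) hD)
    have h1 := hqg k (a + b)
    rw [← hE.sub_apply_eq (hne k) hD] at h1
    have h2 := LinearPMap.mem_graph_snd_inj S h1 (S.graph.sub_mem ha ha') rfl
    change q k (a + b) = a - a' at h2
    rw [h2, sub_sub_cancel_left, norm_neg]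
    have := hS _ _ _ ha' hb'
    rwa [hab'] at this
  have hdense : Dense {y : X | ∃ n ∈ nullSpace D, ∃ v ∈ rangeSpace D, n + v = y} := by
    intro u
    obtain ⟨n, hn, hv⟩ := hE.exists_null_add_range hX u
    have h1 : u = n + (u - n) := by abel
    rw [h1]
    have h2 : Continuous fun v : X => n + v := by fun_prop
    exact map_mem_closure h2 hv fun v hv => ⟨n, hn, v, hv, rfl⟩
  obtain ⟨Q, hQ⟩ := exists_tendsto_of_dense (T := q) hqn (s := _) (by
    rintro _ ⟨n, hn, v, hv, rfl⟩
    obtain ⟨x, hx⟩ := mem_rangeSpace_iff.1 hv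
    obtain ⟨a, b, ha, hb, rfl⟩ := h.exists_add _ _ hx
    refine ⟨a, (hrange x a b ha hb).congr fun k => ?_⟩
    rw [map_add (q k) n, hnull n hn, zero_add]) hdense
  have hQD : ∀ x a b, (x, a) ∈ S.graph → (x, b) ∈ T.graph → Q (a + b) = a := fun x a b ha hb =>
    tendsto_nhds_unique (hQ _) (hrange x a b ha hb)
  refine ⟨Q, fun x => ?_, fun x hx => ?_, fun x hx => ?_, fun x hx => ?_, hQD⟩
  · refine (rangeSpace S).isClosed_topologicalClosure.mem_of_tendsto (hQ x)
      (Eventually.of_forall fun k => (rangeSpace S).le_topologicalClosure ?_)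
    exact mem_rangeSpace_iff.2 ⟨_, hqg k x⟩
  · have hc : IsClosed {x | Q x = x} := isClosed_eq Q.continuous continuous_id
    refine (hc.closure_subset_iff.2 fun w hw => ?_) hx
    have h1 := (h.tendsto_evenPart_range hE hK hS hw).comp hnat
    have h2 := h1.const_sub w
    rw [sub_zero] at h2
    refine hc.mem_of_tendsto h2 (Eventually.of_forall fun k => ?_)
    obtain ⟨u, hu⟩ := mem_rangeSpace_iff.1 hw
    have h3 := h.nilpotent_left _ _ (h.evenPart_graph hE (hne k) hu)
    obtain ⟨z, w', e1, e2, e3⟩ := hE.evenPart_spec (hne k) w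
    obtain ⟨a, b, a', b', ha, hb, rfl, ha', hb', rfl⟩ := h.exists_square e1 e2
    have ha0 : a = 0 := LinearPMap.mem_graph_snd_inj S ha h3 rfl
    have hb0 : b' = 0 := LinearPMap.graph_fst_eq_zero_snd T hb' ha0
    have h5 : Q a' = a' := by
      simpa using hQD b a' 0 ha' (h.nilpotent_right _ _ hb)
    have h6 : w - evenPart E (k + 1) w = (((k + 1 : ℝ) : ℂ) ^ 2) • a' := by
      nth_rw 1 [← e3]
      rw [hb0, add_zero, add_sub_cancel_left]
    change Q (w - evenPart E (k + 1) w) = w - evenPart E (k + 1) w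
    rw [h6, map_smul, h5]
  · have hc : IsClosed {x | Q x = 0} := isClosed_eq Q.continuous continuous_const
    refine (hc.closure_subset_iff.2 fun w hw => ?_) hx
    have h1 := (h.symm.tendsto_evenPart_range hE hK
      (fun x a b ha hb => by rw [add_comm]; exact hT x b a hb ha) hw).comp hnat
    have h2 := h1.const_sub w
    rw [sub_zero] at h2
    refine hc.mem_of_tendsto h2 (Eventually.of_forall fun k => ?_)
    obtain ⟨u, hu⟩ := mem_rangeSpace_iff.1 hw
    have h3 := h.nilpotent_right _ _ (h.symm.evenPart_graph hE (hne k) hu)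
    obtain ⟨z, w', e1, e2, e3⟩ := hE.evenPart_spec (hne k) w
    obtain ⟨a, b, a', b', ha, hb, rfl, ha', hb', rfl⟩ := h.exists_square e1 e2
    have hb0 : b = 0 := LinearPMap.mem_graph_snd_inj T hb h3 rfl
    have ha0 : a' = 0 := LinearPMap.graph_fst_eq_zero_snd S ha' hb0
    have h5 : Q b' = 0 := by
      simpa using hQD a 0 b' (h.nilpotent_left _ _ ha) hb'
    have h6 : w - evenPart E (k + 1) w = (((k + 1 : ℝ) : ℂ) ^ 2) • b' := by
      nth_rw 1 [← e3]
      rw [ha0, zero_add, add_sub_cancel_left]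
    change Q (w - evenPart E (k + 1) w) = 0
    rw [h6, map_smul, h5, smul_zero]
  · exact tendsto_nhds_unique (hQ x) (tendsto_const_nhds.congr fun k => (hnull x hx k).symm)

/-- The Hodge splitting. The projections onto the closed ranges of `S` and `T` are those of
`exists_projection`, and their complement is the projection onto the null space of `D`. -/
theorem hodge_splitting [CompleteSpace X] (h : IsNilpotentPair S T D)
    (hE : IsResolventFamily D E M) (hX : HasConvexLimits X) {K : ℝ} (hK : 0 ≤ K)
    (hS : ∀ x a b, (x, a) ∈ S.graph → (x, b) ∈ T.graph → ‖a‖ ≤ K * ‖a + b‖)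
    (hT : ∀ x a b, (x, a) ∈ S.graph → (x, b) ∈ T.graph → ‖b‖ ≤ K * ‖a + b‖) :
    (nullSpace D).ClosedComplemented ∧ (rangeSpace D).topologicalClosure.ClosedComplemented ∧
      (rangeSpace S).topologicalClosure.ClosedComplemented ∧
      (rangeSpace T).topologicalClosure.ClosedComplemented ∧
      IsCompl (nullSpace D) (rangeSpace D).topologicalClosure ∧
      DirectSum.IsInternal ![nullSpace D, (rangeSpace S).topologicalClosure,
        (rangeSpace T).topologicalClosure] := by
  obtain ⟨Q, q1, q2, q3, q4, q5⟩ := h.exists_projection hE hX hK hS hT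
  obtain ⟨R, r1, r2, r3, r4, r5⟩ := h.symm.exists_projection hE hX hK
    (fun x a b ha hb => by rw [add_comm]; exact hT x b a hb ha)
    (fun x a b ha hb => by rw [add_comm]; exact hS x b a hb ha)
  set P : X →L[ℂ] X := 1 - (Q + R) with hP
  have hPx : ∀ x, P x = x - (Q x + R x) := fun x => rfl
  have p1 : ∀ x ∈ nullSpace D, P x = x := fun x hx => by simp [hPx, q4 x hx, r4 x hx]
  have p2 : ∀ x ∈ (rangeSpace D).topologicalClosure, P x = 0 := by
    have hc : IsClosed {x | P x = 0} := isClosed_eq P.continuous continuous_const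
    refine fun x hx => (hc.closure_subset_iff.2 fun w hw => ?_) hx
    obtain ⟨u, hu⟩ := mem_rangeSpace_iff.1 hw
    obtain ⟨a, b, ha, hb, rfl⟩ := h.exists_add _ _ hu
    change P (a + b) = 0
    rw [hPx, q5 u a b ha hb, add_comm a b, r5 u b a hb ha]
    abel
  have p3 : ∀ x, P x ∈ nullSpace D ∧ x - P x ∈ (rangeSpace D).topologicalClosure := by
    intro x
    obtain ⟨n, hn, hv⟩ := hE.exists_null_add_range hX x
    have h1 : P x = n := by
      have := p2 _ hv
      rw [map_sub, p1 n hn] at this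
      exact sub_eq_zero.1 this
    rw [h1]; exact ⟨hn, hv⟩
  refine ⟨⟨P.codRestrict _ fun x => (p3 x).1, fun x => Subtype.ext (p1 x x.2)⟩,
    ⟨(1 - P).codRestrict _ fun x => (p3 x).2, fun x => Subtype.ext ?_⟩,
    ⟨Q.codRestrict _ q1, fun x => Subtype.ext (q2 x x.2)⟩,
    ⟨R.codRestrict _ r1, fun x => Subtype.ext (r2 x x.2)⟩, ?_, ?_⟩
  · change (x : X) - P x = x
    rw [p2 x x.2, sub_zero]
  · refine IsCompl.of_eq ?_ ?_
    · rw [eq_bot_iff]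
      rintro x ⟨hx, hx'⟩
      exact (p1 x hx).symm.trans (p2 x hx')
    · rw [eq_top_iff]
      rintro x -
      exact Submodule.mem_sup.2 ⟨P x, (p3 x).1, x - P x, (p3 x).2, by abel⟩
  · rw [DirectSum.isInternal_submodule_iff_iSupIndep_and_iSup_eq_top]
    refine ⟨?_, ?_⟩
    · rw [iSupIndep_def]
      -- Each projection is the identity on its own summand and vanishes on the two others.
      have key : ∀ (W : X →L[ℂ] X) (V V₁ V₂ : Submodule ℂ X), (∀ x ∈ V, W x = x) →
          (∀ x ∈ V₁, W x = 0) → (∀ x ∈ V₂, W x = 0) → Disjoint V (V₁ ⊔ V₂) := by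
        intro W V V₁ V₂ w0 w1 w2
        rw [disjoint_iff, eq_bot_iff]
        rintro x ⟨hx, hx'⟩
        obtain ⟨y, hy, z, hz, rfl⟩ := Submodule.mem_sup.1 hx'
        have := w0 _ hx
        rw [map_add, w1 y hy, w2 z hz, add_zero] at this
        exact this.symm
      intro i
      fin_cases i
      · refine (key P _ (rangeSpace S).topologicalClosure
          (rangeSpace T).topologicalClosure p1 (fun x hx => ?_) (fun x hx => ?_)).mono_right ?_
        · simp [hPx, q2 x hx, r3 x hx]
        · simp [hPx, q3 x hx, r2 x hx]
        · refine iSup₂_le fun j hj => ?_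
          fin_cases j
          · exact absurd rfl hj
          · exact le_sup_left
          · exact le_sup_right
      · refine (key Q _ (nullSpace D)
          (rangeSpace T).topologicalClosure q2 q4 q3).mono_right ?_
        refine iSup₂_le fun j hj => ?_
        fin_cases j
        · exact le_sup_left
        · exact absurd rfl hj
        · exact le_sup_right
      · refine (key R _ (nullSpace D)
          (rangeSpace S).topologicalClosure r2 r4 r3).mono_right ?_
        refine iSup₂_le fun j hj => ?_
        fin_cases j
        · exact le_sup_left
        · exact le_sup_right
        · exact absurd rfl hj
    · rw [eq_top_iff]
      rintro x -
      have hx : x = P x + Q x + R x := by rw [hPx]; abel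
      rw [hx]
      refine Submodule.add_mem _ (Submodule.add_mem _ ?_ ?_) ?_
      · exact Submodule.mem_iSup_of_mem (p := ![nullSpace D, (rangeSpace S).topologicalClosure,
          (rangeSpace T).topologicalClosure]) 0 (p3 x).1
      · exact Submodule.mem_iSup_of_mem (p := ![nullSpace D, (rangeSpace S).topologicalClosure,
          (rangeSpace T).topologicalClosure]) 1 (q1 x)
      · exact Submodule.mem_iSup_of_mem (p := ![nullSpace D, (rangeSpace S).topologicalClosure,
          (rangeSpace T).topologicalClosure]) 2 (r1 x)

end IsNilpotentPair
end Pair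

/-! ### Uniform convexity of `L^p` -/

section Convexity

/-- Under a uniform convexity bound for `‖·‖ ^ q`, nearly norm-minimal points of the closed midpoint
convex hulls of the tails form a Cauchy sequence. -/
theorem HasConvexLimits.of_gap {X : Type*} [NormedAddCommGroup X] [NormedSpace ℂ X]
    [CompleteSpace X] {q : ℝ} (hq : 0 < q)
    (H : ∀ δ : ℝ, 0 < δ → ∃ C : ℝ, 0 ≤ C ∧ ∀ f g : X, ‖f - g‖ ^ q ≤ δ * (‖f‖ ^ q + ‖g‖ ^ q) +
      C * (2⁻¹ * ‖f‖ ^ q + 2⁻¹ * ‖g‖ ^ q - ‖(2⁻¹ : ℂ) • (f + g)‖ ^ q)) :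
    HasConvexLimits X := by
  intro x B hB
  -- `A n` is the closed midpoint convex hull of `{x k | n ≤ k}`.
  let A : ℕ → Set X := fun n => {y | ∀ s : Set X, IsClosed s →
    (∀ a ∈ s, ∀ b ∈ s, (2⁻¹ : ℂ) • (a + b) ∈ s) → (∀ k, n ≤ k → x k ∈ s) → y ∈ s}
  have hAc : ∀ n, IsClosed (A n) := by
    intro n
    have : A n = ⋂ s ∈ {s : Set X | IsClosed s ∧ (∀ a ∈ s, ∀ b ∈ s, (2⁻¹ : ℂ) • (a + b) ∈ s) ∧
        ∀ k, n ≤ k → x k ∈ s}, s := by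
      ext y; simp [A]
    rw [this]
    exact isClosed_biInter fun s hs => hs.1
  have hAm : ∀ n, ∀ a ∈ A n, ∀ b ∈ A n, (2⁻¹ : ℂ) • (a + b) ∈ A n :=
    fun n a ha b hb s h1 h2 h3 => h2 a (ha s h1 h2 h3) b (hb s h1 h2 h3)
  have hAx : ∀ n, x n ∈ A n := fun n s _ _ h3 => h3 n le_rfl
  have hAa : ∀ m n, m ≤ n → A n ⊆ A m := fun m n hmn y hy s h1 h2 h3 =>
    hy s h1 h2 fun k hk => h3 k (hmn.trans hk)
  let F : ℕ → Set ℝ := fun n => (fun y => ‖y‖ ^ q) '' A n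
  have hF0 : ∀ n, BddBelow (F n) := fun n => ⟨0, by rintro _ ⟨y, -, rfl⟩; positivity⟩
  have hFn : ∀ n, (F n).Nonempty := fun n => ⟨_, x n, hAx n, rfl⟩
  let d : ℕ → ℝ := fun n => sInf (F n)
  have hdle : ∀ n, ∀ y ∈ A n, d n ≤ ‖y‖ ^ q := fun n y hy => csInf_le (hF0 n) ⟨y, hy, rfl⟩
  have hdm : Monotone d := fun m n hmn =>
    le_csInf (hFn n) (by rintro _ ⟨y, hy, rfl⟩; exact hdle m y (hAa m n hmn hy))
  have hdb : ∀ n, d n ≤ B ^ q := fun n => (hdle n _ (hAx n)).trans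
    (Real.rpow_le_rpow (norm_nonneg _) (hB n) hq.le)
  have hd0 : ∀ n, 0 ≤ d n := fun n =>
    le_csInf (hFn n) (by rintro _ ⟨y, -, rfl⟩; positivity)
  obtain ⟨D, hD⟩ : ∃ D, Tendsto d atTop (𝓝 D) :=
    ⟨_, tendsto_atTop_ciSup hdm ⟨B ^ q, by rintro _ ⟨n, rfl⟩; exact hdb n⟩⟩
  have hdD : ∀ n, d n ≤ D := fun n => hdm.ge_of_tendsto hD n
  have hD0 : 0 ≤ D := (hd0 0).trans (hdD 0)
  have hy : ∀ n : ℕ, ∃ y ∈ A n, ‖y‖ ^ q < d n + 1 / ((n : ℝ) + 1) := by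
    intro n
    obtain ⟨_, ⟨y, hy, rfl⟩, h⟩ := exists_lt_of_csInf_lt (hFn n)
      (show sInf (F n) < d n + 1 / ((n : ℝ) + 1) from lt_add_of_pos_right _ (by positivity))
    exact ⟨y, hy, h⟩
  choose y hyA hyd using hy
  have hle : ∀ N n : ℕ, N ≤ n → ‖y n‖ ^ q ≤ D + 1 / ((N : ℝ) + 1) := by
    intro N n hn
    have h1 : 1 / ((n : ℝ) + 1) ≤ 1 / ((N : ℝ) + 1) := by gcongr
    linarith [hyd n, hdD n]
  have hcau : CauchySeq y := by
    rw [Metric.cauchySeq_iff']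
    intro ε hε
    obtain ⟨C, hC, hgap⟩ := H (ε ^ q / (8 * (D + 1))) (by positivity)
    have hη : Tendsto (fun N : ℕ => C * (D - d N + 1 / ((N : ℝ) + 1))) atTop (𝓝 0) := by
      have := ((hD.const_sub D).add (tendsto_one_div_add_atTop_nhds_zero_nat (𝕜 := ℝ))).const_mul C
      simpa using this
    obtain ⟨N, hN⟩ := (hη.eventually (gt_mem_nhds (show 0 < ε ^ q / 2 by positivity))).exists
    refine ⟨N, fun n hn => ?_⟩
    have h1 := hgap (y n) (y N)
    have h2 := hdle N _ (hAm N _ (hAa N n hn (hyA n)) _ (hyA N))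
    have h3 := hle N n hn
    have h4 := hle N N le_rfl
    have h5 : 1 / ((N : ℝ) + 1) ≤ 1 := by
      rw [div_le_one (by positivity)]; linarith [Nat.cast_nonneg (α := ℝ) N]
    have h6 : C * (2⁻¹ * ‖y n‖ ^ q + 2⁻¹ * ‖y N‖ ^ q - ‖(2⁻¹ : ℂ) • (y n + y N)‖ ^ q) ≤
        C * (D - d N + 1 / ((N : ℝ) + 1)) := by
      gcongr
      linarith
    have h7 : ε ^ q / (8 * (D + 1)) * (‖y n‖ ^ q + ‖y N‖ ^ q) ≤
        ε ^ q / (8 * (D + 1)) * (2 * (D + 1)) := by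
      gcongr
      linarith
    have h8 : ε ^ q / (8 * (D + 1)) * (2 * (D + 1)) = ε ^ q / 4 := by field_simp; norm_num
    have h9 : ‖y n - y N‖ ^ q < ε ^ q := by
      have : 0 < ε ^ q := by positivity
      linarith
    rw [dist_eq_norm]
    exact (Real.rpow_lt_rpow_iff (norm_nonneg _) hε.le hq).1 h9
  obtain ⟨x₀, hx₀⟩ := cauchySeq_tendsto_of_complete hcau
  refine ⟨x₀, fun s h1 h2 h3 => ?_⟩
  obtain ⟨N, hN⟩ := eventually_atTop.1 h3
  have : x₀ ∈ A N := (hAc N).mem_of_tendsto hx₀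
    (eventually_atTop.2 ⟨N, fun n hn => hAa N n hn (hyA n)⟩)
  exact this s h1 h2 hN

theorem Lp_norm_rpow_eq {E : Type*} [NormedAddCommGroup E] {α : Type*}
    {m : MeasurableSpace α} {ν : Measure α} {p : ℝ≥0∞} (hp : p ≠ 0) (hp' : p ≠ ∞) (f : Lp E p ν) :
    ‖f‖ ^ p.toReal = ∫ x, ‖f x‖ ^ p.toReal ∂ν := by
  have h0 : 0 < p.toReal := ENNReal.toReal_pos hp hp'
  rw [Lp.norm_def, (Lp.memLp f).eLpNorm_eq_integral_rpow_norm hp hp',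
    ENNReal.toReal_ofReal (by positivity), ← Real.rpow_mul (by positivity),
    inv_mul_cancel₀ h0.ne', Real.rpow_one]

variable {E : Type*} [NormedAddCommGroup E] [InnerProductSpace ℂ E]

theorem norm_midpoint_rpow_lt {q : ℝ} (hq : 1 < q) {a b : E} (hab : a ≠ b) :
    ‖(2⁻¹ : ℂ) • (a + b)‖ ^ q < 2⁻¹ * ‖a‖ ^ q + 2⁻¹ * ‖b‖ ^ q := by
  have hn : ‖(2⁻¹ : ℂ) • (a + b)‖ = 2⁻¹ * ‖a + b‖ := by rw [norm_smul]; norm_num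
  by_cases h : ‖a‖ = ‖b‖
  · have h1 := parallelogram_law_with_norm ℂ a b
    have h2 : 0 < ‖a - b‖ := norm_pos_iff.2 (sub_ne_zero.2 hab)
    rw [← h] at h1 ⊢
    have h3 : ‖(2⁻¹ : ℂ) • (a + b)‖ < ‖a‖ := by
      rw [hn]
      nlinarith [norm_nonneg a, norm_nonneg (a + b), mul_pos h2 h2]
    calc _ < ‖a‖ ^ q := Real.rpow_lt_rpow (norm_nonneg _) h3 (by linarith)
      _ = _ := by ring
  · have h1 : ‖(2⁻¹ : ℂ) • (a + b)‖ ≤ 2⁻¹ * ‖a‖ + 2⁻¹ * ‖b‖ := by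
      rw [hn]; linarith [norm_add_le a b]
    have h2 := (strictConvexOn_rpow hq).2 (norm_nonneg a) (norm_nonneg b) h
      (show (0 : ℝ) < 2⁻¹ by norm_num) (show (0 : ℝ) < 2⁻¹ by norm_num) (by norm_num)
    simp only [smul_eq_mul] at h2
    exact (Real.rpow_le_rpow (norm_nonneg _) h1 (by linarith)).trans_lt h2

/-- A quantitative form of the strict convexity of `‖·‖ ^ q`, from homogeneity and the compactness of
the unit sphere of `E × E`. -/
theorem exists_norm_sub_rpow_le [FiniteDimensional ℂ E] {q : ℝ} (hq : 1 < q) {δ : ℝ}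
    (hδ : 0 < δ) : ∃ C : ℝ, 0 ≤ C ∧ ∀ a b : E, ‖a - b‖ ^ q ≤ δ * (‖a‖ ^ q + ‖b‖ ^ q) +
      C * (2⁻¹ * ‖a‖ ^ q + 2⁻¹ * ‖b‖ ^ q - ‖(2⁻¹ : ℂ) • (a + b)‖ ^ q) := by
  have hq0 : 0 ≤ q := by linarith
  have : ProperSpace E := FiniteDimensional.proper ℂ E
  let G : E × E → ℝ := fun z => 2⁻¹ * ‖z.1‖ ^ q + 2⁻¹ * ‖z.2‖ ^ q - ‖(2⁻¹ : ℂ) • (z.1 + z.2)‖ ^ q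
  let N : E × E → ℝ := fun z => ‖z.1 - z.2‖ ^ q
  let W : E × E → ℝ := fun z => δ * (‖z.1‖ ^ q + ‖z.2‖ ^ q)
  have hrp : Continuous fun t : ℝ => t ^ q := Real.continuous_rpow_const hq0
  have hG : Continuous G :=
    ((continuous_const.mul (hrp.comp (by fun_prop))).add
      (continuous_const.mul (hrp.comp (by fun_prop)))).sub (hrp.comp (by fun_prop))
  have hN : Continuous N := hrp.comp (by fun_prop)
  have hW : Continuous W :=
    continuous_const.mul ((hrp.comp (by fun_prop)).add (hrp.comp (by fun_prop)))
  have hG0 : ∀ z, 0 ≤ G z := by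
    rintro ⟨a, b⟩
    by_cases hab : a = b
    · subst hab
      have : (2⁻¹ : ℂ) • (a + a) = a := by module
      simp only [G, this]
      linarith
    · have := norm_midpoint_rpow_lt hq hab
      simp only [G]; linarith
  let S : Set (E × E) := Metric.sphere 0 1 ∩ {z | W z ≤ N z}
  have hS : IsCompact S := (isCompact_sphere 0 1).inter_right (isClosed_le hW hN)
  have hpos : ∀ z ∈ S, 0 < G z := by
    rintro ⟨a, b⟩ ⟨h1, h2⟩
    have hab : a ≠ b := by
      rintro rfl
      have h3 : δ * (‖a‖ ^ q + ‖a‖ ^ q) ≤ ‖a - a‖ ^ q := h2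
      rw [sub_self, norm_zero, Real.zero_rpow (by linarith)] at h3
      have h4 : ‖a‖ = 1 := by simpa [Prod.norm_def] using h1
      rw [h4, Real.one_rpow] at h3
      linarith
    have := norm_midpoint_rpow_lt hq hab
    simp only [G]; linarith
  -- On the compact part `W ≤ N` of the unit sphere `G` has a positive minimum.
  obtain ⟨C, hC, hsph⟩ : ∃ C, 0 ≤ C ∧ ∀ z ∈ Metric.sphere (0 : E × E) 1, N z ≤ W z + C * G z := by
    rcases S.eq_empty_or_nonempty with he | hne
    · refine ⟨0, le_rfl, fun z hz => ?_⟩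
      by_contra hcon
      have : z ∈ S := ⟨hz, by change W z ≤ N z; linarith⟩
      simp [he] at this
    · obtain ⟨z₀, hz₀, hmin⟩ := hS.exists_isMinOn hne hG.continuousOn
      obtain ⟨z₁, -, hmax⟩ := hS.exists_isMaxOn hne hN.continuousOn
      have hp := hpos z₀ hz₀
      have hN1 : 0 ≤ N z₁ := by positivity
      refine ⟨N z₁ / G z₀, by positivity, fun z hz => ?_⟩
      have hW0 : 0 ≤ W z := by positivity
      by_cases hzS : W z ≤ N z
      · have h1 : G z₀ ≤ G z := hmin ⟨hz, hzS⟩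
        have h2 : N z ≤ N z₁ := hmax ⟨hz, hzS⟩
        have h3 : N z₁ / G z₀ * G z₀ ≤ N z₁ / G z₀ * G z := by gcongr
        rw [div_mul_cancel₀ _ hp.ne'] at h3
        linarith
      · have := hG0 z
        have : 0 ≤ N z₁ / G z₀ * G z := by positivity
        linarith
  refine ⟨C, hC, fun a b => ?_⟩
  by_cases hz : (a, b) = (0 : E × E)
  · obtain ⟨rfl, rfl⟩ := Prod.mk_eq_zero.1 hz
    simp [Real.zero_rpow (show q ≠ 0 by linarith)]
  set r := ‖((a, b) : E × E)‖ with hr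
  have hr0 : 0 < r := norm_pos_iff.2 hz
  have h1 := hsph (((r⁻¹ : ℝ) : ℂ) • (a, b)) (by
    rw [mem_sphere_zero_iff_norm, norm_smul, Complex.norm_real, norm_inv, norm_norm,
      inv_mul_cancel₀ hr0.ne'])
  have hs : ∀ c : E, ‖((r⁻¹ : ℝ) : ℂ) • c‖ ^ q = (r⁻¹) ^ q * ‖c‖ ^ q := by
    intro c
    rw [norm_smul, Complex.norm_real, norm_inv, norm_norm,
      Real.mul_rpow (by positivity) (norm_nonneg _)]
  simp only [N, W, G, Prod.smul_fst, Prod.smul_snd] at h1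
  rw [← smul_sub, ← smul_add, smul_comm (2⁻¹ : ℂ), hs, hs, hs, hs] at h1
  have hrq : 0 < (r⁻¹) ^ q := by positivity
  refine le_of_mul_le_mul_left ?_ hrq
  linarith

theorem hasConvexLimits_Lp {α : Type*} {m : MeasurableSpace α} {ν : Measure α}
    [FiniteDimensional ℂ E] {p : ℝ≥0∞} [Fact (1 ≤ p)] (hp : 1 < p) (hp' : p < ∞) :
    HasConvexLimits (Lp E p ν) := by
  have hp0 : p ≠ 0 := (zero_lt_one.trans hp).ne'
  have : CompleteSpace E := FiniteDimensional.complete ℂ E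
  have hq : 1 < p.toReal := by
    rw [← ENNReal.toReal_one]
    exact (ENNReal.toReal_lt_toReal ENNReal.one_ne_top hp'.ne).2 hp
  refine HasConvexLimits.of_gap (q := p.toReal) (by linarith) fun δ hδ => ?_
  obtain ⟨C, hC, h⟩ := exists_norm_sub_rpow_le (E := E) hq hδ
  refine ⟨C, hC, fun f g => ?_⟩
  have hi : ∀ u : Lp E p ν, Integrable (fun x => ‖u x‖ ^ p.toReal) ν := fun u =>
    (Lp.memLp u).integrable_norm_rpow hp0 hp'.ne
  simp only [Lp_norm_rpow_eq hp0 hp'.ne]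
  have e1 : ∫ x, ‖(f - g) x‖ ^ p.toReal ∂ν ≤ ∫ x, (δ * (‖f x‖ ^ p.toReal + ‖g x‖ ^ p.toReal) +
      C * (2⁻¹ * ‖f x‖ ^ p.toReal + 2⁻¹ * ‖g x‖ ^ p.toReal -
        ‖((2⁻¹ : ℂ) • (f + g)) x‖ ^ p.toReal)) ∂ν := by
    refine integral_mono_ae (hi _) ((((hi f).add (hi g)).const_mul _).add
      (((((hi f).const_mul _).add ((hi g).const_mul _)).sub (hi _)).const_mul _)) ?_
    filter_upwards [Lp.coeFn_sub f g, Lp.coeFn_smul (2⁻¹ : ℂ) (f + g), Lp.coeFn_add f g]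
      with x h1 h2 h3
    simp only [h1, h2, h3, Pi.sub_apply, Pi.smul_apply, Pi.add_apply]
    exact h _ _
  have e2 : ∀ F G H : α → ℝ, Integrable F ν → Integrable G ν → Integrable H ν →
      ∫ x, (δ * (F x + G x) + C * (2⁻¹ * F x + 2⁻¹ * G x - H x)) ∂ν =
        δ * (∫ x, F x ∂ν + ∫ x, G x ∂ν) +
          C * (2⁻¹ * ∫ x, F x ∂ν + 2⁻¹ * ∫ x, G x ∂ν - ∫ x, H x ∂ν) := by
    intro F G H hF hG hH
    have i1 : Integrable (fun x => δ * (F x + G x)) ν := (hF.add hG).const_mul δ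
    have i2 : Integrable (fun x => 2⁻¹ * F x + 2⁻¹ * G x) ν := (hF.const_mul _).add (hG.const_mul _)
    have i3 : Integrable (fun x => C * (2⁻¹ * F x + 2⁻¹ * G x - H x)) ν := (i2.sub hH).const_mul C
    rw [integral_add i1 i3, integral_const_mul, integral_const_mul, integral_add hF hG,
      integral_sub i2 hH, integral_add (hF.const_mul _) (hG.const_mul _), integral_const_mul,
      integral_const_mul]
  rwa [e2 _ _ _ (hi f) (hi g) (hi _)] at e1

end Convexity

/-! ### Rotation of contours -/

section Rays

theorem integral_comp_exp {F : Type*} [NormedAddCommGroup F] [NormedSpace ℝ F] (g : ℝ → F) :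
    ∫ x, Real.exp x • g (Real.exp x) = ∫ y in Ioi 0, g y := by
  symm
  rw [← Real.range_exp, ← image_univ]
  simpa [abs_of_pos (Real.exp_pos _)] using integral_image_eq_integral_abs_deriv_smul
      (MeasurableSet.univ) (fun x _ ↦ (Real.hasDerivAt_exp x).hasDerivWithinAt)
      (fun x _ y _ hxy ↦ Real.exp_injective hxy) g

theorem integrable_comp_exp {F : Type*} [NormedAddCommGroup F] [NormedSpace ℝ F] {g : ℝ → F}
    (hg : IntegrableOn g (Ioi 0)) : Integrable fun x => Real.exp x • g (Real.exp x) := by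
  rw [← Real.range_exp, ← image_univ] at hg
  simpa [abs_of_pos (Real.exp_pos _)] using (integrableOn_image_iff_integrableOn_abs_deriv_smul
      (MeasurableSet.univ) (fun x _ ↦ (Real.hasDerivAt_exp x).hasDerivWithinAt)
      (fun x _ y _ hxy ↦ Real.exp_injective hxy) g).1 hg

/-- The integral of `f` along the ray of angle `φ` from the origin. -/
def rayIntegral {F : Type*} [NormedAddCommGroup F] [NormedSpace ℂ F] (f : ℂ → F) (φ : ℝ) : F :=
  ∫ r in Ioi (0 : ℝ), Complex.exp (φ * Complex.I) • f (r * Complex.exp (φ * Complex.I))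

theorem exp_re_add (x φ : ℝ) : Complex.exp (x + φ * Complex.I) =
    (Real.exp x : ℝ) * Complex.exp (φ * Complex.I) := by
  rw [Complex.exp_add, Complex.ofReal_exp]

variable {F : Type*} [NormedAddCommGroup F] [NormedSpace ℂ F] {f : ℂ → F}

theorem rayIntegral_eq (φ : ℝ) : rayIntegral f φ = ∫ x : ℝ,
    Complex.exp (x + φ * Complex.I) • f (Complex.exp (x + φ * Complex.I)) := by
  rw [rayIntegral, ← integral_comp_exp]
  refine integral_congr_ae (Eventually.of_forall fun x => ?_)
  simp only [exp_re_add]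
  rw [← Complex.coe_smul, smul_smul]

theorem integrable_exp_ray {φ : ℝ}
    (h : IntegrableOn (fun r : ℝ => f (r * Complex.exp (φ * Complex.I))) (Ioi 0)) :
    Integrable fun x : ℝ =>
      Complex.exp (x + φ * Complex.I) • f (Complex.exp (x + φ * Complex.I)) := by
  have h1 := integrable_comp_exp (h.smul (Complex.exp (φ * Complex.I)))
  refine h1.congr (Eventually.of_forall fun x => ?_)
  simp only [exp_re_add, Pi.smul_apply]
  rw [← Complex.coe_smul, smul_smul]

/-- Cauchy's theorem in the sector `α ≤ arg z ≤ β`. In the coordinate `log z` the sector is a strip,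
exhausted by rectangles. The bound `‖f z‖ = O(1 / |1 - t² |z|²|)` makes the vertical sides of the
rectangles negligible; it says nothing on the circle `|z| = 1 / |t|`, which carries the removable
singularities of the functions in question. -/
theorem rayIntegral_rotate [CompleteSpace F] {α β : ℝ} (hαβ : α ≤ β) {U : Set ℂ}
    (hf : DifferentiableOn ℂ f U)
    (hU : ∀ r : ℝ, 0 < r → ∀ φ ∈ Icc α β, r * Complex.exp (φ * Complex.I) ∈ U) {t C : ℝ}
    (ht : t ≠ 0) (hb : ∀ r : ℝ, 0 < r → ∀ φ ∈ Icc α β,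
      ‖f (r * Complex.exp (φ * Complex.I))‖ * |1 - t ^ 2 * r ^ 2| ≤ C)
    (hiα : IntegrableOn (fun r : ℝ => f (r * Complex.exp (α * Complex.I))) (Ioi 0))
    (hiβ : IntegrableOn (fun r : ℝ => f (r * Complex.exp (β * Complex.I))) (Ioi 0)) :
    rayIntegral f α = rayIntegral f β := by
  have ht2 : 0 < t ^ 2 := by positivity
  set g : ℂ → F := fun w => Complex.exp w • f (Complex.exp w) with hg
  have hgd : DifferentiableOn ℂ g {w | w.im ∈ Icc α β} := by
    refine Complex.differentiable_exp.differentiableOn.smul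
      (hf.comp Complex.differentiable_exp.differentiableOn fun w hw => ?_)
    have := hU (Real.exp w.re) (Real.exp_pos _) w.im hw
    rwa [← exp_re_add, Complex.re_add_im] at this
  have hC : 0 ≤ C := (by positivity : (0 : ℝ) ≤ _).trans (hb 1 one_pos α ⟨le_rfl, hαβ⟩)
  have hgn : ∀ x y : ℝ, ‖g (x + y * Complex.I)‖ =
      Real.exp x * ‖f (Real.exp x * Complex.exp (y * Complex.I))‖ := by
    intro x y
    simp only [hg]
    rw [norm_smul, Complex.norm_exp, exp_re_add]
    simp
  let V : ℝ → F := fun x => ∫ y in α..β, g (x + y * Complex.I)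
  have hVbot : Tendsto V atBot (𝓝 0) := by
    have h0 : Tendsto (fun x => 2 * C * Real.exp x * |β - α|) atBot (𝓝 0) := by
      simpa using (Real.tendsto_exp_atBot.const_mul (2 * C)).mul_const |β - α|
    have h1 : Tendsto (fun x => t ^ 2 * Real.exp x ^ 2) atBot (𝓝 0) := by
      simpa using (Real.tendsto_exp_atBot.pow 2).const_mul (t ^ 2)
    refine squeeze_zero_norm' ?_ h0
    filter_upwards [h1.eventually (gt_mem_nhds (show (0 : ℝ) < 1 / 2 by norm_num))] with x hx
    refine intervalIntegral.norm_integral_le_of_norm_le_const fun y hy => ?_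
    rw [uIoc_of_le hαβ] at hy
    have h2 := hb (Real.exp x) (Real.exp_pos _) y ⟨hy.1.le, hy.2⟩
    rw [hgn, mul_comm (2 * C)]
    refine mul_le_mul_of_nonneg_left ?_ (Real.exp_pos x).le
    have h3 : 1 / 2 ≤ |1 - t ^ 2 * Real.exp x ^ 2| := by
      rw [abs_of_pos (by linarith)]; linarith
    nlinarith [norm_nonneg (f (Real.exp x * Complex.exp (y * Complex.I)))]
  have hVtop : Tendsto V atTop (𝓝 0) := by
    have h0 : Tendsto (fun x => 2 * C / t ^ 2 * Real.exp (-x) * |β - α|) atTop (𝓝 0) := by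
      simpa using ((Real.tendsto_exp_neg_atTop_nhds_zero).const_mul (2 * C / t ^ 2)).mul_const
        |β - α|
    have h1 : Tendsto (fun x => t ^ 2 * Real.exp x ^ 2) atTop atTop :=
      ((tendsto_pow_atTop two_ne_zero).comp Real.tendsto_exp_atTop).const_mul_atTop ht2
    refine squeeze_zero_norm' ?_ h0
    filter_upwards [h1.eventually (eventually_ge_atTop 2)] with x hx
    refine intervalIntegral.norm_integral_le_of_norm_le_const fun y hy => ?_
    rw [uIoc_of_le hαβ] at hy
    have h2 := hb (Real.exp x) (Real.exp_pos _) y ⟨hy.1.le, hy.2⟩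
    rw [hgn, Real.exp_neg]
    have hx0 := Real.exp_pos x
    have h3 : t ^ 2 * Real.exp x ^ 2 / 2 ≤ |1 - t ^ 2 * Real.exp x ^ 2| := by
      rw [abs_of_neg (by linarith)]; linarith
    have h4 : ‖f (Real.exp x * Complex.exp (y * Complex.I))‖ * (t ^ 2 * Real.exp x ^ 2 / 2) ≤ C :=
      (mul_le_mul_of_nonneg_left h3 (norm_nonneg _)).trans h2
    rw [← div_eq_mul_inv, div_div, le_div_iff₀ (by positivity)]
    nlinarith
  have hrect : ∀ L : ℝ, (∫ x in (-L)..L, g (x + α * Complex.I)) -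
      (∫ x in (-L)..L, g (x + β * Complex.I)) = Complex.I • V (-L) - Complex.I • V L := by
    intro L
    have h := Complex.integral_boundary_rect_eq_zero_of_differentiableOn g
      ((-L : ℝ) + α * Complex.I) ((L : ℝ) + β * Complex.I) (hgd.mono (by
        intro w hw
        have := (Complex.mem_reProdIm.1 hw).2
        simpa [uIcc_of_le hαβ] using this))
    simp only [Complex.add_re, Complex.ofReal_re, Complex.mul_re, Complex.I_re, mul_zero,
      Complex.ofReal_im, Complex.I_im, mul_one, sub_self, add_zero, Complex.add_im, Complex.mul_im,
      zero_add] at h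
    have h' : (∫ x in (-L)..L, g (x + α * Complex.I)) - (∫ x in (-L)..L, g (x + β * Complex.I)) +
      Complex.I • V L - Complex.I • V (-L) = 0 := h
    rw [sub_eq_zero] at h'
    rw [← h']; abel
  have hα := (intervalIntegral_tendsto_integral (integrable_exp_ray hiα) tendsto_neg_atTop_atBot
    tendsto_id)
  have hβ := (intervalIntegral_tendsto_integral (integrable_exp_ray hiβ) tendsto_neg_atTop_atBot
    tendsto_id)
  rw [← rayIntegral_eq] at hα hβ
  have h1 := hα.sub hβ
  have h2 := ((hVbot.comp tendsto_neg_atTop_atBot).const_smul Complex.I).sub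
    (hVtop.const_smul Complex.I)
  rw [smul_zero, sub_zero] at h2
  exact sub_eq_zero.1 (tendsto_nhds_unique h1 (h2.congr fun L => (hrect L).symm))

end Rays

/-! ### Double sectors -/

theorem abs_sin_le_of_abs_le {θ φ : ℝ} (h : θ ≤ Real.pi / 2) (hφ : |φ| ≤ θ) :
    |Real.sin φ| ≤ Real.sin θ := by
  obtain ⟨h1, h2⟩ := abs_le.1 hφ
  rw [abs_le]
  refine ⟨?_, Real.sin_le_sin_of_le_of_le_pi_div_two (by linarith) h h2⟩
  rw [← Real.sin_neg]
  exact Real.sin_le_sin_of_le_of_le_pi_div_two (by linarith) (by linarith) h1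

theorem abs_im_le_of_abs_arg_le {z : ℂ} {α : ℝ} (hα : α ≤ Real.pi / 2) (h : |z.arg| ≤ α) :
    |z.im| ≤ Real.sin α * ‖z‖ := by
  have h1 := abs_sin_le_of_abs_le hα h
  rw [← Complex.norm_mul_sin_arg z, abs_mul, abs_norm, mul_comm]
  gcongr

theorem abs_im_le_of_mem_closedBisector {z : ℂ} {α : ℝ} (hα : α ≤ Real.pi / 2)
    (h : z ∈ closedBisector α) : |z.im| ≤ Real.sin α * ‖z‖ := by
  rcases h with rfl | h | h
  · simp
  · exact abs_im_le_of_abs_arg_le hα h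
  · simpa using abs_im_le_of_abs_arg_le hα h

theorem abs_im_le_of_mem_openBisector {z : ℂ} {α : ℝ} (hα : α ≤ Real.pi / 2)
    (h : z ∈ openBisector α) : |z.im| ≤ Real.sin α * ‖z‖ :=
  abs_im_le_of_mem_closedBisector hα (Or.inr (h.2.imp le_of_lt le_of_lt))

/-- The open double cone around the imaginary axis where `|Im z| > s |z|`. -/
def imagCone (s : ℝ) : Set ℂ := {z | s * ‖z‖ < |z.im|}

theorem isOpen_imagCone (s : ℝ) : IsOpen (imagCone s) :=
  isOpen_lt (by fun_prop) (Complex.continuous_im.abs)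

theorem ne_zero_of_mem_imagCone {s : ℝ} {z : ℂ} (h : z ∈ imagCone s) : z ≠ 0 := by
  rintro rfl
  simp [imagCone] at h

theorem mem_imagCone_ray {s r φ : ℝ} (hr : 0 < r) (h : s < |Real.sin φ|) :
    (r : ℂ) * Complex.exp (φ * Complex.I) ∈ imagCone s := by
  have h1 : ((r : ℂ) * Complex.exp (φ * Complex.I)).im = r * Real.sin φ := by
    rw [Complex.im_ofReal_mul, Complex.exp_ofReal_mul_I_im]
  have h2 : ‖(r : ℂ) * Complex.exp (φ * Complex.I)‖ = r := by
    rw [norm_mul, Complex.norm_exp_ofReal_mul_I, mul_one, Complex.norm_real,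
      Real.norm_of_nonneg hr.le]
  change s * _ < _
  rw [h1, h2, abs_mul, abs_of_pos hr, mul_comm]
  gcongr

theorem one_sub_mul_le_norm {z : ℂ} {σ : ℝ} (hσ : 0 ≤ σ) (hσ' : σ ≤ 1) (hz : |z.im| ≤ σ * ‖z‖)
    (t : ℝ) : (1 - σ) * (1 + t ^ 2 * ‖z‖ ^ 2) ≤ ‖1 + (t : ℂ) ^ 2 * z ^ 2‖ := by
  -- Factor `1 + t² z² = (1 + i t z) (1 - i t z)`.
  have hsq : ∀ τ : ℝ, |τ| = |t| → (1 - σ) * (1 + t ^ 2 * ‖z‖ ^ 2) ≤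
      ‖1 + Complex.I * (τ * z)‖ ^ 2 := by
    intro τ hτ
    have h1 : ‖1 + Complex.I * (τ * z)‖ ^ 2 = 1 - 2 * (τ * z.im) + t ^ 2 * ‖z‖ ^ 2 := by
      rw [← sq_abs t, ← hτ, sq_abs, ← Complex.normSq_eq_norm_sq, ← Complex.normSq_eq_norm_sq,
        Complex.normSq_apply, Complex.normSq_apply]
      simp
      ring
    have h2 : τ * z.im ≤ |t| * (σ * ‖z‖) :=
      (le_abs_self _).trans (by rw [abs_mul, hτ]; gcongr)
    have h3 : 2 * (|t| * ‖z‖) ≤ 1 + t ^ 2 * ‖z‖ ^ 2 := by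
      nlinarith [sq_nonneg (|t| * ‖z‖ - 1), sq_abs t]
    rw [h1]
    nlinarith
  have h1 := hsq t rfl
  have h2 := hsq (-t) (abs_neg t)
  have h3 : ‖1 + (t : ℂ) ^ 2 * z ^ 2‖ ^ 2 =
      ‖1 + Complex.I * (t * z)‖ ^ 2 * ‖1 + Complex.I * ((-t : ℝ) * z)‖ ^ 2 := by
    rw [← mul_pow (‖_‖), ← norm_mul]
    congr 2
    push_cast
    linear_combination (t : ℂ) ^ 2 * z ^ 2 * Complex.I_mul_I
  have h4 : 0 ≤ (1 - σ) * (1 + t ^ 2 * ‖z‖ ^ 2) :=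
    mul_nonneg (by linarith) (by positivity)
  refine (sq_le_sq₀ h4 (norm_nonneg _)).1 ?_
  rw [h3, sq]
  exact mul_le_mul h1 h2 h4 (by positivity)

theorem abs_one_sub_le_norm (z : ℂ) (t : ℝ) :
    |1 - t ^ 2 * ‖z‖ ^ 2| ≤ ‖1 + (t : ℂ) ^ 2 * z ^ 2‖ := by
  have h := abs_norm_sub_norm_le (1 : ℂ) (-((t : ℂ) ^ 2 * z ^ 2))
  rw [sub_neg_eq_add, norm_neg, norm_one, norm_mul, norm_pow, norm_pow, Complex.norm_real,
    Real.norm_eq_abs, sq_abs] at h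
  exact h

/-! ### Resolvents off the real axis -/

section Resolvent

variable {X : Type*} [NormedAddCommGroup X] [NormedSpace ℂ X] {D : X →ₗ.[ℂ] X}

theorem IsResolventAt.mem_graph {z : ℂ} {R : X →L[ℂ] X} (h : IsResolventAt D z R) (u : X) :
    (R u, z • R u - u) ∈ D.graph := by
  obtain ⟨h1, h2⟩ := h.1 u
  have h3 : z • R u - u = D ⟨R u, h1⟩ := by
    nth_rw 2 [← h2]; abel
  rw [h3]
  exact D.mem_graph ⟨R u, h1⟩

theorem IsResolventAt.apply_sub {z : ℂ} {R : X →L[ℂ] X} (h : IsResolventAt D z R) {x y : X}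
    (hxy : (x, y) ∈ D.graph) : R (z • x - y) = x := by
  obtain ⟨w, rfl, rfl⟩ := (LinearPMap.mem_graph_iff D).1 hxy
  exact h.2 w

theorem IsResolventAt.sub_eq {z w : ℂ} {R S : X →L[ℂ] X} (hR : IsResolventAt D z R)
    (hS : IsResolventAt D w S) : R - S = (w - z) • (R * S) := by
  ext u
  have h := hR.apply_sub (hS.mem_graph u)
  have h1 : z • S u - (w • S u - u) = u - (w - z) • S u := by module
  rw [h1, map_sub, map_smul] at h
  change R u - S u = (w - z) • R (S u)
  nth_rw 1 [← h]
  abel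

theorem isResolventAt_resolvent {z : ℂ} (h : z ∈ resolventSet D) :
    IsResolventAt D z (resolvent D z) := by
  have h' : ∃ R : X →L[ℂ] X, IsResolventAt D z R := h
  rw [resolvent, dif_pos h']
  exact h'.choose_spec

variable {R : ℂ → X →L[ℂ] X} {s C : ℝ}

theorem continuousOn_resolvent (hR : ∀ z ∈ imagCone s, IsResolventAt D z (R z))
    (hC : ∀ z ∈ imagCone s, ‖z • R z‖ ≤ C) : ContinuousOn R (imagCone s) := by
  intro z hz
  refine ContinuousAt.continuousWithinAt ?_
  have hz0 : z ≠ 0 := ne_zero_of_mem_imagCone hz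
  have hev : ∀ᶠ w in 𝓝 z, w ∈ imagCone s := (isOpen_imagCone s).mem_nhds hz
  rw [ContinuousAt, tendsto_iff_norm_sub_tendsto_zero]
  have h0 : Tendsto (fun w : ℂ => ‖z - w‖ * (C / ‖w‖ * ‖R z‖)) (𝓝 z) (𝓝 0) := by
    have : ContinuousAt (fun w : ℂ => ‖z - w‖ * (C / ‖w‖ * ‖R z‖)) z := by
      have : ContinuousAt (fun w : ℂ => C / ‖w‖) z :=
        continuousAt_const.div continuous_norm.continuousAt (norm_ne_zero_iff.2 hz0)
      fun_prop
    have h1 := this.tendsto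
    simpa using h1
  refine squeeze_zero' (Eventually.of_forall fun _ => norm_nonneg _) ?_ h0
  filter_upwards [hev] with w hw
  rw [(hR w hw).sub_eq (hR z hz), norm_smul]
  gcongr
  refine (norm_mul_le _ _).trans ?_
  gcongr
  have hw0 : w ≠ 0 := ne_zero_of_mem_imagCone hw
  rw [le_div_iff₀ (norm_pos_iff.2 hw0), mul_comm, ← norm_smul]
  exact hC w hw

theorem differentiableOn_resolvent (hR : ∀ z ∈ imagCone s, IsResolventAt D z (R z))
    (hC : ∀ z ∈ imagCone s, ‖z • R z‖ ≤ C) : DifferentiableOn ℂ R (imagCone s) := by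
  intro z hz
  have hev : ∀ᶠ w in 𝓝 z, w ∈ imagCone s := (isOpen_imagCone s).mem_nhds hz
  have hc : ContinuousAt R z :=
    (continuousOn_resolvent hR hC).continuousAt ((isOpen_imagCone s).mem_nhds hz)
  have h : HasDerivAt R (-(R z * R z)) z := by
    rw [hasDerivAt_iff_tendsto_slope]
    have h1 : Tendsto (fun w => -(R w * R z)) (𝓝[≠] z) (𝓝 (-(R z * R z))) :=
      ((hc.tendsto.mul_const (R z)).neg).mono_left nhdsWithin_le_nhds
    refine h1.congr' ?_
    filter_upwards [nhdsWithin_le_nhds hev, self_mem_nhdsWithin] with w hw hne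
    rw [slope, vsub_eq_sub, (hR w hw).sub_eq (hR z hz), smul_smul]
    have : (w - z)⁻¹ * (z - w) = -1 := by
      rw [← neg_sub w z, mul_neg, inv_mul_cancel₀ (sub_ne_zero.2 hne)]
    rw [this, neg_one_smul]
  exact h.differentiableAt.differentiableWithinAt

theorem I_div_mem_imagCone (hs : s < 1) {t : ℝ} (ht : t ≠ 0) : Complex.I / t ∈ imagCone s := by
  have h1 : (Complex.I / (t : ℂ)).im = t⁻¹ := by
    rw [Complex.div_ofReal_im]; simp
  have h2 : ‖Complex.I / (t : ℂ)‖ = |t⁻¹| := by simp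
  change s * _ < _
  rw [h1, h2]
  have : 0 < |t⁻¹| := by positivity
  nlinarith

/-- The resolvents on the imaginary axis, `(1 + i t D)⁻¹ = (i / t) (i / t - D)⁻¹`. -/
def imagFamily (R : ℂ → X →L[ℂ] X) (t : ℝ) : X →L[ℂ] X := (Complex.I / t) • R (Complex.I / t)

theorem isResolventFamily_imagFamily (hs : s < 1)
    (hR : ∀ z ∈ imagCone s, IsResolventAt D z (R z)) (hC : ∀ z ∈ imagCone s, ‖z • R z‖ ≤ C) :
    IsResolventFamily D (imagFamily R) C where
  mem_graph t ht u := by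
    have h := D.graph.smul_mem (Complex.I / t) ((hR _ (I_div_mem_imagCone hs ht)).mem_graph u)
    have h1 : (Complex.I * (t : ℂ))⁻¹ = -(Complex.I / t) := by
      rw [mul_inv, Complex.inv_I]; ring
    rw [h1]
    convert h using 1
    simp only [imagFamily, smul_apply, Prod.smul_mk]
    congr 1
    module
  apply_add t ht x y hxy := by
    have ht' : (t : ℂ) ≠ 0 := by simpa using ht
    have h := (hR _ (I_div_mem_imagCone hs ht)).apply_sub (D.graph.smul_mem (Complex.I / t) hxy)
    change R _ ((Complex.I / t) • (Complex.I / t) • x - (Complex.I / t) • y) = _ at h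
    change (Complex.I / (t : ℂ)) • R (Complex.I / t) (x + (Complex.I * t) • y) = x
    rw [← smul_sub, map_smul] at h
    have h2 := smul_right_injective X (r := Complex.I / (t : ℂ))
      (div_ne_zero Complex.I_ne_zero ht') h
    rw [← map_smul]
    have h3 : (Complex.I / (t : ℂ)) • (x + (Complex.I * t) • y) =
        (Complex.I / (t : ℂ)) • x - y := by
      rw [smul_add, smul_smul]
      have : Complex.I / (t : ℂ) * (Complex.I * t) = -1 := by
        field_simp; exact Complex.I_sq
      rw [this]; module
    rw [h3, h2]
  norm_le t ht := hC _ (I_div_mem_imagCone hs ht)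

end Resolvent

/-! ### The functional calculus of `t z / (1 + t² z²)` -/

section Kernel

/-- The kernel `t / (1 + t² z²)`. -/
def kern (t : ℝ) (z : ℂ) : ℂ := t / (1 + (t : ℂ) ^ 2 * z ^ 2)

theorem kern_neg (t : ℝ) (z : ℂ) : kern (-t) z = -kern t z := by
  simp [kern, neg_div]

theorem ray_norm {r φ : ℝ} (hr : 0 < r) : ‖(r : ℂ) * Complex.exp (φ * Complex.I)‖ = r := by
  rw [norm_mul, Complex.norm_exp_ofReal_mul_I, mul_one, Complex.norm_real,
    Real.norm_of_nonneg hr.le]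

theorem ray_abs_im {r φ σ : ℝ} (hr : 0 < r) (hφ : |Real.sin φ| ≤ σ) :
    |((r : ℂ) * Complex.exp (φ * Complex.I)).im| ≤
      σ * ‖(r : ℂ) * Complex.exp (φ * Complex.I)‖ := by
  rw [ray_norm hr, Complex.im_ofReal_mul, Complex.exp_ofReal_mul_I_im, abs_mul, abs_of_pos hr,
    mul_comm]
  gcongr

theorem kern_denom_ne_zero {z : ℂ} {σ : ℝ} (hσ : 0 ≤ σ) (hσ' : σ < 1) (hz : |z.im| ≤ σ * ‖z‖)
    (t : ℝ) : 1 + (t : ℂ) ^ 2 * z ^ 2 ≠ 0 := by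
  rw [← norm_pos_iff]
  refine lt_of_lt_of_le ?_ (one_sub_mul_le_norm hσ hσ'.le hz t)
  have : 0 < 1 - σ := by linarith
  positivity

theorem norm_kern_le {z : ℂ} {σ : ℝ} (hσ : 0 ≤ σ) (hσ' : σ < 1) (hz : |z.im| ≤ σ * ‖z‖)
    (t : ℝ) : ‖kern t z‖ ≤ |t| / (1 - σ) * (1 + t ^ 2 * ‖z‖ ^ 2)⁻¹ := by
  have h1 : 0 < 1 - σ := by linarith
  rw [kern, norm_div, Complex.norm_real, Real.norm_eq_abs, ← div_eq_mul_inv, div_div]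
  gcongr
  exact one_sub_mul_le_norm hσ hσ'.le hz t

theorem norm_kern_mul_le (z : ℂ) (t : ℝ) : ‖kern t z‖ * |1 - t ^ 2 * ‖z‖ ^ 2| ≤ |t| := by
  rw [kern, norm_div, Complex.norm_real, Real.norm_eq_abs]
  by_cases h : ‖1 + (t : ℂ) ^ 2 * z ^ 2‖ = 0
  · rw [h, div_zero, zero_mul]; positivity
  · rw [div_mul_eq_mul_div, div_le_iff₀ (by positivity)]
    gcongr
    exact abs_one_sub_le_norm z t

theorem differentiableOn_kern (t : ℝ) :
    DifferentiableOn ℂ (kern t) {z | 1 + (t : ℂ) ^ 2 * z ^ 2 ≠ 0} := by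
  intro z hz
  have h : DifferentiableAt ℂ (kern t) z := by
    unfold kern
    exact (differentiableAt_const _).div (by fun_prop) hz
  exact h.differentiableWithinAt

theorem integrableOn_kern_bound {t : ℝ} (ht : t ≠ 0) (C : ℝ) :
    IntegrableOn (fun r : ℝ => C * (1 + t ^ 2 * r ^ 2)⁻¹) (Ioi 0) := by
  have h := (integrable_inv_one_add_sq.comp_mul_left' ht).integrableOn (s := Ioi 0)
  simp only [mul_pow] at h
  exact h.const_mul C

/-- On a ray off the imaginary axis the kernel is integrable against bounded continuous
functions. -/
theorem integrableOn_kern_smul {F : Type*} [NormedAddCommGroup F] [NormedSpace ℂ F] {t φ C : ℝ}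
    (ht : t ≠ 0) (hφ : |Real.sin φ| < 1) {f : ℝ → F} (hf : ContinuousOn f (Ioi 0))
    (hC : ∀ r : ℝ, 0 < r → ‖f r‖ ≤ C) :
    IntegrableOn (fun r : ℝ => kern t (r * Complex.exp (φ * Complex.I)) • f r) (Ioi 0) := by
  have hσ := abs_nonneg (Real.sin φ)
  have h1 : 0 < 1 - |Real.sin φ| := by linarith
  refine Integrable.mono' (integrableOn_kern_bound ht (|t| / (1 - |Real.sin φ|) * C)) ?_ ?_
  · refine ContinuousOn.aestronglyMeasurable (ContinuousOn.smul ?_ hf) measurableSet_Ioi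
    refine (differentiableOn_kern t).continuousOn.comp (by fun_prop) fun r hr => ?_
    exact kern_denom_ne_zero hσ hφ (ray_abs_im hr le_rfl) t
  · refine (ae_restrict_iff' measurableSet_Ioi).2 (Eventually.of_forall fun r hr => ?_)
    have h2 := norm_kern_le hσ hφ (ray_abs_im hr le_rfl) t
    rw [ray_norm hr] at h2
    rw [norm_smul]
    calc _ ≤ |t| / (1 - |Real.sin φ|) * (1 + t ^ 2 * r ^ 2)⁻¹ * C := by
          gcongr
          exact hC r hr
      _ = _ := by ring

theorem integrableOn_kern {t φ : ℝ} (ht : t ≠ 0) (hφ : |Real.sin φ| < 1) :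
    IntegrableOn (fun r : ℝ => kern t (r * Complex.exp (φ * Complex.I))) (Ioi 0) := by
  simpa using integrableOn_kern_smul (F := ℂ) (C := 1) ht hφ (f := fun _ => 1)
    continuousOn_const (by simp)

theorem rayIntegral_kern_rotate {t α β σ : ℝ} (ht : t ≠ 0) (hαβ : α ≤ β) (hσ : σ < 1)
    (h : ∀ φ ∈ Icc α β, |Real.sin φ| ≤ σ) : rayIntegral (kern t) α = rayIntegral (kern t) β := by
  have hσ0 : 0 ≤ σ := (abs_nonneg _).trans (h α ⟨le_rfl, hαβ⟩)
  refine rayIntegral_rotate hαβ (differentiableOn_kern t) (fun r hr φ hφ => ?_) ht (C := |t|)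
    (fun r hr φ hφ => ?_) (integrableOn_kern ht ((h α ⟨le_rfl, hαβ⟩).trans_lt hσ))
    (integrableOn_kern ht ((h β ⟨hαβ, le_rfl⟩).trans_lt hσ))
  · exact kern_denom_ne_zero hσ0 hσ (ray_abs_im hr (h φ hφ)) t
  · have := norm_kern_mul_le (r * Complex.exp (φ * Complex.I)) t
    rwa [ray_norm hr] at this

theorem integral_kern {t : ℝ} (ht : 0 < t) : ∫ r in Ioi (0 : ℝ), kern t r = Real.pi / 2 := by
  have h1 := integral_comp_mul_left_Ioi (fun x : ℝ => (1 + x ^ 2)⁻¹) 0 ht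
  rw [mul_zero, integral_Ioi_inv_one_add_sq, Real.arctan_zero, sub_zero] at h1
  have h2 : ∀ r : ℝ, kern t r = ((t * (1 + (t * r) ^ 2)⁻¹ : ℝ) : ℂ) := by
    intro r
    simp only [kern, div_eq_mul_inv]
    push_cast
    rw [mul_pow]
  simp_rw [h2]
  rw [integral_complex_ofReal, integral_const_mul, h1, smul_eq_mul,
    mul_inv_cancel_left₀ ht.ne']
  push_cast; rfl

theorem rayIntegral_kern_of_sq {t φ : ℝ} (ht : 0 < t)
    (hφ : Complex.exp (φ * Complex.I) ^ 2 = 1) :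
    rayIntegral (kern t) φ = Complex.exp (φ * Complex.I) * (Real.pi / 2) := by
  rw [← integral_kern ht, rayIntegral]
  simp only [smul_eq_mul]
  rw [integral_const_mul]
  simp only [kern, mul_pow, hφ, mul_one]

end Kernel

section Operator

variable {X : Type*} [NormedAddCommGroup X] [NormedSpace ℂ X]
  {D : X →ₗ.[ℂ] X} {R : ℂ → X →L[ℂ] X} {s C : ℝ}

theorem integrableOn_kern_resolvent (hR : ∀ z ∈ imagCone s, IsResolventAt D z (R z))
    (hC : ∀ z ∈ imagCone s, ‖z • R z‖ ≤ C) {t φ : ℝ} (ht : t ≠ 0) (hφ : s < |Real.sin φ|)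
    (hφ' : |Real.sin φ| < 1) :
    IntegrableOn (fun r : ℝ => kern t (r * Complex.exp (φ * Complex.I)) •
      ((r * Complex.exp (φ * Complex.I)) • R (r * Complex.exp (φ * Complex.I)))) (Ioi 0) := by
  refine integrableOn_kern_smul (C := C) ht hφ' ?_ fun r hr => hC _ (mem_imagCone_ray hr hφ)
  have h1 : ContinuousOn (fun r : ℝ => (r : ℂ) * Complex.exp (φ * Complex.I)) (Ioi 0) := by
    fun_prop
  exact h1.smul ((continuousOn_resolvent hR hC).comp h1 fun r hr => mem_imagCone_ray hr hφ)

/-- The contribution of the pole `λ = i / t` of the kernel inside a sector `α ≤ arg z ≤ β`: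
there `k(z) (z R(z) - λ R(λ))` has no singularity, so its integrals along the two sides agree. -/
theorem rayIntegral_kern_resolvent [CompleteSpace X] (hs1 : s < 1)
    (hR : ∀ z ∈ imagCone s, IsResolventAt D z (R z)) (hC : ∀ z ∈ imagCone s, ‖z • R z‖ ≤ C)
    {t α β : ℝ} (ht : t ≠ 0) (hαβ : α ≤ β) (h : ∀ φ ∈ Icc α β, s < |Real.sin φ|)
    (hpos : ∀ φ ∈ Icc α β, 0 < Real.sin φ * t) (hα : |Real.sin α| < 1) (hβ : |Real.sin β| < 1) :
    rayIntegral (fun z => kern t z • (z • R z)) β - rayIntegral (fun z => kern t z • (z • R z)) α =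
      (rayIntegral (kern t) β - rayIntegral (kern t) α) • imagFamily R t := by
  have ht' : (t : ℂ) ≠ 0 := by simpa using ht
  set l : ℂ := Complex.I / t with hl
  have hlC : l ∈ imagCone s := I_div_mem_imagCone hs1 ht
  have hE : imagFamily R t = l • R l := rfl
  set H : ℂ → X →L[ℂ] X := fun z => ((t : ℂ) * (z + l))⁻¹ • (R z * (1 - l • R l)) with hH
  -- Off the pole, `H` is the regularized kernel.
  have hkern : ∀ z ∈ imagCone s, z ≠ l → z + l ≠ 0 →
      H z = kern t z • (z • R z) - kern t z • (l • R l) := by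
    intro z hz hzl hzl'
    have h1 : z • R z - l • R l = (z - l) • (R z * (1 - l • R l)) := by
      have h2 := (hR z hz).sub_eq (hR l hlC)
      calc z • R z - l • R l = (z - l) • R z + l • (R z - R l) := by module
        _ = _ := by
          rw [h2, mul_sub, mul_one, mul_smul_comm]
          module
    have h3 : (t : ℂ) ^ 2 * l ^ 2 = -1 := by
      rw [hl, div_pow, Complex.I_sq]; field_simp
    have h4 : 1 + (t : ℂ) ^ 2 * z ^ 2 = (t : ℂ) ^ 2 * (z - l) * (z + l) := by
      linear_combination h3
    rw [← smul_sub, h1, smul_smul, hH, kern, h4]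
    have : z - l ≠ 0 := sub_ne_zero.2 hzl
    field_simp
  have him : ∀ r : ℝ, 0 < r → ∀ φ ∈ Icc α β,
      (r : ℂ) * Complex.exp (φ * Complex.I) + l ≠ 0 := by
    intro r hr φ hφ h0
    have h1 := congrArg Complex.im h0
    rw [Complex.add_im, Complex.im_ofReal_mul, Complex.exp_ofReal_mul_I_im, hl,
      Complex.div_ofReal_im, Complex.I_im, Complex.zero_im] at h1
    have h2 := hpos φ hφ
    have h3 : r * (Real.sin φ * t) + 1 = 0 := by
      have := congrArg (· * t) h1
      simp only [add_mul, zero_mul] at this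
      rw [div_mul_cancel₀ _ ht] at this
      linarith
    have : 0 < r * (Real.sin φ * t) := by positivity
    linarith
  have hline : ∀ φ ∈ Icc α β, |Real.sin φ| < 1 → ∀ r : ℝ, 0 < r →
      (r : ℂ) * Complex.exp (φ * Complex.I) ≠ l := by
    intro φ hφ hφ1 r hr h0
    have h1 := congrArg Complex.re h0
    rw [Complex.re_ofReal_mul, Complex.exp_ofReal_mul_I_re, hl, Complex.div_ofReal_re,
      Complex.I_re, zero_div] at h1
    have h2 : Real.cos φ = 0 := (mul_eq_zero.1 h1).resolve_left hr.ne'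
    have h3 := Real.sin_sq_add_cos_sq φ
    rw [h2] at h3
    have h4 : |Real.sin φ| ^ 2 < 1 := by
      have := abs_nonneg (Real.sin φ)
      nlinarith
    rw [sq_abs] at h4
    linarith
  have hint : ∀ φ ∈ Icc α β, |Real.sin φ| < 1 →
      IntegrableOn (fun r : ℝ => H (r * Complex.exp (φ * Complex.I))) (Ioi 0) ∧
      rayIntegral H φ = rayIntegral (fun z => kern t z • (z • R z)) φ -
        rayIntegral (kern t) φ • (l • R l) := by
    intro φ hφ hφ1
    have i1 := integrableOn_kern_resolvent hR hC ht (h φ hφ) hφ1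
    have i2 := (integrableOn_kern ht hφ1).smul_const (l • R l)
    have e : ∀ r ∈ Ioi (0 : ℝ), H (r * Complex.exp (φ * Complex.I)) =
        kern t (r * Complex.exp (φ * Complex.I)) • ((r * Complex.exp (φ * Complex.I)) •
          R (r * Complex.exp (φ * Complex.I))) -
        kern t (r * Complex.exp (φ * Complex.I)) • (l • R l) := fun r hr =>
      hkern _ (mem_imagCone_ray hr (h φ hφ)) (hline φ hφ hφ1 r hr) (him r hr φ hφ)
    refine ⟨(i1.sub i2).congr_fun (fun r hr => (e r hr).symm) measurableSet_Ioi, ?_⟩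
    have e5 : rayIntegral (kern t) φ • (l • R l) = ∫ r in Ioi (0 : ℝ),
        (Complex.exp (φ * Complex.I) • kern t (r * Complex.exp (φ * Complex.I))) • (l • R l) := by
      rw [rayIntegral]
      exact (integral_smul_const
        (fun r : ℝ => Complex.exp (φ * Complex.I) • kern t (r * Complex.exp (φ * Complex.I)))
        (l • R l)).symm
    rw [e5, rayIntegral, rayIntegral]
    refine Eq.trans ?_ (integral_sub (i1.smul (Complex.exp (φ * Complex.I)))
      (((integrableOn_kern ht hφ1).smul (Complex.exp (φ * Complex.I))).smul_const (l • R l)))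
    refine setIntegral_congr_fun measurableSet_Ioi fun r hr => ?_
    simp only [e r hr, smul_sub, smul_assoc]
  have hrot : rayIntegral H α = rayIntegral H β := by
    have hU : ∀ r : ℝ, 0 < r → ∀ φ ∈ Icc α β, (r : ℂ) * Complex.exp (φ * Complex.I) ∈
        imagCone s ∩ {z | z + l ≠ 0} := fun r hr φ hφ =>
      ⟨mem_imagCone_ray hr (h φ hφ), him r hr φ hφ⟩
    refine rayIntegral_rotate hαβ (U := imagCone s ∩ {z | z + l ≠ 0}) ?_ hU ht
      (C := |t| * (C + C)) ?_ (hint α ⟨le_rfl, hαβ⟩ hα).1 (hint β ⟨hαβ, le_rfl⟩ hβ).1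
    · refine DifferentiableOn.fun_smul ?_ ?_
      · refine DifferentiableOn.inv (by fun_prop) fun z hz => mul_ne_zero ht' hz.2
      · exact ((differentiableOn_resolvent hR hC).mono inter_subset_left).mul_const _
    · intro r hr φ hφ
      have hCnn : 0 ≤ C := (norm_nonneg _).trans (hC l hlC)
      set z : ℂ := (r : ℂ) * Complex.exp (φ * Complex.I) with hz
      by_cases hzl : z = l
      · have h1 : t ^ 2 * r ^ 2 = 1 := by
          have h2 : ‖z‖ = r := ray_norm hr
          rw [← h2, hzl, hl]
          simp [ht]
        rw [h1, sub_self, abs_zero, mul_zero]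
        positivity
      · rw [hkern z (hU r hr φ hφ).1 hzl (him r hr φ hφ), ← smul_sub, norm_smul]
        have h1 := norm_kern_mul_le z t
        rw [ray_norm hr] at h1
        have h2 : ‖z • R z - l • R l‖ ≤ C + C :=
          (norm_sub_le _ _).trans (add_le_add (hC z (hU r hr φ hφ).1) (hC l hlC))
        calc _ = ‖kern t z‖ * |1 - t ^ 2 * r ^ 2| * ‖z • R z - l • R l‖ := by ring
          _ ≤ _ := by gcongr
  rw [(hint α ⟨le_rfl, hαβ⟩ hα).2, (hint β ⟨hαβ, le_rfl⟩ hβ).2] at hrot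
  rw [hE, sub_smul]
  rw [sub_eq_sub_iff_add_eq_add] at hrot ⊢
  rw [← hrot, add_comm]

end Operator

section Angles

theorem sin_le_sin_of_mem {θ φ : ℝ} (h0 : 0 ≤ θ) (hφ : φ ∈ Icc θ (Real.pi - θ)) :
    Real.sin θ ≤ Real.sin φ := by
  have hpi := Real.pi_pos
  rcases le_total φ (Real.pi / 2) with h | h
  · exact Real.sin_le_sin_of_le_of_le_pi_div_two (by linarith) h hφ.1
  · rw [← Real.sin_pi_sub φ]
    exact Real.sin_le_sin_of_le_of_le_pi_div_two (by linarith) (by linarith) (by linarith [hφ.2])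

theorem exp_pi_sub (θ : ℝ) : Complex.exp (((Real.pi - θ : ℝ) : ℂ) * Complex.I) =
    -Complex.exp (-(Complex.I * θ)) := by
  have : ((Real.pi - θ : ℝ) : ℂ) * Complex.I = Real.pi * Complex.I - Complex.I * θ := by
    push_cast; ring
  rw [this, sub_eq_add_neg, Complex.exp_add, Complex.exp_pi_mul_I, neg_one_mul]

theorem exp_sub_pi (θ : ℝ) : Complex.exp (((θ - Real.pi : ℝ) : ℂ) * Complex.I) =
    -Complex.exp (Complex.I * θ) := by
  have : ((θ - Real.pi : ℝ) : ℂ) * Complex.I = Complex.I * θ - Real.pi * Complex.I := by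
    push_cast; ring
  rw [this, Complex.exp_sub, Complex.exp_pi_mul_I, div_neg, div_one]

end Angles

section Calculus

variable {X : Type*} [NormedAddCommGroup X] [NormedSpace ℂ X]
  {D : X →ₗ.[ℂ] X} {s C : ℝ}

/-- The contour integral as a combination of four ray integrals. -/
theorem psiCalc_eq_rayIntegral (D : X →ₗ.[ℂ] X) (θ : ℝ) (ψ : ℂ → ℂ)
    (hi : ∀ φ ∈ ({-θ, θ, Real.pi - θ, θ - Real.pi} : Set ℝ), IntegrableOn (fun r : ℝ =>
      ψ (r * Complex.exp (φ * Complex.I)) • resolvent D (r * Complex.exp (φ * Complex.I)))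
      (Ioi 0)) :
    psiCalc D θ ψ = (2 * Real.pi * Complex.I)⁻¹ •
      (rayIntegral (fun z => ψ z • resolvent D z) (-θ) -
        rayIntegral (fun z => ψ z • resolvent D z) θ +
        rayIntegral (fun z => ψ z • resolvent D z) (Real.pi - θ) -
        rayIntegral (fun z => ψ z • resolvent D z) (θ - Real.pi)) := by
  have i1 := (hi (-θ) (by simp)).smul (Complex.exp (((-θ : ℝ) : ℂ) * Complex.I))
  have i2 := (hi θ (by simp)).smul (Complex.exp ((θ : ℂ) * Complex.I))
  have i3 := (hi (Real.pi - θ) (by simp)).smul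
    (Complex.exp (((Real.pi - θ : ℝ) : ℂ) * Complex.I))
  have i4 := (hi (θ - Real.pi) (by simp)).smul
    (Complex.exp (((θ - Real.pi : ℝ) : ℂ) * Complex.I))
  rw [psiCalc]
  simp only [rayIntegral]
  congr 1
  refine Eq.trans ?_ ((integral_sub ((i1.sub i2).add i3) i4).trans (congrArg₂ _
    ((integral_add (i1.sub i2) i3).trans (congrArg₂ _ (integral_sub i1 i2) rfl)) rfl))
  refine setIntegral_congr_fun measurableSet_Ioi fun r _ => ?_
  simp only [Pi.smul_apply, Pi.sub_apply, Pi.add_apply, exp_pi_sub, exp_sub_pi]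
  have e1 : Complex.exp (((-θ : ℝ) : ℂ) * Complex.I) = Complex.exp (-(Complex.I * θ)) := by
    congr 1; push_cast; ring
  rw [e1, mul_comm (θ : ℂ) Complex.I]
  simp only [mul_neg, neg_smul]
  abel

/-- The function `t z / (1 + t² z²)`. -/
def oddSymbol (t : ℝ) (z : ℂ) : ℂ := kern t z * z

theorem oddSymbol_smul {F : Type*} [AddCommGroup F] [Module ℂ F] (t : ℝ) (z : ℂ) (x : F) :
    oddSymbol t z • x = kern t z • (z • x) := by
  rw [oddSymbol, mul_smul]

theorem abs_sin_of_mem {θ φ : ℝ} (h0 : 0 ≤ θ) (h1 : θ ≤ Real.pi / 2)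
    (hφ : φ ∈ ({-θ, θ, Real.pi - θ, θ - Real.pi} : Set ℝ)) : |Real.sin φ| = Real.sin θ := by
  have h2 : 0 ≤ Real.sin θ := Real.sin_nonneg_of_nonneg_of_le_pi h0 (by linarith [Real.pi_pos])
  rcases hφ with rfl | rfl | rfl | rfl
  · rw [Real.sin_neg, abs_neg, abs_of_nonneg h2]
  · exact abs_of_nonneg h2
  · rw [Real.sin_pi_sub, abs_of_nonneg h2]
  · rw [← neg_sub, Real.sin_neg, abs_neg, Real.sin_pi_sub, abs_of_nonneg h2]

theorem integrableOn_oddSymbol (hR : ∀ z ∈ imagCone s, IsResolventAt D z (resolvent D z))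
    (hC : ∀ z ∈ imagCone s, ‖z • resolvent D z‖ ≤ C) {t φ θ : ℝ} (ht : t ≠ 0) (h0 : 0 ≤ θ)
    (hθ : s < Real.sin θ) (hθ' : θ < Real.pi / 2)
    (hφ : φ ∈ ({-θ, θ, Real.pi - θ, θ - Real.pi} : Set ℝ)) :
    IntegrableOn (fun r : ℝ => oddSymbol t (r * Complex.exp (φ * Complex.I)) •
      resolvent D (r * Complex.exp (φ * Complex.I))) (Ioi 0) := by
  simp only [oddSymbol_smul]
  have h1 := abs_sin_of_mem h0 hθ'.le hφ
  refine integrableOn_kern_resolvent hR hC ht (by rwa [h1]) ?_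
  rw [h1, ← Real.sin_pi_div_two]
  exact Real.sin_lt_sin_of_lt_of_le_pi_div_two (by linarith [Real.pi_pos]) le_rfl hθ'

/-- The Cauchy integral of `t z / (1 + t² z²)` is `t D (1 + t² D²)⁻¹`. -/
theorem psiCalc_oddSymbol [CompleteSpace X] (hs1 : s < 1)
    (hR : ∀ z ∈ imagCone s, IsResolventAt D z (resolvent D z))
    (hC : ∀ z ∈ imagCone s, ‖z • resolvent D z‖ ≤ C) {t θ : ℝ} (ht : 0 < t) (h0 : 0 < θ)
    (hθ : s < Real.sin θ) (hθ' : θ < Real.pi / 2) :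
    psiCalc D θ (oddSymbol t) = oddPart (imagFamily (resolvent D)) t := by
  have hpi := Real.pi_pos
  have hsin : Real.sin θ < 1 := by
    rw [← Real.sin_pi_div_two]
    exact Real.sin_lt_sin_of_lt_of_le_pi_div_two (by linarith) le_rfl hθ'
  have hsin0 : 0 < Real.sin θ := Real.sin_pos_of_pos_of_lt_pi h0 (by linarith)
  rw [psiCalc_eq_rayIntegral D θ _
    fun φ hφ => integrableOn_oddSymbol hR hC ht.ne' h0.le hθ hθ' hφ]
  simp only [oddSymbol_smul]
  have hup : ∀ φ ∈ Icc θ (Real.pi - θ), Real.sin θ ≤ Real.sin φ := fun φ hφ =>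
    sin_le_sin_of_mem h0.le hφ
  have hlow : ∀ φ ∈ Icc (θ - Real.pi) (-θ), Real.sin φ ≤ -Real.sin θ := fun φ hφ => by
    have := hup (-φ) ⟨by linarith [hφ.2], by linarith [hφ.1]⟩
    rw [Real.sin_neg] at this
    linarith
  have habs : ∀ φ ∈ ({-θ, θ, Real.pi - θ, θ - Real.pi} : Set ℝ), |Real.sin φ| < 1 :=
    fun φ hφ => by rwa [abs_sin_of_mem h0.le hθ'.le hφ]
  have hU := rayIntegral_kern_resolvent hs1 hR hC ht.ne' (α := θ) (β := Real.pi - θ)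
    (by linarith) (fun φ hφ => hθ.trans_le ((hup φ hφ).trans (le_abs_self _)))
    (fun φ hφ => mul_pos (hsin0.trans_le (hup φ hφ)) ht) (habs _ (by simp)) (habs _ (by simp))
  have hL := rayIntegral_kern_resolvent hs1 hR hC (neg_ne_zero.2 ht.ne') (α := θ - Real.pi)
    (β := -θ) (by linarith)
    (fun φ hφ => hθ.trans_le (by have := hlow φ hφ; rw [le_abs]; right; linarith))
    (fun φ hφ => by have := hlow φ hφ; nlinarith) (habs _ (by simp)) (habs _ (by simp))
  have hneg1 : ∀ φ, rayIntegral (kern (-t)) φ = -rayIntegral (kern t) φ := by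
    intro φ
    simp only [rayIntegral, kern_neg, smul_neg]
    rw [integral_neg]
  have hneg2 : ∀ φ, rayIntegral (fun z => kern (-t) z • (z • resolvent D z)) φ =
      -rayIntegral (fun z => kern t z • (z • resolvent D z)) φ := by
    intro φ
    simp only [rayIntegral, kern_neg, smul_neg, neg_smul]
    rw [integral_neg]
  have hz : rayIntegral (kern t) 0 = Real.pi / 2 := by
    rw [rayIntegral_kern_of_sq ht (by simp)]; simp
  have hp : rayIntegral (kern t) Real.pi = -(Real.pi / 2) := by
    rw [rayIntegral_kern_of_sq ht (by simp), Complex.exp_pi_mul_I, neg_one_mul]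
  have hm : rayIntegral (kern t) (-Real.pi) = -(Real.pi / 2) := by
    have : Complex.exp (((-Real.pi : ℝ) : ℂ) * Complex.I) = -1 := by
      push_cast
      rw [neg_mul, Complex.exp_neg, Complex.exp_pi_mul_I]; norm_num
    rw [rayIntegral_kern_of_sq ht (by rw [this]; norm_num), this, neg_one_mul]
  have r1 : rayIntegral (kern t) θ = Real.pi / 2 := by
    rw [← hz]
    exact (rayIntegral_kern_rotate ht.ne' h0.le hsin fun φ hφ =>
      abs_sin_le_of_abs_le hθ'.le (abs_le.2 ⟨by linarith [hφ.1], hφ.2⟩)).symm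
  have r2 : rayIntegral (kern t) (-θ) = Real.pi / 2 := by
    rw [← hz]
    exact rayIntegral_kern_rotate ht.ne' (by linarith) hsin fun φ hφ =>
      abs_sin_le_of_abs_le hθ'.le (abs_le.2 ⟨hφ.1, by linarith [hφ.2]⟩)
  have r3 : rayIntegral (kern t) (Real.pi - θ) = -(Real.pi / 2) := by
    rw [← hp]
    refine rayIntegral_kern_rotate ht.ne' (by linarith) hsin fun φ hφ => ?_
    rw [← Real.sin_pi_sub]
    exact abs_sin_le_of_abs_le hθ'.le (abs_le.2 ⟨by linarith [hφ.2], by linarith [hφ.1]⟩)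
  have r4 : rayIntegral (kern t) (θ - Real.pi) = -(Real.pi / 2) := by
    rw [← hm]
    refine (rayIntegral_kern_rotate ht.ne' (by linarith) hsin fun φ hφ => ?_).symm
    rw [← abs_neg, ← Real.sin_add_pi]
    exact abs_sin_le_of_abs_le hθ'.le (abs_le.2 ⟨by linarith [hφ.1], by linarith [hφ.2]⟩)
  rw [r1, r3] at hU
  rw [hneg1, hneg1, hneg2, hneg2, r2, r4] at hL
  rw [oddPart]
  set A := rayIntegral (fun z => kern t z • (z • resolvent D z))
  set E := imagFamily (resolvent D)
  have hL' : A (-θ) - A (θ - Real.pi) = (Real.pi : ℂ) • E (-t) := by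
    have : A (-θ) - A (θ - Real.pi) = -(-A (-θ) - -A (θ - Real.pi)) := by abel
    rw [this, hL, ← neg_smul]
    congr 1; ring
  have hU' : A (Real.pi - θ) - A θ = (-Real.pi : ℂ) • E t := by
    rw [hU]; congr 1; ring
  have : A (-θ) - A θ + A (Real.pi - θ) - A (θ - Real.pi) =
      (A (-θ) - A (θ - Real.pi)) + (A (Real.pi - θ) - A θ) := by abel
  rw [this, hL', hU', neg_smul, ← sub_eq_add_neg, ← smul_sub, smul_smul]
  congr 1
  have : (Real.pi : ℂ) ≠ 0 := by exact_mod_cast hpi.ne'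
  field_simp

theorem psiCalc_sum [CompleteSpace X] (hs1 : s < 1)
    (hR : ∀ z ∈ imagCone s, IsResolventAt D z (resolvent D z))
    (hC : ∀ z ∈ imagCone s, ‖z • resolvent D z‖ ≤ C) {θ : ℝ} (h0 : 0 < θ)
    (hθ : s < Real.sin θ) (hθ' : θ < Real.pi / 2) {t : ℝ} (ht : 0 < t) (n : ℕ) (ε : ℕ → ℂ) :
    psiCalc D θ (fun z => ∑ k ∈ Finset.range n, ε k * oddSymbol (t * 2 ^ k) z) =
      ∑ k ∈ Finset.range n, ε k • oddPart (imagFamily (resolvent D)) (t * 2 ^ k) := by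
  have htk : ∀ k : ℕ, 0 < t * 2 ^ k := fun k => by positivity
  have hi : ∀ k, ∀ φ ∈ ({-θ, θ, Real.pi - θ, θ - Real.pi} : Set ℝ), _ := fun k φ hφ =>
    integrableOn_oddSymbol hR hC (htk k).ne' h0.le hθ hθ' hφ
  have hray : ∀ φ ∈ ({-θ, θ, Real.pi - θ, θ - Real.pi} : Set ℝ),
      rayIntegral (fun z => (∑ k ∈ Finset.range n, ε k * oddSymbol (t * 2 ^ k) z) •
        resolvent D z) φ = ∑ k ∈ Finset.range n, ε k •
          rayIntegral (fun z => oddSymbol (t * 2 ^ k) z • resolvent D z) φ := by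
    intro φ hφ
    simp only [rayIntegral]
    refine Eq.trans ?_ ((integral_finsetSum (Finset.range n) fun k _ =>
      ((hi k φ hφ).smul (Complex.exp (φ * Complex.I))).smul (ε k)).trans
      (Finset.sum_congr rfl fun k _ => by
        simp only [Pi.smul_apply]; exact integral_smul _ _))
    refine setIntegral_congr_fun measurableSet_Ioi fun r _ => ?_
    simp only [Finset.sum_smul, Finset.smul_sum, Pi.smul_apply, mul_smul]
    exact Finset.sum_congr rfl fun k _ => smul_comm _ _ _
  rw [psiCalc_eq_rayIntegral]
  · rw [hray _ (by simp), hray _ (by simp), hray _ (by simp), hray _ (by simp),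
      ← Finset.sum_sub_distrib, ← Finset.sum_add_distrib, ← Finset.sum_sub_distrib, Finset.smul_sum]
    refine Finset.sum_congr rfl fun k _ => ?_
    rw [← psiCalc_oddSymbol hs1 hR hC (htk k) h0 hθ hθ', psiCalc_eq_rayIntegral D θ _ (hi k),
      ← smul_sub, ← smul_add, ← smul_sub, smul_comm]
  · intro φ hφ
    refine (integrable_finsetSum (Finset.range n) fun k _ => (hi k φ hφ).smul (ε k)).congr
      (Eventually.of_forall fun r => ?_)
    simp only [Finset.sum_smul, Pi.smul_apply, mul_smul]

/-! ### Uniform bounds for the sign sums -/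

theorem sum_dyadic_le {x : ℝ} (hx : 0 < x) (n : ℕ) :
    ∑ k ∈ Finset.range n, x * 2 ^ k / (1 + (x * 2 ^ k) ^ 2) ≤ 4 := by
  -- Compare with the telescoping series of `y ↦ y / (1 + y)`.
  have h1 : ∀ k : ℕ, x * 2 ^ k / (1 + (x * 2 ^ k) ^ 2) ≤
      4 * (x * 2 ^ (k + 1) / (1 + x * 2 ^ (k + 1)) - x * 2 ^ k / (1 + x * 2 ^ k)) := by
    intro k
    have hy : 0 < x * 2 ^ k := by positivity
    rw [show x * 2 ^ (k + 1) = x * 2 ^ k * 2 by ring]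
    set y := x * 2 ^ k
    have h2 : y * 2 / (1 + y * 2) - y / (1 + y) = y / ((1 + y * 2) * (1 + y)) := by
      field_simp; ring
    rw [h2, mul_div_assoc', div_le_div_iff₀ (by positivity) (by positivity)]
    nlinarith [mul_nonneg hy.le (sq_nonneg (y - 1))]
  calc _ ≤ ∑ k ∈ Finset.range n,
        4 * (x * 2 ^ (k + 1) / (1 + x * 2 ^ (k + 1)) - x * 2 ^ k / (1 + x * 2 ^ k)) :=
        Finset.sum_le_sum fun k _ => h1 k
    _ = 4 * (x * 2 ^ n / (1 + x * 2 ^ n) - x * 2 ^ 0 / (1 + x * 2 ^ 0)) := by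
        rw [← Finset.mul_sum, Finset.sum_range_sub (fun k => x * 2 ^ k / (1 + x * 2 ^ k))]
    _ ≤ 4 := by
        have h2 : x * 2 ^ n / (1 + x * 2 ^ n) ≤ 1 := by
          rw [div_le_one (by positivity)]; linarith
        have h3 : 0 ≤ x * 2 ^ 0 / (1 + x * 2 ^ 0) := by positivity
        linarith

theorem norm_oddSymbol_le {z : ℂ} {σ t : ℝ} (hσ : 0 ≤ σ) (hσ' : σ < 1) (hz : |z.im| ≤ σ * ‖z‖)
    (ht : 0 < t) : ‖oddSymbol t z‖ ≤ (1 - σ)⁻¹ * (t * ‖z‖ / (1 + (t * ‖z‖) ^ 2)) := by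
  rw [oddSymbol, norm_mul]
  calc _ ≤ |t| / (1 - σ) * (1 + t ^ 2 * ‖z‖ ^ 2)⁻¹ * ‖z‖ := by
        gcongr; exact norm_kern_le hσ hσ' hz t
    _ = _ := by rw [abs_of_pos ht, mul_pow]; ring

theorem norm_sum_oddSymbol_le {z : ℂ} {σ t : ℝ} (hσ : 0 ≤ σ) (hσ' : σ < 1)
    (hz : |z.im| ≤ σ * ‖z‖) (hz0 : z ≠ 0) (ht : 0 < t) (n : ℕ) {ε : ℕ → ℂ}
    (hε : ∀ k, ε k = 1 ∨ ε k = -1) :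
    ‖∑ k ∈ Finset.range n, ε k * oddSymbol (t * 2 ^ k) z‖ ≤ (1 - σ)⁻¹ * 4 := by
  have hσ1 : 0 < 1 - σ := by linarith
  have hz1 : 0 < ‖z‖ := norm_pos_iff.2 hz0
  refine (norm_sum_le _ _).trans (le_trans ?_ (mul_le_mul_of_nonneg_left
    (sum_dyadic_le (show 0 < t * ‖z‖ by positivity) n) (inv_nonneg.2 hσ1.le)))
  rw [Finset.mul_sum]
  refine Finset.sum_le_sum fun k _ => ?_
  have h1 : ‖ε k‖ = 1 := by rcases hε k with h | h <;> simp [h]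
  rw [norm_mul, h1, one_mul]
  refine (norm_oddSymbol_le hσ hσ' hz (by positivity)).trans (le_of_eq ?_)
  rw [show t * 2 ^ k * ‖z‖ = t * ‖z‖ * 2 ^ k by ring]

theorem sum_oddSymbol_mem_psiClass {μ t : ℝ} (h0 : 0 ≤ μ) (hμ : μ < Real.pi / 2) (ht : 0 < t)
    (n : ℕ) {ε : ℕ → ℂ} (hε : ∀ k, ε k = 1 ∨ ε k = -1) :
    (fun z => ∑ k ∈ Finset.range n, ε k * oddSymbol (t * 2 ^ k) z) ∈ PsiClass μ := by
  have hσ : 0 ≤ Real.sin μ := Real.sin_nonneg_of_nonneg_of_le_pi h0 (by linarith [Real.pi_pos])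
  have hσ' : Real.sin μ < 1 := by
    rw [← Real.sin_pi_div_two]
    exact Real.sin_lt_sin_of_lt_of_le_pi_div_two (by linarith [Real.pi_pos]) le_rfl hμ
  have hσ1 : 0 < 1 - Real.sin μ := by linarith
  refine ⟨?_, 1, 1, ∑ k ∈ Finset.range n, (1 - Real.sin μ)⁻¹ *
    (t * 2 ^ k * (1 + ((t * 2 ^ k) ^ 2)⁻¹)) + 1, one_pos, one_pos, by positivity, ?_⟩
  · refine DifferentiableOn.fun_sum fun k _ => ?_
    refine DifferentiableOn.const_mul ?_ _
    refine DifferentiableOn.mul ((differentiableOn_kern _).mono fun z hz => ?_) differentiableOn_id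
    exact kern_denom_ne_zero hσ hσ' (abs_im_le_of_mem_openBisector hμ.le hz) _
  · intro z hz
    have hzim := abs_im_le_of_mem_openBisector hμ.le hz
    rw [Real.rpow_one, show (1 : ℝ) + 1 = 2 by norm_num, Real.rpow_two, mul_assoc, add_mul]
    refine le_add_of_le_of_nonneg ?_ (by positivity)
    rw [Finset.sum_mul]
    refine (norm_sum_le _ _).trans (Finset.sum_le_sum fun k _ => ?_)
    have h1 : ‖ε k‖ = 1 := by rcases hε k with h | h <;> simp [h]
    rw [norm_mul, h1, one_mul]
    have hτ : 0 < t * 2 ^ k := by positivity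
    refine (norm_oddSymbol_le hσ hσ' hzim hτ).trans ?_
    generalize t * 2 ^ k = τ at hτ
    rw [mul_assoc (1 - Real.sin μ)⁻¹]
    refine mul_le_mul_of_nonneg_left ?_ (inv_nonneg.2 hσ1.le)
    have h2 : τ * (1 + (τ ^ 2)⁻¹) * (‖z‖ * (1 + ‖z‖ ^ 2)⁻¹) =
        τ * ‖z‖ * ((1 + (τ ^ 2)⁻¹) / (1 + ‖z‖ ^ 2)) := by ring
    rw [h2, div_eq_mul_inv]
    gcongr
    rw [← one_div, div_le_div_iff₀ (by positivity) (by positivity)]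
    have h3 : (1 + (τ ^ 2)⁻¹) * (1 + (τ * ‖z‖) ^ 2) =
        1 + ‖z‖ ^ 2 + (τ ^ 2)⁻¹ + τ ^ 2 * ‖z‖ ^ 2 := by field_simp; ring
    rw [h3, one_mul]
    have : 0 ≤ (τ ^ 2)⁻¹ + τ ^ 2 * ‖z‖ ^ 2 := by positivity
    linarith

/-- What the functional calculus provides: resolvents on the imaginary axis, and bounds on the sign
sums. -/
theorem exists_family_of_calculus [CompleteSpace X] {ω μ : ℝ} (hω : 0 ≤ ω)
    (hμ : μ < Real.pi / 2) (hbis : IsBisectorial D ω) (hcalc : HasBoundedHInftyCalculus D ω μ) :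
    ∃ E M C, IsResolventFamily D E M ∧ HasSignBound E C := by
  have hpi := Real.pi_pos
  obtain ⟨θ, hωθ, hθμ, C₀, hC₀, hbd⟩ := hcalc
  have hμ0 : 0 ≤ μ := by linarith
  obtain ⟨C, -, hC⟩ := hbis.bound ((ω + θ) / 2) (by linarith) (by linarith)
  have hs1 : Real.sin ((ω + θ) / 2) < 1 := by
    rw [← Real.sin_pi_div_two]
    exact Real.sin_lt_sin_of_lt_of_le_pi_div_two (by linarith) le_rfl (by linarith)
  have hsθ : Real.sin ((ω + θ) / 2) < Real.sin θ :=
    Real.sin_lt_sin_of_lt_of_le_pi_div_two (by linarith) (by linarith) (by linarith)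
  have hsω : Real.sin ω ≤ Real.sin ((ω + θ) / 2) :=
    Real.sin_le_sin_of_le_of_le_pi_div_two (by linarith) (by linarith) (by linarith)
  have hR : ∀ z ∈ imagCone (Real.sin ((ω + θ) / 2)), IsResolventAt D z (resolvent D z) := by
    intro z hz
    refine isResolventAt_resolvent ?_
    by_contra hcon
    have h1 := abs_im_le_of_mem_closedBisector (by linarith) (hbis.spectrum hcon)
    have h2 : Real.sin ω * ‖z‖ ≤ Real.sin ((ω + θ) / 2) * ‖z‖ := by gcongr
    have h3 : Real.sin ((ω + θ) / 2) * ‖z‖ < |z.im| := hz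
    linarith
  have hCz : ∀ z ∈ imagCone (Real.sin ((ω + θ) / 2)), ‖z • resolvent D z‖ ≤ C := by
    intro z hz
    refine hC z fun hcon => ?_
    have h1 := abs_im_le_of_mem_closedBisector (by linarith) hcon
    have h3 : Real.sin ((ω + θ) / 2) * ‖z‖ < |z.im| := hz
    linarith
  refine ⟨imagFamily (resolvent D), C, C₀ * ((1 - Real.sin μ)⁻¹ * 4),
    isResolventFamily_imagFamily hs1 hR hCz, fun t ht n ε hε => ?_⟩
  rw [← psiCalc_sum hs1 hR hCz (by linarith) hsθ (by linarith) ht n ε]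
  refine hbd _ (sum_oddSymbol_mem_psiClass hμ0 hμ ht n hε) _ fun z hz => ?_
  have hσ : 0 ≤ Real.sin μ := Real.sin_nonneg_of_nonneg_of_le_pi hμ0 (by linarith)
  have hσ' : Real.sin μ < 1 := by
    rw [← Real.sin_pi_div_two]
    exact Real.sin_lt_sin_of_lt_of_le_pi_div_two (by linarith) le_rfl hμ
  exact norm_sum_oddSymbol_le hσ hσ' (abs_im_le_of_mem_openBisector hμ.le hz) hz.1 ht n hε

end Calculus

/-! ### Exterior multiplication and the degree of forms -/

section Algebra

theorem basis_exteriorAlgebra_singleton {R M I : Type*} [LinearOrder I] [CommRing R]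
    [AddCommGroup M] [Module R M] (b : Module.Basis I R M) (j : I) :
    b.ExteriorAlgebra {j} = ExteriorAlgebra.ι R (b j) := by
  rw [ExteriorAlgebra.basis_apply_ofCard b (Finset.card_singleton j)]
  have h := (powersetCard.mem_range_ofFinEmbEquiv_symm_iff_mem
    (powersetCard.ofCard (Finset.card_singleton j)) j).2 (by
      change j ∈ ({j} : Finset I); simp)
  obtain ⟨i, hi⟩ := h
  obtain rfl : i = 0 := Subsingleton.elim _ _
  simp [ExteriorAlgebra.ιMulti_family, hi]

/-- Exterior multiplication by a basis vector raises the degree by one. -/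
theorem repr_ι_mul_eq_zero {R M I : Type*} [LinearOrder I] [CommRing R]
    [AddCommGroup M] [Module R M] (b : Module.Basis I R M) (j : I) {S T : Finset I}
    (h : S.card ≠ T.card + 1) :
    b.ExteriorAlgebra.repr (ExteriorAlgebra.ι R (b j) * b.ExteriorAlgebra T) S = 0 := by
  rw [← basis_exteriorAlgebra_singleton]
  let s : powersetCard I 1 := powersetCard.ofCard (Finset.card_singleton j)
  let t : powersetCard I T.card := powersetCard.ofCard rfl
  change b.ExteriorAlgebra.repr (b.ExteriorAlgebra s.val * b.ExteriorAlgebra t.val) S = 0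
  by_cases hd : Disjoint s.val t.val
  · rw [ExteriorAlgebra.basis_mul_of_disjoint b s t hd, Units.smul_def, map_zsmul,
      Module.Basis.repr_self, Finsupp.smul_apply, Finsupp.single_apply, if_neg, smul_zero]
    intro hS
    have h1 := (powersetCard.disjUnion hd).2
    rw [powersetCard.mem_iff] at h1
    rw [hS] at h1
    omega
  · rw [ExteriorAlgebra.basis_mul_of_not_disjoint b s t hd, map_zero, Finsupp.zero_apply]

variable {n : ℕ}

theorem wedge_apply (j : Fin n) (w : Forms n) (S : Finset (Fin n)) :
    wedge n j w S = ∑ T, (Pi.basisFun ℂ (Fin n)).ExteriorAlgebra.repr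
      (ExteriorAlgebra.ι ℂ (Pi.basisFun ℂ (Fin n) j) *
        (Pi.basisFun ℂ (Fin n)).ExteriorAlgebra T) S * w T := by
  simp only [wedge, Matrix.ofLp_toEuclideanCLM, Matrix.mulVec, dotProduct,
    LinearMap.toMatrix_apply, LinearMap.mulLeft_apply, Pi.basisFun_apply]

theorem wedge_anticomm (i j : Fin n) :
    wedge n i ∘L wedge n j = -(wedge n j ∘L wedge n i) := by
  have hM : ∀ u v : ExteriorAlgebra ℂ (Fin n → ℂ), u * v = -(v * u) →
      LinearMap.toMatrix (Pi.basisFun ℂ (Fin n)).ExteriorAlgebra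
          (Pi.basisFun ℂ (Fin n)).ExteriorAlgebra (LinearMap.mulLeft ℂ u) *
        LinearMap.toMatrix (Pi.basisFun ℂ (Fin n)).ExteriorAlgebra
          (Pi.basisFun ℂ (Fin n)).ExteriorAlgebra (LinearMap.mulLeft ℂ v) =
      -(LinearMap.toMatrix (Pi.basisFun ℂ (Fin n)).ExteriorAlgebra
          (Pi.basisFun ℂ (Fin n)).ExteriorAlgebra (LinearMap.mulLeft ℂ v) *
        LinearMap.toMatrix (Pi.basisFun ℂ (Fin n)).ExteriorAlgebra
          (Pi.basisFun ℂ (Fin n)).ExteriorAlgebra (LinearMap.mulLeft ℂ u)) := by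
    intro u v h
    rw [← LinearMap.toMatrix_comp, ← LinearMap.toMatrix_comp, ← map_neg]
    congr 1
    refine LinearMap.ext fun x => ?_
    simp only [LinearMap.comp_apply, LinearMap.mulLeft_apply, LinearMap.neg_apply, ← mul_assoc]
    rw [h, neg_mul]
  have h := congrArg (Matrix.toEuclideanCLM (𝕜 := ℂ) (n := Finset (Fin n)))
    (hM _ _ (eq_neg_of_add_eq_zero_left (ExteriorAlgebra.ι_add_mul_swap (R := ℂ)
      (Pi.single i 1 : Fin n → ℂ) (Pi.single j 1))))
  rwa [map_neg, map_mul, map_mul] at h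

/-- Multiplication of the forms of degree `k` by `cᵏ`. -/
def degreeOp (n : ℕ) (c : ℂ) : Forms n →L[ℂ] Forms n :=
  Matrix.toEuclideanCLM (𝕜 := ℂ) (n := Finset (Fin n)) (Matrix.diagonal fun S => c ^ S.card)

theorem degreeOp_apply (c : ℂ) (w : Forms n) (S : Finset (Fin n)) :
    degreeOp n c w S = c ^ S.card * w S := by
  simp [degreeOp, Matrix.ofLp_toEuclideanCLM, Matrix.mulVec_diagonal]

theorem degreeOp_wedge (c : ℂ) (j : Fin n) :
    degreeOp n c ∘L wedge n j = c • (wedge n j ∘L degreeOp n c) := by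
  ext w S
  simp only [ContinuousLinearMap.comp_apply, _root_.smul_apply, PiLp.smul_apply,
    degreeOp_apply, wedge_apply, smul_eq_mul, Finset.mul_sum]
  refine Finset.sum_congr rfl fun T _ => ?_
  by_cases h : S.card = T.card + 1
  · rw [h, pow_succ]; ring
  · rw [repr_ι_mul_eq_zero _ _ h]; ring

theorem adjoint_degreeOp (c : ℂ) :
    ContinuousLinearMap.adjoint (degreeOp n c) = degreeOp n (starRingEnd ℂ c) := by
  rw [← ContinuousLinearMap.star_eq_adjoint, degreeOp, ← map_star, Matrix.star_eq_conjTranspose,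
    Matrix.diagonal_conjTranspose, degreeOp]
  congr 2
  ext S
  simp

theorem wedge_degreeOp_I (j : Fin n) (w : Forms n) :
    wedge n j (degreeOp n Complex.I w) = -Complex.I • degreeOp n Complex.I (wedge n j w) := by
  have h := congrArg (fun L => L w) (degreeOp_wedge Complex.I j)
  simp only [ContinuousLinearMap.comp_apply, _root_.smul_apply] at h
  rw [h, smul_smul, neg_mul, Complex.I_mul_I, neg_neg, one_smul]

theorem adjoint_wedge_degreeOp_I (j : Fin n) (w : Forms n) :
    ContinuousLinearMap.adjoint (wedge n j) (degreeOp n Complex.I w) =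
      Complex.I • degreeOp n Complex.I (ContinuousLinearMap.adjoint (wedge n j) w) := by
  have h := congrArg (fun L => ContinuousLinearMap.adjoint L w) (degreeOp_wedge (-Complex.I) j)
  simpa [ContinuousLinearMap.adjoint_comp, adjoint_degreeOp, map_smulₛₗ] using h

theorem norm_degreeOp_I (w : Forms n) : ‖degreeOp n Complex.I w‖ = ‖w‖ := by
  simp [EuclideanSpace.norm_eq, degreeOp_apply]

theorem degreeOp_of_mem {c : ℂ} {k : ℕ} {w : Forms n} (hw : w ∈ degreeForms n k) :
    degreeOp n c w = c ^ k • w := by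
  ext S
  rw [degreeOp_apply, PiLp.smul_apply, smul_eq_mul]
  by_cases h : S.card = k
  · rw [h]
  · rw [hw S h, mul_zero, mul_zero]

/-- A degree preserving operator commutes with `degreeOp`. -/
theorem comm_degreeOp {B : Forms n →L[ℂ] Forms n}
    (hB : ∀ k : ℕ, ∀ w ∈ degreeForms n k, B w ∈ degreeForms n k) (c : ℂ) :
    B ∘L degreeOp n c = degreeOp n c ∘L B := by
  have : (B ∘L degreeOp n c).toLinearMap = (degreeOp n c ∘L B).toLinearMap := by
    refine (EuclideanSpace.basisFun (Finset (Fin n)) ℂ).toBasis.ext fun S => ?_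
    have hS : EuclideanSpace.single S (1 : ℂ) ∈ degreeForms n S.card := by
      intro T hT
      have : T ≠ S := fun h => hT (by rw [h])
      simp [this]
    simp only [OrthonormalBasis.coe_toBasis, EuclideanSpace.basisFun_apply,
      ContinuousLinearMap.coe_coe, ContinuousLinearMap.comp_apply]
    rw [degreeOp_of_mem hS, degreeOp_of_mem (hB _ _ hS), map_smul]
  exact ContinuousLinearMap.coe_injective this

end Algebra

/-! ### First order operators and constant matrices -/

section FirstOrder

variable {n : ℕ} {E : Type*} [NormedAddCommGroup E] [NormedSpace ℂ E]

theorem isWeakSol_zero_right_iff {A : Fin n → E →L[ℂ] E} {p : ℝ≥0∞}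
    {u : Lp E p (volume : Measure (EuclideanSpace ℝ (Fin n)))} :
    IsWeakSol A u (0 : Lp E p (volume : Measure (EuclideanSpace ℝ (Fin n)))) ↔
      ∀ φ : EuclideanSpace ℝ (Fin n) → ℝ, ContDiff ℝ ((⊤ : ℕ∞) : WithTop ℕ∞) φ →
        HasCompactSupport φ →
        ∫ x, ∑ j, fderiv ℝ φ x (EuclideanSpace.single j 1) • A j (u x) = 0 := by
  have e0 : ∀ φ : EuclideanSpace ℝ (Fin n) → ℝ,
      ∫ x, φ x • (0 : Lp E p (volume : Measure (EuclideanSpace ℝ (Fin n)))) x = 0 := by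
    intro φ
    refine integral_eq_zero_of_ae ?_
    filter_upwards [Lp.coeFn_zero E p (volume : Measure (EuclideanSpace ℝ (Fin n)))] with x hx
    rw [hx, Pi.zero_apply, smul_zero]
  refine forall_congr' fun φ => forall_congr' fun _ => forall_congr' fun _ => ?_
  rw [e0, eq_comm, neg_eq_zero]

variable [CompleteSpace E] {p : ℝ≥0∞} [Fact (1 ≤ p)]

/-- A constant matrix `L` with `Aⱼ L = c L Aⱼ` intertwines `∑ⱼ Aⱼ ∂ⱼ` with a multiple of itself. -/
theorem firstOrderOp_compLp {A : Fin n → E →L[ℂ] E} {L : E →L[ℂ] E} {c : ℂ}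
    (h : ∀ j x, A j (L x) = c • L (A j x))
    {u f : Lp E p (volume : Measure (EuclideanSpace ℝ (Fin n)))}
    (hu : (u, f) ∈ (firstOrderOp A p).graph) :
    (L.compLpL p volume u, c • L.compLpL p volume f) ∈ (firstOrderOp A p).graph := by
  rw [mem_graph_firstOrderOp] at hu ⊢
  intro φ hφ hc
  have e1 : ∫ x, φ x • (c • L.compLpL p volume f) x = (c • L) (∫ x, φ x • f x) := by
    rw [← ContinuousLinearMap.integral_comp_comm _ (integrable_smul_test hφ.continuous hc f)]
    refine integral_congr_ae ?_
    filter_upwards [L.coeFn_compLpL f, Lp.coeFn_smul c (L.compLpL p volume f)] with x h1 h2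
    rw [h2, Pi.smul_apply, h1, ContinuousLinearMap.map_smul_of_tower,
      _root_.smul_apply]
  have e2 : ∫ x, ∑ j, fderiv ℝ φ x (EuclideanSpace.single j 1) • A j (L.compLpL p volume u x) =
      (c • L) (∫ x, ∑ j, fderiv ℝ φ x (EuclideanSpace.single j 1) • A j (u x)) := by
    rw [← ContinuousLinearMap.integral_comp_comm _ (integrable_sum_test A hφ hc u)]
    refine integral_congr_ae ?_
    filter_upwards [L.coeFn_compLpL u] with x h1
    rw [map_sum]
    refine Finset.sum_congr rfl fun j _ => ?_
    rw [h1, h, ContinuousLinearMap.map_smul_of_tower, _root_.smul_apply]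
  rw [e1, e2, hu φ hφ hc, map_neg]

theorem contDiff_partial {φ : EuclideanSpace ℝ (Fin n) → ℝ}
    (hφ : ContDiff ℝ ((⊤ : ℕ∞) : WithTop ℕ∞) φ) (v : EuclideanSpace ℝ (Fin n)) :
    ContDiff ℝ ((⊤ : ℕ∞) : WithTop ℕ∞) fun x => fderiv ℝ φ x v :=
  (hφ.fderiv_right (m := ((⊤ : ℕ∞) : WithTop ℕ∞)) (by simp)).clm_apply contDiff_const

theorem fderiv_partial_symm {φ : EuclideanSpace ℝ (Fin n) → ℝ}
    (hφ : ContDiff ℝ ((⊤ : ℕ∞) : WithTop ℕ∞) φ) (x v w : EuclideanSpace ℝ (Fin n)) :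
    fderiv ℝ (fun y => fderiv ℝ φ y v) x w = fderiv ℝ (fun y => fderiv ℝ φ y w) x v := by
  have h1 : DifferentiableAt ℝ (fderiv ℝ φ) x :=
    (hφ.fderiv_right (m := ((⊤ : ℕ∞) : WithTop ℕ∞)) (by simp)).differentiable (by simp) x
  have h2 : IsSymmSndFDerivAt ℝ φ x := hφ.contDiffAt.isSymmSndFDerivAt (by
    rw [minSmoothness_of_isRCLikeNormedField]
    exact WithTop.coe_le_coe.2 (le_top : (2 : ℕ∞) ≤ ⊤))
  rw [fderiv_clm_apply h1 (differentiableAt_const _),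
    fderiv_clm_apply h1 (differentiableAt_const _)]
  simpa using h2 w v

/-- If the coefficients anticommute, `(∑ⱼ Aⱼ ∂ⱼ)² = 0`, by the symmetry of second derivatives. -/
theorem firstOrderOp_nilpotent {A : Fin n → E →L[ℂ] E} (h : ∀ i j, A i ∘L A j = -(A j ∘L A i))
    {u f : Lp E p (volume : Measure (EuclideanSpace ℝ (Fin n)))}
    (hu : (u, f) ∈ (firstOrderOp A p).graph) : (f, 0) ∈ (firstOrderOp A p).graph := by
  rw [mem_graph_firstOrderOp] at hu ⊢
  rw [isWeakSol_zero_right_iff]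
  intro φ hφ hc
  let ψ : Fin n → EuclideanSpace ℝ (Fin n) → ℝ := fun i x =>
    fderiv ℝ φ x (EuclideanSpace.single i 1)
  have hψ : ∀ i, ContDiff ℝ ((⊤ : ℕ∞) : WithTop ℕ∞) (ψ i) := fun i => contDiff_partial hφ _
  have hψc : ∀ i, HasCompactSupport (ψ i) := fun i => hc.fderiv_apply ℝ _
  have e1 : ∀ i, ∫ x, ψ i x • A i (f x) = -∫ x, A i (∑ j,
      fderiv ℝ (ψ i) x (EuclideanSpace.single j 1) • A j (u x)) := by
    intro i
    rw [ContinuousLinearMap.integral_comp_comm _ (integrable_sum_test A (hψ i) (hψc i) u),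
      ← map_neg, ← hu (ψ i) (hψ i) (hψc i), ← ContinuousLinearMap.integral_comp_comm _
        (integrable_smul_test (hψ i).continuous (hψc i) f)]
    simp only [ContinuousLinearMap.map_smul_of_tower]
  have e2 : ∀ x, ∑ i, A i (∑ j, fderiv ℝ (ψ i) x (EuclideanSpace.single j 1) • A j (u x)) = 0 := by
    intro x
    simp only [map_sum, ContinuousLinearMap.map_smul_of_tower]
    have h1 : ∑ i, ∑ j, fderiv ℝ (ψ i) x (EuclideanSpace.single j 1) • A i (A j (u x)) =
        -∑ i, ∑ j, fderiv ℝ (ψ i) x (EuclideanSpace.single j 1) • A i (A j (u x)) := by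
      conv_lhs => rw [Finset.sum_comm]
      simp only [← Finset.sum_neg_distrib]
      refine Finset.sum_congr rfl fun i _ => Finset.sum_congr rfl fun j _ => ?_
      have h2 : A j (A i (u x)) = -A i (A j (u x)) := congrArg (fun L => L (u x)) (h j i)
      rw [h2, smul_neg]
      congr 2
      exact fderiv_partial_symm hφ x _ _
    have h3 : (2 : ℂ) • ∑ i, ∑ j,
        fderiv ℝ (ψ i) x (EuclideanSpace.single j 1) • A i (A j (u x)) = 0 := by
      rw [two_smul]; nth_rw 2 [h1]; exact add_neg_cancel _
    exact (smul_eq_zero.1 h3).resolve_left two_ne_zero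
  have i1 : ∀ i, Integrable fun x => ψ i x • A i (f x) := fun i => by
    simpa only [ContinuousLinearMap.map_smul_of_tower] using
      (A i).integrable_comp (integrable_smul_test (hψ i).continuous (hψc i) f)
  rw [integral_finsetSum _ fun i _ => i1 i]
  simp only [e1]
  rw [Finset.sum_neg_distrib, ← integral_finsetSum _ fun i _ =>
    (A i).integrable_comp (integrable_sum_test A (hψ i) (hψc i) u)]
  simp only [e2, integral_zero, neg_zero]

end FirstOrder

/-! ### Annihilators of the range of a first order operator -/

section Annihilator

open scoped Convolution Pointwise
open ContinuousLinearMap (lsmul)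

variable {n : ℕ} {E : Type*} [NormedAddCommGroup E] [NormedSpace ℂ E]

variable {A : Fin n → E →L[ℂ] E} {K : EuclideanSpace ℝ (Fin n) → E →L[ℂ] E} {C : ℝ}

/-- The mollification `η ⋆ K` of a matrix annihilating `∑ⱼ Aⱼ ∂ⱼ v` for all test functions `v` is a
classical solution of the adjoint equation. -/
theorem sum_fderiv_convolution_eq_zero (hKl : LocallyIntegrable K)
    (hK : ∀ η : EuclideanSpace ℝ (Fin n) → ℝ, ContDiff ℝ ((⊤ : ℕ∞) : WithTop ℕ∞) η →
      HasCompactSupport η → ∀ w : E,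
      ∫ x, K x (∑ j, fderiv ℝ η x (EuclideanSpace.single j 1) • A j w) = 0)
    {η : EuclideanSpace ℝ (Fin n) → ℝ} (hη : ContDiff ℝ ((⊤ : ℕ∞) : WithTop ℕ∞) η)
    (hηc : HasCompactSupport η) (y : EuclideanSpace ℝ (Fin n)) (w : E) :
    ∑ j, fderiv ℝ (η ⋆[lsmul ℝ ℝ, volume] K) y (EuclideanSpace.single j 1) (A j w) = 0 := by
  have hη1 : ContDiff ℝ 1 η := hη.of_le (by exact_mod_cast le_top)
  have hd : ∀ v, fderiv ℝ (η ⋆[lsmul ℝ ℝ, volume] K) y v =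
      ∫ t, fderiv ℝ η (y - t) v • K t := by
    intro v
    rw [← convolution_flip, (hηc.hasFDerivAt_convolution_right _ hKl hη1 y).fderiv,
      convolution_precompR_apply _ hKl (hηc.fderiv ℝ) (hη1.continuous_fderiv (by simp))]
    rfl
  have hint : ∀ v, Integrable fun t => fderiv ℝ η (y - t) v • K t := by
    intro v
    refine hKl.integrable_smul_left_of_hasCompactSupport
      ((contDiff_partial hη v).continuous.comp (by fun_prop)) ?_
    exact (hηc.fderiv_apply ℝ v).comp_homeomorph (Homeomorph.subLeft y)
  have happ : ∀ v x, fderiv ℝ (η ⋆[lsmul ℝ ℝ, volume] K) y v x =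
      ∫ t, fderiv ℝ η (y - t) v • K t x := by
    intro v x
    rw [hd, ContinuousLinearMap.integral_apply (hint v)]
    rfl
  have hη' : ContDiff ℝ ((⊤ : ℕ∞) : WithTop ℕ∞) fun t => η (y - t) :=
    hη.comp (contDiff_const.sub contDiff_id)
  have h := hK _ hη' (hηc.comp_homeomorph (Homeomorph.subLeft y)) w
  have hd' : ∀ t v, fderiv ℝ (fun t => η (y - t)) t v = -fderiv ℝ η (y - t) v := by
    intro t v
    have h1 : HasFDerivAt (fun t => y - t) (-ContinuousLinearMap.id ℝ _) t :=
      (hasFDerivAt_id t).const_sub y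
    have h2 := ((hη.differentiable (by simp) (y - t)).hasFDerivAt.comp t h1).fderiv
    refine (congrArg (fun L => L v) h2).trans ?_
    simp
  simp only [happ]
  rw [← integral_finsetSum _ fun j _ => ?_]
  · rw [← neg_eq_zero, ← integral_neg, ← h]
    refine integral_congr_ae (Eventually.of_forall fun t => ?_)
    simp only [hd', neg_smul, Finset.sum_neg_distrib]
    simp only [map_neg, map_sum, ContinuousLinearMap.map_smul_of_tower]
  · exact (ContinuousLinearMap.apply ℂ E (A j w)).integrable_comp (hint (EuclideanSpace.single j 1))

variable [CompleteSpace E]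

/-- A classical solution `η w`, with `η` a test function, is a weak solution. -/
theorem isWeakSol_smul (A : Fin n → E →L[ℂ] E) {η : EuclideanSpace ℝ (Fin n) → ℝ}
    (hη : ContDiff ℝ ((⊤ : ℕ∞) : WithTop ℕ∞) η) (hηc : HasCompactSupport η) (w : E) :
    IsWeakSol A (fun x => η x • w)
      fun x => ∑ j, fderiv ℝ η x (EuclideanSpace.single j 1) • A j w := by
  intro φ hφ hc
  have hdφ : ∀ v, Continuous fun x => fderiv ℝ φ x v := fun v => (contDiff_partial hφ v).continuous
  have hdη : ∀ v, Continuous fun x => fderiv ℝ η x v := fun v => (contDiff_partial hη v).continuous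
  have hdηc : ∀ v, HasCompactSupport fun x => fderiv ℝ η x v := fun v => hηc.fderiv_apply ℝ _
  have i1 : ∀ v, Integrable fun x => φ x * fderiv ℝ η x v := fun v =>
    (hφ.continuous.mul (hdη v)).integrable_of_hasCompactSupport (hdηc v).mul_left
  have i2 : ∀ v, Integrable fun x => fderiv ℝ φ x v * η x := fun v =>
    ((hdφ v).mul hη.continuous).integrable_of_hasCompactSupport hηc.mul_left
  have i3 : Integrable fun x => φ x * η x :=
    (hφ.continuous.mul hη.continuous).integrable_of_hasCompactSupport hηc.mul_left
  have h := fun v => integral_mul_fderiv_eq_neg_fderiv_mul_of_integrable (v := v) (i2 v) (i1 v) i3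
    (fun x _ => hφ.differentiable (by simp) x) (fun x _ => hη.differentiable (by simp) x)
  simp only [Finset.smul_sum, smul_smul, ContinuousLinearMap.map_smul_of_tower]
  rw [integral_finsetSum _ fun j _ => (i1 _).smul_const _,
    integral_finsetSum _ fun j _ => (i2 _).smul_const _, ← Finset.sum_neg_distrib]
  refine Finset.sum_congr rfl fun j _ => ?_
  rw [integral_smul_const, integral_smul_const, h, neg_smul]

variable [FiniteDimensional ℂ E]

/-- Weak solutions may be tested with smooth matrix valued functions. -/
theorem IsWeakSol.integral_matrix {A : Fin n → E →L[ℂ] E} {p : ℝ≥0∞} [Fact (1 ≤ p)]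
    {u f : Lp E p (volume : Measure (EuclideanSpace ℝ (Fin n)))} (h : IsWeakSol A u f)
    {Φ : EuclideanSpace ℝ (Fin n) → E →L[ℂ] E} (hΦ : ContDiff ℝ ((⊤ : ℕ∞) : WithTop ℕ∞) Φ)
    (hc : HasCompactSupport Φ) :
    ∫ x, Φ x (f x) = -∫ x, ∑ j, fderiv ℝ Φ x (EuclideanSpace.single j 1) (A j (u x)) := by
  have : FiniteDimensional ℝ (E →L[ℂ] E) := FiniteDimensional.complexToReal _
  let b := Module.finBasis ℝ (E →L[ℂ] E)
  let ℓ : Fin _ → (E →L[ℂ] E) →L[ℝ] ℝ := fun i => LinearMap.toContinuousLinearMap (b.coord i)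
  have hb : ∀ T x, T x = ∑ i, ℓ i T • b i x := by
    intro T x
    conv_lhs => rw [← b.sum_repr T]
    rw [_root_.sum_apply]
    rfl
  let φ : Fin _ → EuclideanSpace ℝ (Fin n) → ℝ := fun i x => ℓ i (Φ x)
  have hφ : ∀ i, ContDiff ℝ ((⊤ : ℕ∞) : WithTop ℕ∞) (φ i) := fun i => (ℓ i).contDiff.comp hΦ
  have hφc : ∀ i, HasCompactSupport (φ i) := fun i => hc.comp_left (map_zero (ℓ i))
  have hd : ∀ i x v, fderiv ℝ (φ i) x v = ℓ i (fderiv ℝ Φ x v) := by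
    intro i x v
    have := ((ℓ i).hasFDerivAt.comp x (hΦ.differentiable (by simp) x).hasFDerivAt).fderiv
    exact congrArg (fun L => L v) this
  have e1 : ∀ x, Φ x (f x) = ∑ i, b i (φ i x • f x) := by
    intro x
    rw [hb]
    simp only [ContinuousLinearMap.map_smul_of_tower, φ]
  have e2 : ∀ x, ∑ j, fderiv ℝ Φ x (EuclideanSpace.single j 1) (A j (u x)) =
      ∑ i, b i (∑ j, fderiv ℝ (φ i) x (EuclideanSpace.single j 1) • A j (u x)) := by
    intro x
    simp only [map_sum, ContinuousLinearMap.map_smul_of_tower, hd]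
    rw [Finset.sum_comm]
    exact Finset.sum_congr rfl fun j _ => hb _ _
  have i1 := fun i => integrable_smul_test (hφ i).continuous (hφc i) f
  have i2 := fun i => integrable_sum_test A (hφ i) (hφc i) u
  simp only [e1, e2]
  rw [integral_finsetSum _ fun i _ => (b i).integrable_comp (i1 i),
    integral_finsetSum _ fun i _ => (b i).integrable_comp (i2 i), ← Finset.sum_neg_distrib]
  refine Finset.sum_congr rfl fun i _ => ?_
  rw [ContinuousLinearMap.integral_comp_comm _ (i1 i),
    ContinuousLinearMap.integral_comp_comm _ (i2 i), h _ (hφ i) (hφc i), map_neg]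

/-- A bounded, compactly supported matrix `K` that annihilates `∑ⱼ Aⱼ ∂ⱼ v` for all test functions
`v` annihilates the range of `∑ⱼ Aⱼ ∂ⱼ` in every `L^p`. The mollifications of `K` are admissible in
the weak formulation. -/
theorem integral_eq_zero_of_annihilates (hKm : AEStronglyMeasurable K) (hKb : ∀ᵐ x, ‖K x‖ ≤ C)
    (hKc : HasCompactSupport K)
    (hK : ∀ η : EuclideanSpace ℝ (Fin n) → ℝ, ContDiff ℝ ((⊤ : ℕ∞) : WithTop ℕ∞) η →
      HasCompactSupport η → ∀ w : E,
      ∫ x, K x (∑ j, fderiv ℝ η x (EuclideanSpace.single j 1) • A j w) = 0)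
    {p : ℝ≥0∞} [Fact (1 ≤ p)] {u f : Lp E p (volume : Measure (EuclideanSpace ℝ (Fin n)))}
    (h : IsWeakSol A u f) : ∫ x, K x (f x) = 0 := by
  have hKl : LocallyIntegrable K := (memLp_top_of_bound hKm C hKb).locallyIntegrable le_top
  let β : ℕ → ContDiffBump (0 : EuclideanSpace ℝ (Fin n)) := fun i =>
    ⟨(2 * (i + 1 : ℝ))⁻¹, (i + 1 : ℝ)⁻¹, by positivity, by
      rw [mul_inv]; have : (0 : ℝ) < (i + 1 : ℝ)⁻¹ := by positivity
      linarith⟩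
  let η : ℕ → EuclideanSpace ℝ (Fin n) → ℝ := fun i => (β i).normed volume
  have hη : ∀ i, ContDiff ℝ ((⊤ : ℕ∞) : WithTop ℕ∞) (η i) := fun i => (β i).contDiff_normed
  have hηc : ∀ i, HasCompactSupport (η i) := fun i => (β i).hasCompactSupport_normed
  let κ : ℕ → EuclideanSpace ℝ (Fin n) → E →L[ℂ] E := fun i => η i ⋆[lsmul ℝ ℝ, volume] K
  have hκ : ∀ i, ContDiff ℝ ((⊤ : ℕ∞) : WithTop ℕ∞) (κ i) := fun i =>
    (hηc i).contDiff_convolution_left _ (hη i) hKl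
  have hκc : ∀ i, HasCompactSupport (κ i) := fun i => (hηc i).convolution _ hKc
  have h0 : ∀ i, ∫ x, κ i x (f x) = 0 := by
    intro i
    rw [h.integral_matrix (hκ i) (hκc i)]
    simp only [κ, sum_fderiv_convolution_eq_zero hKl hK (hη i) (hηc i), integral_zero, neg_zero]
  have hrOut : Tendsto (fun i => (β i).rOut) atTop (𝓝 0) := by
    simpa [β] using tendsto_one_div_add_atTop_nhds_zero_nat (𝕜 := ℝ)
  have hae : ∀ᵐ x, Tendsto (fun i => κ i x) atTop (𝓝 (K x)) :=
    ContDiffBump.ae_convolution_tendsto_right_of_locallyIntegrable (K := 2) hrOut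
      (Eventually.of_forall fun i => by
        change (i + 1 : ℝ)⁻¹ ≤ 2 * (2 * (i + 1 : ℝ))⁻¹
        rw [mul_inv, ← mul_assoc, mul_inv_cancel₀ two_ne_zero, one_mul]) hKl
  have hC : 0 ≤ C := by
    obtain ⟨x, hx⟩ := hKb.exists
    exact (norm_nonneg _).trans hx
  have hbound : ∀ i x, ‖κ i x‖ ≤ C := by
    intro i x
    have h1 : ∫ t, η i (x - t) * C = C := by
      rw [integral_mul_const, integral_sub_left_eq_self (η i) volume x, (β i).integral_normed,
        one_mul]
    rw [← h1]
    change ‖(η i ⋆[lsmul ℝ ℝ, volume] K) x‖ ≤ _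
    rw [convolution_lsmul_swap]
    refine norm_integral_le_of_norm_le
      (((β i).integrable_normed.comp_sub_left x).mul_const C) ?_
    filter_upwards [hKb] with t ht
    rw [norm_smul, Real.norm_of_nonneg ((β i).nonneg_normed _)]
    exact mul_le_mul_of_nonneg_left ht ((β i).nonneg_normed _)
  let T : Set (EuclideanSpace ℝ (Fin n)) :=
    Metric.closedBall (0 : EuclideanSpace ℝ (Fin n)) 1 + tsupport K
  have hT : IsCompact T := (isCompact_closedBall _ _).add hKc
  have hzero : ∀ i x, x ∉ T → κ i x = 0 := by
    intro i x hx
    by_contra hne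
    refine hx ?_
    have h1 := support_convolution_subset (lsmul ℝ ℝ) (μ := volume) (f := η i) (g := K) hne
    refine Set.add_subset_add ?_ (subset_tsupport K) h1
    change Function.support ((β i).normed volume) ⊆ _
    rw [(β i).support_normed_eq]
    refine Metric.ball_subset_closedBall.trans (Metric.closedBall_subset_closedBall ?_)
    change (i + 1 : ℝ)⁻¹ ≤ 1
    exact inv_le_one_of_one_le₀ (by linarith [Nat.cast_nonneg (α := ℝ) i])
  have hfl : LocallyIntegrable f := (Lp.memLp f).locallyIntegrable Fact.out
  have hlim : Tendsto (fun i => ∫ x, κ i x (f x)) atTop (𝓝 (∫ x, K x (f x))) := by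
    refine tendsto_integral_of_dominated_convergence (T.indicator fun x => C * ‖f x‖) (fun i => ?_)
      ?_ (fun i => Eventually.of_forall fun x => ?_) ?_
    · exact (ContinuousLinearMap.id ℂ (E →L[ℂ] E)).aestronglyMeasurable_comp₂
        (hκ i).continuous.aestronglyMeasurable hfl.aestronglyMeasurable
    · exact (integrable_indicator_iff hT.measurableSet).2
        ((hfl.integrableOn_isCompact hT).norm.const_mul C)
    · by_cases hx : x ∈ T
      · rw [indicator_of_mem hx]
        exact ((κ i x).le_opNorm _).trans (mul_le_mul_of_nonneg_right (hbound i x) (norm_nonneg _))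
      · rw [indicator_of_notMem hx, hzero i x hx]; simp
    · filter_upwards [hae] with x hx
      exact ((ContinuousLinearMap.apply ℂ E (f x)).continuous.tendsto _).comp hx
  simp only [h0] at hlim
  exact (tendsto_nhds_unique hlim tendsto_const_nhds)

end Annihilator

/-! ### Nilpotence of `B₁ d* B₂` in `L^p` -/

section Nilpotent

variable {n : ℕ} {E : Type*} [NormedAddCommGroup E] [NormedSpace ℂ E]

theorem coeFn_mulOp (B : Lp (E →L[ℂ] E) ∞ (volume : Measure (EuclideanSpace ℝ (Fin n))))
    {p : ℝ≥0∞} [Fact (1 ≤ p)] (u : Lp E p (volume : Measure (EuclideanSpace ℝ (Fin n)))) :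
    mulOp B p u =ᵐ[volume] fun x => B x (u x) :=
  ContinuousLinearMap.coeFn_holder _ _ _

theorem exists_ae_norm_le {F : Type*} [NormedAddCommGroup F]
    (B : Lp F ∞ (volume : Measure (EuclideanSpace ℝ (Fin n)))) : ∃ C : ℝ, ∀ᵐ x, ‖B x‖ ≤ C := by
  have h := (Lp.memLp B).eLpNorm_lt_top
  rw [eLpNorm_exponent_top] at h
  refine ⟨(eLpNormEssSup B volume).toReal, ?_⟩
  filter_upwards [ae_le_eLpNormEssSup (f := B) (μ := volume)] with x hx
  rw [← toReal_enorm]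
  exact ENNReal.toReal_mono h.ne hx

theorem IsWeakSol.congr_ae {A : Fin n → E →L[ℂ] E} {u f u' f' : EuclideanSpace ℝ (Fin n) → E}
    (h : IsWeakSol A u f) (hu : u =ᵐ[volume] u') (hf : f =ᵐ[volume] f') : IsWeakSol A u' f' := by
  intro φ hφ hc
  have e1 : ∫ x, φ x • f' x = ∫ x, φ x • f x :=
    integral_congr_ae (by filter_upwards [hf] with x hx; rw [hx])
  have e2 : ∫ x, ∑ j, fderiv ℝ φ x (EuclideanSpace.single j 1) • A j (u' x) =
      ∫ x, ∑ j, fderiv ℝ φ x (EuclideanSpace.single j 1) • A j (u x) :=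
    integral_congr_ae (by filter_upwards [hu] with x hx; rw [hx])
  rw [e1, e2, h φ hφ hc]

variable [FiniteDimensional ℂ E] [CompleteSpace E]

/-- The relation `A B₂ B₁ A = 0`, for `A = ∑ⱼ Aⱼ ∂ⱼ`, passes from `L²` to `L^p`: tested with `φ` it
says that the matrix `∑ⱼ ∂ⱼφ Aⱼ B₂ B₁` annihilates the range of `A`. -/
theorem nilpotent_transfer {A : Fin n → E →L[ℂ] E}
    {B₁ B₂ : Lp (E →L[ℂ] E) ∞ (volume : Measure (EuclideanSpace ℝ (Fin n)))}
    (h2 : ∀ f ∈ rangeSpace (firstOrderOp A 2),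
      mulOp B₂ 2 (mulOp B₁ 2 f) ∈ nullSpace (firstOrderOp A 2))
    {p : ℝ≥0∞} [Fact (1 ≤ p)] {f : Lp E p (volume : Measure (EuclideanSpace ℝ (Fin n)))}
    (hf : f ∈ rangeSpace (firstOrderOp A p)) :
    mulOp B₂ p (mulOp B₁ p f) ∈ nullSpace (firstOrderOp A p) := by
  obtain ⟨u, hu⟩ := mem_rangeSpace_iff.1 hf
  rw [mem_graph_firstOrderOp] at hu
  rw [mem_nullSpace_iff, mem_graph_firstOrderOp, isWeakSol_zero_right_iff]
  intro φ hφ hc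
  let K : EuclideanSpace ℝ (Fin n) → E →L[ℂ] E := fun x =>
    ∑ j, fderiv ℝ φ x (EuclideanSpace.single j 1) • (A j ∘L (B₂ x ∘L B₁ x))
  have hKapp : ∀ x w, K x w = ∑ j, fderiv ℝ φ x (EuclideanSpace.single j 1) •
      A j (B₂ x (B₁ x w)) := by
    intro x w
    simp only [K, _root_.sum_apply]
    rfl
  have hKval : ∀ {q : ℝ≥0∞} [Fact (1 ≤ q)]
      (g : Lp E q (volume : Measure (EuclideanSpace ℝ (Fin n)))),
      ∫ x, ∑ j, fderiv ℝ φ x (EuclideanSpace.single j 1) • A j (mulOp B₂ q (mulOp B₁ q g) x) =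
        ∫ x, K x (g x) := by
    intro q _ g
    refine integral_congr_ae ?_
    filter_upwards [coeFn_mulOp B₂ (mulOp B₁ q g), coeFn_mulOp B₁ g] with x h1 h3
    rw [hKapp, h1, h3]
  have hKc : HasCompactSupport K := by
    refine HasCompactSupport.intro hc fun x hx => ?_
    have : fderiv ℝ φ x = 0 := by
      by_contra hne
      exact hx (support_fderiv_subset ℝ hne)
    simp [K, this]
  have hKm : AEStronglyMeasurable K := by
    refine Finset.aestronglyMeasurable_fun_sum _ fun j _ => ?_
    refine (contDiff_partial hφ _).continuous.aestronglyMeasurable.smul ?_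
    refine (ContinuousLinearMap.compL ℂ E E E (A j)).continuous.comp_aestronglyMeasurable ?_
    exact (ContinuousLinearMap.compL ℂ E E E).aestronglyMeasurable_comp₂
      (Lp.aestronglyMeasurable B₂) (Lp.aestronglyMeasurable B₁)
  obtain ⟨C₁, hC₁⟩ := exists_ae_norm_le B₁
  obtain ⟨C₂, hC₂⟩ := exists_ae_norm_le B₂
  have hφb : ∀ j : Fin n, ∃ M : ℝ, ∀ x, ‖fderiv ℝ φ x (EuclideanSpace.single j 1)‖ ≤ M := fun j =>
    (hc.fderiv_apply ℝ _).exists_bound_of_continuous (contDiff_partial hφ _).continuous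
  choose M hM using hφb
  have hKb : ∀ᵐ x, ‖K x‖ ≤ ∑ j, M j * (‖A j‖ * (C₂ * C₁)) := by
    filter_upwards [hC₁, hC₂] with x h1 h3
    refine (norm_sum_le _ _).trans (Finset.sum_le_sum fun j _ => ?_)
    rw [norm_smul]
    have hM0 : 0 ≤ M j := (norm_nonneg _).trans (hM j x)
    have hC0 : 0 ≤ C₂ := (norm_nonneg _).trans h3
    refine mul_le_mul (hM j x) (((A j).opNorm_comp_le _).trans ?_) (norm_nonneg _) hM0
    refine mul_le_mul_of_nonneg_left (((B₂ x).opNorm_comp_le _).trans ?_) (norm_nonneg _)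
    exact mul_le_mul h3 h1 (norm_nonneg _) hC0
  rw [hKval]
  refine integral_eq_zero_of_annihilates hKm hKb hKc (fun η hη hηc w => ?_) hu
  have hv : MemLp (fun x => η x • w) 2 (volume : Measure (EuclideanSpace ℝ (Fin n))) :=
    (hη.continuous.smul continuous_const).memLp_of_hasCompactSupport hηc.smul_right
  have hg : MemLp (fun x => ∑ j, fderiv ℝ η x (EuclideanSpace.single j 1) • A j w) 2
      (volume : Measure (EuclideanSpace ℝ (Fin n))) :=
    memLp_finsetSum _ fun j _ => ((contDiff_partial hη _).continuous.smul
      continuous_const).memLp_of_hasCompactSupport (hηc.fderiv_apply ℝ _).smul_right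
  have hgraph : (hv.toLp, hg.toLp) ∈ (firstOrderOp A 2).graph := by
    rw [mem_graph_firstOrderOp]
    exact (isWeakSol_smul A hη hηc w).congr_ae hv.coeFn_toLp.symm hg.coeFn_toLp.symm
  have h3 := h2 _ (mem_rangeSpace_iff.2 ⟨_, hgraph⟩)
  rw [mem_nullSpace_iff, mem_graph_firstOrderOp, isWeakSol_zero_right_iff] at h3
  rw [← h3 φ hφ hc, hKval]
  refine integral_congr_ae ?_
  filter_upwards [hg.coeFn_toLp] with x hx
  rw [hx]

end Nilpotent

/-! ### The pair `d`, `B₁ d* B₂` -/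

section Pair

variable {n : ℕ} {B₁ B₂ : Coeff n} {p : ℝ≥0∞} [Fact (1 ≤ p)]

theorem mem_graph_gammaStarB {x b : LpForms n p} : (x, b) ∈ (gammaStarB B₁ B₂ p).graph ↔
    ∃ g, (mulOp B₂ p x, g) ∈ (extDStar n p).graph ∧ mulOp B₁ p g = b := by
  constructor
  · intro h
    obtain ⟨y, rfl, rfl⟩ := (LinearPMap.mem_graph_iff _).1 h
    exact ⟨_, (LinearPMap.mem_graph_iff _).2 ⟨⟨mulOp B₂ p y, y.2⟩, rfl, rfl⟩, rfl⟩
  · rintro ⟨g, hg, rfl⟩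
    obtain ⟨y, hy, rfl⟩ := (LinearPMap.mem_graph_iff _).1 hg
    obtain ⟨y, hy'⟩ := y
    obtain rfl : y = mulOp B₂ p x := hy
    exact (LinearPMap.mem_graph_iff _).2 ⟨⟨x, hy'⟩, rfl, rfl⟩

theorem isNilpotentPair_piB (hB : IsPerturbedHodgeDirac B₁ B₂) :
    IsNilpotentPair (extD n p) (gammaStarB B₁ B₂ p) (piB B₁ B₂ p) where
  graph_add x a b ha hb := by
    obtain ⟨y, rfl, rfl⟩ := (LinearPMap.mem_graph_iff _).1 ha
    obtain ⟨z, hz, rfl⟩ := (LinearPMap.mem_graph_iff _).1 hb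
    obtain ⟨z, hz'⟩ := z
    obtain rfl : z = y := hz
    exact (LinearPMap.mem_graph_iff _).2 ⟨⟨y, y.2, hz'⟩, rfl, rfl⟩
  exists_add x z hz := by
    obtain ⟨y, rfl, rfl⟩ := (LinearPMap.mem_graph_iff _).1 hz
    exact ⟨_, _, (LinearPMap.mem_graph_iff _).2 ⟨⟨y, y.2.1⟩, rfl, rfl⟩,
      (LinearPMap.mem_graph_iff _).2 ⟨⟨y, y.2.2⟩, rfl, rfl⟩, rfl⟩
  nilpotent_left x a ha := firstOrderOp_nilpotent wedge_anticomm ha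
  nilpotent_right x b hb := by
    obtain ⟨g, hg, rfl⟩ := mem_graph_gammaStarB.1 hb
    refine mem_graph_gammaStarB.2 ⟨0, mem_nullSpace_iff.1 ?_, map_zero _⟩
    exact nilpotent_transfer hB.nilpotent_dStar (mem_rangeSpace_iff.2 ⟨_, hg⟩)

/-- The operator `J` multiplying the forms of degree `k` by `iᵏ`. -/
def degreeLp (n : ℕ) (p : ℝ≥0∞) [Fact (1 ≤ p)] : LpForms n p →L[ℂ] LpForms n p :=
  (degreeOp n Complex.I).compLpL p volume

theorem norm_degreeLp (u : LpForms n p) : ‖degreeLp n p u‖ = ‖u‖ := by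
  refine le_antisymm (Lp.norm_le_norm_of_ae_le ?_) (Lp.norm_le_norm_of_ae_le ?_) <;>
  · filter_upwards [(degreeOp n Complex.I).coeFn_compLpL u] with x hx
    rw [degreeLp, hx, norm_degreeOp_I]

theorem mulOp_degreeLp {B : Coeff n} (hB : PreservesDegree B) (u : LpForms n p) :
    mulOp B p (degreeLp n p u) = degreeLp n p (mulOp B p u) := by
  refine Lp.ext ?_
  filter_upwards [coeFn_mulOp B (degreeLp n p u), coeFn_mulOp B u, hB,
    (degreeOp n Complex.I).coeFn_compLpL u,
    (degreeOp n Complex.I).coeFn_compLpL (mulOp B p u)] with x h1 h2 h3 h4 h5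
  rw [h1, degreeLp, h4, h5, h2]
  exact congrArg (fun L => L (u x)) (comm_degreeOp h3 Complex.I)

theorem extD_degreeLp {x a : LpForms n p} (h : (x, a) ∈ (extD n p).graph) :
    (degreeLp n p x, -Complex.I • degreeLp n p a) ∈ (extD n p).graph :=
  firstOrderOp_compLp wedge_degreeOp_I h

theorem gammaStarB_degreeLp (hB₁ : PreservesDegree B₁) (hB₂ : PreservesDegree B₂)
    {x b : LpForms n p} (h : (x, b) ∈ (gammaStarB B₁ B₂ p).graph) :
    (degreeLp n p x, Complex.I • degreeLp n p b) ∈ (gammaStarB B₁ B₂ p).graph := by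
  obtain ⟨g, hg, rfl⟩ := mem_graph_gammaStarB.1 h
  refine mem_graph_gammaStarB.2 ⟨Complex.I • degreeLp n p g, ?_, ?_⟩
  · rw [mulOp_degreeLp hB₂]
    refine firstOrderOp_compLp (fun j w => ?_) hg
    rw [_root_.neg_apply, _root_.neg_apply, adjoint_wedge_degreeOp_I, map_neg, smul_neg]
  · rw [map_smul, mulOp_degreeLp hB₁]

end Pair

end HodgeDirac

end

theorem proposition4p1 (n : ℕ) (hn : 0 < n) (B₁ B₂ : HodgeDirac.Coeff n)
    (hB : HodgeDirac.IsPerturbedHodgeDirac B₁ B₂)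
    (hB₁ : HodgeDirac.PreservesDegree B₁) (hB₂ : HodgeDirac.PreservesDegree B₂)
    (p : ℝ≥0∞) [Fact (1 ≤ p)] (hp : 1 < p) (hp' : p < ∞)
    (hinv : HodgeDirac.InvertibilityCondition B₁ B₂ p)
    (ω μ : ℝ) (hω : 0 ≤ ω) (hωμ : ω < μ) (hμ : μ < Real.pi / 2)
    (hbis : HodgeDirac.IsBisectorial (HodgeDirac.piB B₁ B₂ p) ω)
    (hcalc : HodgeDirac.HasBoundedHInftyCalculus (HodgeDirac.piB B₁ B₂ p) ω μ) :
    p ∈ HodgeDirac.hodgeExponents B₁ B₂ := by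
  obtain ⟨E, M, C, hE, hC⟩ := HodgeDirac.exists_family_of_calculus hω hμ hbis hcalc
  have hpair := HodgeDirac.isNilpotentPair_piB (p := p) hB
  have hX : HodgeDirac.HasConvexLimits (HodgeDirac.LpForms n p) :=
    HodgeDirac.hasConvexLimits_Lp hp hp'
  obtain ⟨K, hK⟩ := hpair.exists_norm_sub_le hE hX hC
    (fun _ _ => HodgeDirac.extD_degreeLp)
    (fun _ _ => HodgeDirac.gammaStarB_degreeLp hB₁ hB₂) HodgeDirac.norm_degreeLp
  -- `2 a = (a + b) + (a - b)` and `2 b = (a + b) - (a - b)`.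
  have hle : ∀ x a b, (x, a) ∈ (HodgeDirac.extD n p).graph →
      (x, b) ∈ (HodgeDirac.gammaStarB B₁ B₂ p).graph →
      ‖a‖ ≤ (1 + |K|) * ‖a + b‖ ∧ ‖b‖ ≤ (1 + |K|) * ‖a + b‖ := by
    intro x a b ha hb
    have h1 := hK x a b ha hb
    have h2 : K * ‖a + b‖ ≤ |K| * ‖a + b‖ :=
      mul_le_mul_of_nonneg_right (le_abs_self K) (norm_nonneg _)
    have h3 : ‖(2 : ℂ) • a‖ ≤ ‖a + b‖ + ‖a - b‖ := by
      rw [show (2 : ℂ) • a = (a + b) + (a - b) by rw [two_smul]; abel]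
      exact norm_add_le _ _
    have h4 : ‖(2 : ℂ) • b‖ ≤ ‖a + b‖ + ‖a - b‖ := by
      rw [show (2 : ℂ) • b = (a + b) - (a - b) by rw [two_smul]; abel]
      exact norm_sub_le _ _
    rw [norm_smul, Complex.norm_ofNat] at h3 h4
    have h5 : 0 ≤ |K| * ‖a + b‖ := by positivity
    have h6 := norm_nonneg (a + b)
    constructor <;> linarith
  obtain ⟨c1, c2, c3, c4, c5, c6⟩ := hpair.hodge_splitting hE hX (K := 1 + |K|) (by positivity)
    (fun x a b ha hb => (hle x a b ha hb).1) (fun x a b ha hb => (hle x a b ha hb).2)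
  exact ⟨hp', hp, ⟨hinv, c1, c2, c3, c4, c5, c6⟩⟩
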